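/- **Setting.** Let $\kappa$ be the security parameter and let $|Q|,|\Sigma|,n\ge 1$ be public sizes bounded by polynomials in $\kappa$. The server holds a finite-state machine $\mathcal M=(Q,q_0,\Sigma,\delta,Q_{\mathsf{accept}})$ with $Q=\{0,\dots,|Q|-1\}$, and the client holds a string $x=x_1\cdots x_n\in\Sigma^n$. The functionality gives the server a uniformly random bit $r$ and the client the bit $z=r+\mathcal M(x)\bmod 2$, where $\mathcal M(x)=1$ if $\mathcal M$ accepts $x$ and $\mathcal M(x)=0$ otherwise. Write $\ell=\lceil\log_2|Q|\rceil+\kappa$, and let $H:\{0,1\}^{\kappa+\lceil\log_2|\Sigma|\rceil}\to\{0,1\}^{\ell}$ be a random oracle, to which all parties, adversaries, simulators and distinguishers have access. States, symbols and integers are written in binary. Let $(\mathsf{Gen},\mathsf{Enc},\mathsf{Dec})$ be an additively homomorphic public-key encryption scheme with plaintext space $\mathbb Z_N$, where $N$ depends on the public key $pk$ and $N\ge 2^{|Q|\ell}$ (so that a column of $|Q|$ strings of $\ell$ bits, read as an integer, is a plaintext). All its algorithms, including addition $*$ of ciphertexts and multiplication of a ciphertext by a constant, are polynomial-time, and decryption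 is correct on all ciphertexts obtained from encryptions by these operations. The scheme is assumed to be * IND-CPA secure against non-uniform polynomial-time adversaries with access to $H$, and * re-randomizable: there is a negligible $\varepsilon(\kappa)$ such that, for every key pair and every ciphertext $c$ of a plaintext $m$ obtained from encryptions by homomorphic operations, $\mathsf{Enc}_{pk}(0)*c$ (with fresh coins) has statistical distance at most $\varepsilon(\kappa)$ from a fresh encryption $\mathsf{Enc}_{pk}(m)$. **The protocol $\pi$.** 1. The client generates a key pair $(pk,sk)$ and sends $pk$ and, for $i=1,\dots,n$ and $\sigma\in\Sigma$, the ciphertexts $c_{i,\sigma}=\mathsf{Enc}_{pk}(v_{i,\sigma})$, where $v_{i,\sigma}=1$ if $x_i=\sigma$ and $v_{i,\sigma}=0$ otherwise. 2. The server picks uniformly random rotations $r_i\in\mathbb Z_{|Q|}$ and keys $k^i_q\in\{0,1\}^\kappa$ ($1\le i\le n$, $q\in Q$), and a uniformly random bit $r$. With $q'=\delta(q-r_i,\sigma)$, it sets, for $i<n$, $$G(q,\sigma,i)=H(k^i_q\,\|\,\sigma)\oplus\bigl(q'+r_{i+1}\,\big\|\,k^{i+1}_{q'+r_{i+1}}\bigr),$$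 and $G(q,\sigma,n)=H(k^n_q\,\|\,\sigma)\oplus(r+[q'\in Q_{\mathsf{accept}}]\bmod 2)$, the bit being padded with zeros to $\ell$ bits (state arithmetic is modulo $|Q|$). For each $i$ it reads the column $G(\cdot,\sigma,i)$ as an integer $b_{i,\sigma}$ and forms $d_i$ by multiplying $c_{i,\sigma}$ by the constant $b_{i,\sigma}$ for each $\sigma$, adding up the results homomorphically over $\sigma$, and adding a fresh encryption of $0$. It sends $d_1,\dots,d_n$, the rotated initial state $q_{\mathsf{Init}}=q_0+r_1$ and its key $k^1_{q_{\mathsf{Init}}}$. Its output is $r$. 3. The client decrypts $d_1,\dots,d_n$, which gives the columns $G(\cdot,x_i,i)$. Starting from $(q_{\mathsf{Init}},k^1_{q_{\mathsf{Init}}})$, it recovers for $i=1,\dots,n$ the plaintext of the entry of the current state under the current key. Its output is the bit recovered for $i=n$. **Theorem.** Under these assumptions: 1. *($\pi$ is simulation-secure against a semi-honest client.)* There is a non-uniform probabilistic polynomial-time simulator $\mathcal S$, with access to $H$ but unable to program it, such that for all inputs $\mathcal M,x$ and all auxiliary inputs of polynomial length, the ensembles * the client's view in $\pi$ (auxiliary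 input, $x$, the client's coins, the messages received) together with the outputs of the client and of the server, and * $\mathcal S(\text{auxiliary input},x,z)$ together with $(z,r)$, where $r$ is a uniformly random bit and $z=r+\mathcal M(x)\bmod 2$, are computationally indistinguishable by non-uniform polynomial-time distinguishers with access to $H$. 2. *($\pi$ is private against a malicious server.)* Let a non-uniform polynomial-time adversary with access to $H$ choose $x^0,x^1\in\Sigma^n$, and let a client with input $x^b$, for a uniformly random bit $b$, run $\pi$ with the adversary, which may deviate arbitrarily from the protocol and finally outputs a bit $b'$. Then $\Pr[b'=b]-\tfrac12$ is negligible in $\kappa$ for every such adversary. -/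

import Mathlib

namespace ObliviousFSM

open Asymptotics Filter

/-! ## Bit strings, uniform probability, asymptotics -/

/-- Bit strings whose positions are indexed by `ι` (usually `Fin w`; sums and products of such types
index concatenations and arrays of bit strings). -/
abbrev Bits (ι : Type) : Type := ι → Bool

/-- The `w` low-order bits of the natural number `m` (bit `0` is the least significant one). -/
def natBits (w m : ℕ) : Bits (Fin w) := fun j => m.testBit j

/-- Bitwise exclusive or. -/
def bxor {ι : Type} (a b : Bits ι) : Bits ι := fun j => xor (a j) (b j)

/-- The probability of the event `p` when `ω` is uniform on the finite sample space `Ω`. -/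
noncomputable def prob {Ω : Type} [Fintype Ω] (p : Ω → Bool) : ℝ :=
  ((Finset.univ.filter fun ω => p ω = true).card : ℝ) / (Fintype.card Ω : ℝ)

/-- Statistical distance of the random variables `f` and `g`, each on its own uniform space. -/
noncomputable def statDist {Ω Ω' α : Type} [Fintype Ω] [Fintype Ω'] [Fintype α] [DecidableEq α]
    (f : Ω → α) (g : Ω' → α) : ℝ :=
  (1 / 2) * ∑ a : α, |prob (fun ω => decide (f ω = a)) - prob (fun ω => decide (g ω = a))|

/-- `f` is negligible: `κ ^ c * f κ → 0` for every `c`. -/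
def Negligible (f : ℕ → ℝ) : Prop := SuperpolynomialDecay atTop (fun κ : ℕ => (κ : ℝ)) f

/-- `f` is bounded by a polynomial. -/
def PolyBounded (f : ℕ → ℕ) : Prop := ∃ p : Polynomial ℕ, ∀ κ, f κ ≤ p.eval κ

/-! ## Boolean circuits with oracle gates

Non-uniform polynomial time is polynomial circuit size. Randomised algorithms receive their coins as
additional uniformly random input bits. -/

/-- A gate with access to the input bits (indexed by `ι`) and to the values of the earlier gates
(indexed by their position). An oracle gate sends `a` bits to the oracle and outputs one selected bit
of the `b`-bit answer. -/
inductive Gate (a b : ℕ) (ι : Type) : Type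
  | const (v : Bool)
  | nand (u v : ι ⊕ ℕ)
  | oracle (query : Fin a → ι ⊕ ℕ) (j : Fin b)

/-- Value of a wire, given the inputs and the values of the gates so far; a reference to a gate that
has not been evaluated reads `false`. -/
def wire {ι : Type} (x : Bits ι) (vals : List Bool) : ι ⊕ ℕ → Bool
  | Sum.inl i => x i
  | Sum.inr k => vals.getD k false

def Gate.eval {a b : ℕ} {ι : Type} (H : Bits (Fin a) → Bits (Fin b)) (x : Bits ι)
    (vals : List Bool) : Gate a b ι → Bool
  | Gate.const v => v
  | Gate.nand u v => !(wire x vals u && wire x vals v)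
  | Gate.oracle query j => H (fun t => wire x vals (query t)) j

def Gate.cost {a b : ℕ} {ι : Type} : Gate a b ι → ℕ
  | Gate.const _ => 1
  | Gate.nand _ _ => 1
  | Gate.oracle _ _ => 1 + a + b

/-- Circuits with inputs indexed by `ι`, outputs indexed by `ο`, and access to an oracle from `a` bits
to `b` bits. With `a = b = 0` there are no oracle gates. -/
structure Circuit (a b : ℕ) (ι ο : Type) : Type where
  gates : List (Gate a b ι)
  outs : ο → ι ⊕ ℕ

def Circuit.run {a b : ℕ} {ι ο : Type} (C : Circuit a b ι ο) (H : Bits (Fin a) → Bits (Fin b))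
    (x : Bits ι) : Bits ο :=
  fun o => wire x (C.gates.foldl (fun vals g => vals ++ [g.eval H x vals]) []) (C.outs o)

/-- Total gate cost plus the number of inputs and outputs. -/
def Circuit.size {a b : ℕ} {ι ο : Type} [Fintype ι] [Fintype ο] (C : Circuit a b ι ο) : ℕ :=
  (C.gates.map Gate.cost).sum + Fintype.card ι + Fintype.card ο

/-- The family `f` is computed by oracle-free circuits of polynomial size. -/
def PolyComputable {ι ο : ℕ → Type} [∀ κ, Fintype (ι κ)] [∀ κ, Fintype (ο κ)]
    (f : ∀ κ, Bits (ι κ) → Bits (ο κ)) : Prop :=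
  ∃ C : ∀ κ, Circuit 0 0 (ι κ) (ο κ),
    PolyBounded (fun κ => (C κ).size) ∧ ∀ κ x, (C κ).run id x = f κ x

/-! ## Additively homomorphic public-key encryption -/

/-- The algorithms of an additively homomorphic scheme, for every security parameter `κ`. The plaintext
space under the public key `pk` is `ZMod (modulus κ pk)`; the plaintext `m` is handed to the algorithms
as the `msgLen κ`-bit string of its representative in `{0, …, modulus κ pk - 1}`. The last argument of
`enc`, and the argument of `gen`, are the random coins. -/
structure HEAlgorithms : Type where
  pkLen : ℕ → ℕ
  skLen : ℕ → ℕ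
  msgLen : ℕ → ℕ
  ctLen : ℕ → ℕ
  genCoins : ℕ → ℕ
  encCoins : ℕ → ℕ
  modulus : ∀ κ, Bits (Fin (pkLen κ)) → ℕ
  gen : ∀ κ, Bits (Fin (genCoins κ)) → Bits (Fin (pkLen κ)) × Bits (Fin (skLen κ))
  enc : ∀ κ, Bits (Fin (pkLen κ)) → Bits (Fin (msgLen κ)) → Bits (Fin (encCoins κ)) →
    Bits (Fin (ctLen κ))
  dec : ∀ κ, Bits (Fin (skLen κ)) → Bits (Fin (ctLen κ)) → Bits (Fin (msgLen κ))
  add : ∀ κ, Bits (Fin (pkLen κ)) → Bits (Fin (ctLen κ)) → Bits (Fin (ctLen κ)) →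
    Bits (Fin (ctLen κ))
  smul : ∀ κ, Bits (Fin (pkLen κ)) → Bits (Fin (msgLen κ)) → Bits (Fin (ctLen κ)) →
    Bits (Fin (ctLen κ))

/-- `IsCt E κ pk c m`: the ciphertext `c` results from encryptions under `pk` by homomorphic additions
and multiplications by constants, and the same operations on plaintexts give `m`. -/
inductive IsCt (E : HEAlgorithms) (κ : ℕ) (pk : Bits (Fin (E.pkLen κ))) :
    Bits (Fin (E.ctLen κ)) → ZMod (E.modulus κ pk) → Prop
  | enc (m : Bits (Fin (E.msgLen κ))) (coins : Bits (Fin (E.encCoins κ)))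
      (hm : Nat.ofBits m < E.modulus κ pk) :
      IsCt E κ pk (E.enc κ pk m coins) (Nat.ofBits m : ZMod (E.modulus κ pk))
  | add {c c' : Bits (Fin (E.ctLen κ))} {m m' : ZMod (E.modulus κ pk)}
      (h : IsCt E κ pk c m) (h' : IsCt E κ pk c' m') :
      IsCt E κ pk (E.add κ pk c c') (m + m')
  | smul (s : Bits (Fin (E.msgLen κ))) (hs : Nat.ofBits s < E.modulus κ pk)
      {c : Bits (Fin (E.ctLen κ))} {m : ZMod (E.modulus κ pk)} (h : IsCt E κ pk c m) :
      IsCt E κ pk (E.smul κ pk s c) ((Nat.ofBits s : ZMod (E.modulus κ pk)) * m)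

/-- An additively homomorphic encryption scheme: decryption is correct on all ciphertexts obtained from
encryptions by the homomorphic operations, and every algorithm is efficient. -/
structure HEScheme : Type extends HEAlgorithms where
  modulus_le : ∀ κ (g : Bits (Fin (genCoins κ))), modulus κ (gen κ g).1 ≤ 2 ^ msgLen κ
  dec_correct : ∀ κ (g : Bits (Fin (genCoins κ))) c m, IsCt toHEAlgorithms κ (gen κ g).1 c m →
    Nat.ofBits (dec κ (gen κ g).2 c) < modulus κ (gen κ g).1 ∧
      (Nat.ofBits (dec κ (gen κ g).2 c) : ZMod (modulus κ (gen κ g).1)) = m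
  gen_poly : PolyComputable (ι := fun κ => Fin (genCoins κ))
    (ο := fun κ => Fin (pkLen κ) ⊕ Fin (skLen κ))
    (fun κ g => Sum.elim (gen κ g).1 (gen κ g).2)
  enc_poly : PolyComputable (ι := fun κ => Fin (pkLen κ) ⊕ Fin (msgLen κ) ⊕ Fin (encCoins κ))
    (ο := fun κ => Fin (ctLen κ))
    (fun κ w => enc κ (fun j => w (.inl j)) (fun j => w (.inr (.inl j)))
      (fun j => w (.inr (.inr j))))
  dec_poly : PolyComputable (ι := fun κ => Fin (skLen κ) ⊕ Fin (ctLen κ))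
    (ο := fun κ => Fin (msgLen κ))
    (fun κ w => dec κ (fun j => w (.inl j)) (fun j => w (.inr j)))
  add_poly : PolyComputable (ι := fun κ => Fin (pkLen κ) ⊕ Fin (ctLen κ) ⊕ Fin (ctLen κ))
    (ο := fun κ => Fin (ctLen κ))
    (fun κ w => add κ (fun j => w (.inl j)) (fun j => w (.inr (.inl j)))
      (fun j => w (.inr (.inr j))))
  smul_poly : PolyComputable (ι := fun κ => Fin (pkLen κ) ⊕ Fin (msgLen κ) ⊕ Fin (ctLen κ))
    (ο := fun κ => Fin (ctLen κ))
    (fun κ w => smul κ (fun j => w (.inl j)) (fun j => w (.inr (.inl j)))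
      (fun j => w (.inr (.inr j))))

/-- Adding a fresh encryption of `0` re-randomises: the result is statistically close to a fresh
encryption of the same plaintext, for every key pair and every ciphertext obtained from encryptions by
the homomorphic operations. -/
def HEScheme.Rerandomizable (E : HEScheme) : Prop :=
  ∃ ε : ℕ → ℝ, Negligible ε ∧
    ∀ κ (g : Bits (Fin (E.genCoins κ))) (c : Bits (Fin (E.ctLen κ)))
      (m : Bits (Fin (E.msgLen κ))),
      Nat.ofBits m < E.modulus κ (E.gen κ g).1 →
      IsCt E.toHEAlgorithms κ (E.gen κ g).1 c (Nat.ofBits m : ZMod (E.modulus κ (E.gen κ g).1)) →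
      statDist
        (fun ρ : Bits (Fin (E.encCoins κ)) =>
          E.add κ (E.gen κ g).1 (E.enc κ (E.gen κ g).1 (natBits (E.msgLen κ) 0) ρ) c)
        (fun ρ : Bits (Fin (E.encCoins κ)) => E.enc κ (E.gen κ g).1 m ρ) ≤ ε κ

/-- An IND-CPA adversary with access to an oracle from `a κ` to `b κ` bits. From the public key and its
coins, `choose` produces two messages and a state; from the state and the challenge ciphertext, `guess`
produces a bit. -/
structure CPAAdversary (E : HEScheme) (a b : ℕ → ℕ) : Type where
  coins : ℕ → ℕ
  stateLen : ℕ → ℕ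
  choose : ∀ κ, Circuit (a κ) (b κ) (Fin (E.pkLen κ) ⊕ Fin (coins κ))
    ((Fin (E.msgLen κ) ⊕ Fin (E.msgLen κ)) ⊕ Fin (stateLen κ))
  guess : ∀ κ, Circuit (a κ) (b κ) (Fin (stateLen κ) ⊕ Fin (E.ctLen κ)) Unit
  choose_poly : PolyBounded fun κ => (choose κ).size
  guess_poly : PolyBounded fun κ => (guess κ).size

/-- The message with index `β` chosen by the adversary. -/
def CPAAdversary.msg {E : HEScheme} {a b : ℕ → ℕ} (A : CPAAdversary E a b) (κ : ℕ)
    (H : Bits (Fin (a κ)) → Bits (Fin (b κ))) (pk : Bits (Fin (E.pkLen κ)))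
    (r : Bits (Fin (A.coins κ))) (β : Bool) : Bits (Fin (E.msgLen κ)) :=
  fun j => (A.choose κ).run H (Sum.elim pk r) (.inl (if β then .inr j else .inl j))

/-- The adversary always chooses two elements of the plaintext space. -/
def CPAAdversary.Admissible {E : HEScheme} {a b : ℕ → ℕ} (A : CPAAdversary E a b) : Prop :=
  ∀ κ H g r β, Nat.ofBits (A.msg κ H (E.gen κ g).1 r β) < E.modulus κ (E.gen κ g).1

/-- The probability that the adversary guesses the challenge bit. The sample is the random oracle, the
challenge bit, the key-generation coins, the adversary's coins, and the encryption coins. -/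
noncomputable def CPAAdversary.winProb {E : HEScheme} {a b : ℕ → ℕ} (A : CPAAdversary E a b)
    (κ : ℕ) : ℝ :=
  prob fun ω : (Bits (Fin (a κ)) → Bits (Fin (b κ))) × Bool × Bits (Fin (E.genCoins κ)) ×
      Bits (Fin (A.coins κ)) × Bits (Fin (E.encCoins κ)) =>
    match ω with
    | (H, β, g, r, ρ) =>
      let pk := (E.gen κ g).1
      let st : Bits (Fin (A.stateLen κ)) := fun j => (A.choose κ).run H (Sum.elim pk r) (.inr j)
      let c := E.enc κ pk (A.msg κ H pk r β) ρ
      (A.guess κ).run H (Sum.elim st c) () == β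

/-- IND-CPA security against non-uniform polynomial-time adversaries, in the model with a random oracle
from `a κ` to `b κ` bits. -/
def HEScheme.IndCPA (E : HEScheme) (a b : ℕ → ℕ) : Prop :=
  ∀ A : CPAAdversary E a b, A.Admissible → Negligible fun κ => A.winProb κ - 1 / 2

/-! ## The functionality -/

/-- The public sizes: number of states, number of symbols, input length. -/
structure Sizes : Type where
  Q : ℕ
  A : ℕ
  n : ℕ
  Q_pos : 0 < Q
  A_pos : 0 < A
  n_pos : 0 < n

instance (s : Sizes) : NeZero s.Q := ⟨s.Q_pos.ne'⟩
instance (s : Sizes) : NeZero s.A := ⟨s.A_pos.ne'⟩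
instance (s : Sizes) : NeZero s.n := ⟨s.n_pos.ne'⟩

/-- Length of the binary encoding of a state. -/
def Sizes.stateBits (s : Sizes) : ℕ := Nat.clog 2 s.Q

/-- Length of the binary encoding of a symbol. -/
def Sizes.symBits (s : Sizes) : ℕ := Nat.clog 2 s.A

/-- Length of one entry of a garbled matrix: a state followed by a key. -/
def Sizes.entryLen (s : Sizes) (κ : ℕ) : ℕ := s.stateBits + κ

/-- Length of the inputs to the hash function: a key followed by a symbol. -/
def Sizes.hashLen (s : Sizes) (κ : ℕ) : ℕ := κ + s.symBits

/-- The server's private input. -/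
abbrev FSM (s : Sizes) : Type := DFA (Fin s.A) (Fin s.Q)

/-- The client's private input. -/
abbrev Input (s : Sizes) : Type := Fin s.n → Fin s.A

open Classical in
/-- The output of the machine: `1` if the string is accepted, `0` otherwise. -/
noncomputable def FSM.output {s : Sizes} (M : FSM s) (x : Input s) : Bool :=
  decide (List.ofFn x ∈ M.accepts)

/-- The client's share of the output in the ideal execution, when the server's share is `r`; shares are
additive modulo `2`. -/
noncomputable def clientShare {s : Sizes} (M : FSM s) (x : Input s) (r : Bool) : Bool :=
  xor r (M.output x)

/-! ## The protocol -/

/-- The hash function, modelled as a random oracle. -/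
abbrev Hash (s : Sizes) (κ : ℕ) : Type :=
  Bits (Fin (s.hashLen κ)) → Bits (Fin (s.entryLen κ))

/-- The coins of the server: the rotations `r_i`, the keys `k_q^i`, the output mask `r`, and the coins
of the re-randomising encryptions of `0`. -/
abbrev ServerCoins (E : HEScheme) (s : Sizes) (κ : ℕ) : Type :=
  (Fin s.n → Fin s.Q) × (Fin s.n → Fin s.Q → Bits (Fin κ)) × Bool ×
    (Fin s.n → Bits (Fin (E.encCoins κ)))

/-- The coins of the client: those of the key generation and those of the encryptions. -/
abbrev ClientCoins (E : HEScheme) (s : Sizes) (κ : ℕ) : Type :=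
  Bits (Fin (E.genCoins κ)) × (Fin s.n → Fin s.A → Bits (Fin (E.encCoins κ)))

/-- The string `q || k`. -/
def packEntry {s : Sizes} {κ : ℕ} (q : Fin s.Q) (k : Bits (Fin κ)) : Bits (Fin (s.entryLen κ)) :=
  Fin.append (natBits s.stateBits q) k

/-- The string `k || σ`. -/
def packQuery {s : Sizes} {κ : ℕ} (k : Bits (Fin κ)) (σ : Fin s.A) : Bits (Fin (s.hashLen κ)) :=
  Fin.append k (natBits s.symBits σ)

open Classical in
/-- The garbled entry `G(q, σ, i)`. The states are `0, …, |Q| - 1` and the rotations are modulo `|Q|`.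
In the last matrix the next state and its key are replaced by the masked output bit (the `0`-th bit of
the plaintext, padded with zeros). -/
noncomputable def garble {s : Sizes} {κ : ℕ} (H : Hash s κ) (M : FSM s) (rot : Fin s.n → Fin s.Q)
    (key : Fin s.n → Fin s.Q → Bits (Fin κ)) (mask : Bool) (q : Fin s.Q) (σ : Fin s.A)
    (i : Fin s.n) : Bits (Fin (s.entryLen κ)) :=
  let next : Fin s.Q := M.step (q - rot i) σ
  bxor (H (packQuery (key i q) σ))
    (if h : i.val + 1 < s.n then
      packEntry (next + rot ⟨i.val + 1, h⟩) (key ⟨i.val + 1, h⟩ (next + rot ⟨i.val + 1, h⟩))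
    else
      natBits (s.entryLen κ) (xor mask (decide (next ∈ M.accept))).toNat)

/-- A column of `|Q|` entries, read as one natural number below `2 ^ (|Q| (log |Q| + κ))`. -/
def columnToNat {s : Sizes} {κ : ℕ} (col : Fin s.Q → Bits (Fin (s.entryLen κ))) : ℕ :=
  Nat.ofBits fun t : Fin (s.Q * s.entryLen κ) =>
    col (finProdFinEquiv.symm t).1 (finProdFinEquiv.symm t).2

/-- Inverse of `columnToNat`. -/
def natToColumn (s : Sizes) (κ : ℕ) (m : ℕ) : Fin s.Q → Bits (Fin (s.entryLen κ)) :=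
  fun q j => m.testBit (finProdFinEquiv (q, j) : Fin (s.Q * s.entryLen κ))

/-- First message of the oblivious transfers: the client encrypts the one-hot encodings of its symbols,
with a fresh key pair. -/
def clientMessage (E : HEScheme) {s : Sizes} {κ : ℕ} (x : Input s) (cc : ClientCoins E s κ) :
    Bits (Fin (E.pkLen κ)) × (Fin s.n → Fin s.A → Bits (Fin (E.ctLen κ))) :=
  ((E.gen κ cc.1).1, fun i σ =>
    E.enc κ (E.gen κ cc.1).1 (natBits (E.msgLen κ) (if x i = σ then 1 else 0)) (cc.2 i σ))

/-- Homomorphic sum of a non-empty list of ciphertexts. -/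
def sumCt (E : HEScheme) (κ : ℕ) (pk : Bits (Fin (E.pkLen κ))) :
    List (Bits (Fin (E.ctLen κ))) → Bits (Fin (E.ctLen κ))
  | [] => fun _ => false
  | [c] => c
  | c :: c' :: cs => E.add κ pk c (sumCt E κ pk (c' :: cs))

/-- The server's side of one oblivious transfer with inputs `b σ`: multiply the ciphertexts by the
inputs, add up, and re-randomise by adding an encryption of `0`. -/
def otAnswer (E : HEScheme) {s : Sizes} {κ : ℕ} (pk : Bits (Fin (E.pkLen κ)))
    (c : Fin s.A → Bits (Fin (E.ctLen κ))) (b : Fin s.A → ℕ) (ρ : Bits (Fin (E.encCoins κ))) :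
    Bits (Fin (E.ctLen κ)) :=
  E.add κ pk (E.enc κ pk (natBits (E.msgLen κ) 0) ρ)
    (sumCt E κ pk (List.ofFn fun σ => E.smul κ pk (natBits (E.msgLen κ) (b σ)) (c σ)))

/-- The server's message: the answers in the `n` oblivious transfers, whose inputs are the columns of the
garbled matrices, and the (rotated) initial state together with its key. -/
noncomputable def serverMessage (E : HEScheme) {s : Sizes} {κ : ℕ} (H : Hash s κ) (M : FSM s)
    (msg : Bits (Fin (E.pkLen κ)) × (Fin s.n → Fin s.A → Bits (Fin (E.ctLen κ))))
    (sc : ServerCoins E s κ) :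
    (Fin s.n → Bits (Fin (E.ctLen κ))) × Bits (Fin (s.entryLen κ)) :=
  match sc with
  | (rot, key, mask, ρ) =>
    (fun i => otAnswer E msg.1 (msg.2 i)
        (fun σ => columnToNat fun q => garble H M rot key mask q σ i) (ρ i),
      packEntry (M.start + rot 0) (key 0 (M.start + rot 0)))

/-- The client's evaluation: starting from the string `q || k` sent by the server, decrypt in every
received column the entry of the current state under the current key; the output is the `0`-th bit of
the last plaintext. -/
def clientOutput (E : HEScheme) {s : Sizes} {κ : ℕ} (H : Hash s κ) (x : Input s)
    (cc : ClientCoins E s κ)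
    (reply : (Fin s.n → Bits (Fin (E.ctLen κ))) × Bits (Fin (s.entryLen κ))) : Bool :=
  let sk := (E.gen κ cc.1).2
  let last : Bits (Fin (s.entryLen κ)) :=
    (List.finRange s.n).foldl
      (fun (e : Bits (Fin (s.entryLen κ))) i =>
        let q : Fin s.Q := Fin.ofNat s.Q (Nat.ofBits fun j => e (Fin.castAdd κ j))
        let k : Bits (Fin κ) := fun j => e (Fin.natAdd s.stateBits j)
        bxor (H (packQuery k (x i)))
          (natToColumn s κ (Nat.ofBits (E.dec κ sk (reply.1 i))) q))
      reply.2
  (Nat.ofBits last).testBit 0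

/-! ## Security -/

/-- Positions of the bits of the client's view: auxiliary input, input string, key-generation coins,
encryption coins, oblivious-transfer answers, and initial state and key. -/
abbrev ViewIdx (E : HEScheme) (s : Sizes) (κ auxLen : ℕ) : Type :=
  Fin auxLen ⊕ (Fin s.n × Fin s.symBits) ⊕ Fin (E.genCoins κ) ⊕
    (Fin s.n × Fin s.A × Fin (E.encCoins κ)) ⊕ (Fin s.n × Fin (E.ctLen κ)) ⊕
    Fin (s.entryLen κ)

/-- The binary encoding of the client's input. -/
def inputBits {s : Sizes} (x : Input s) : Bits (Fin s.n × Fin s.symBits) :=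
  fun p => natBits s.symBits (x p.1) p.2

/-- The view of the semi-honest client. (The answers of the random oracle are available to everyone.) -/
def clientView (E : HEScheme) {s : Sizes} {κ auxLen : ℕ} (aux : Bits (Fin auxLen)) (x : Input s)
    (cc : ClientCoins E s κ)
    (reply : (Fin s.n → Bits (Fin (E.ctLen κ))) × Bits (Fin (s.entryLen κ))) :
    Bits (ViewIdx E s κ auxLen) :=
  Sum.elim aux <| Sum.elim (inputBits x) <| Sum.elim cc.1 <|
    Sum.elim (fun p => cc.2 p.1 p.2.1 p.2.2) <| Sum.elim (fun p => reply.1 p.1 p.2) reply.2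

/-- A simulator for the client: from the auxiliary input, the client's input, the client's share of the
output and its coins it produces a view. -/
structure Simulator (E : HEScheme) (s : ℕ → Sizes) (auxLen : ℕ → ℕ) : Type where
  coins : ℕ → ℕ
  circuit : ∀ κ, Circuit ((s κ).hashLen κ) ((s κ).entryLen κ)
    (Fin (auxLen κ) ⊕ (Fin (s κ).n × Fin (s κ).symBits) ⊕ Unit ⊕ Fin (coins κ))
    (ViewIdx E (s κ) κ (auxLen κ))
  circuit_poly : PolyBounded fun κ => (circuit κ).size

/-- A distinguisher: it receives a view of the client, the outputs of the client and of the server, and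
coins, and produces a bit. -/
structure Distinguisher (E : HEScheme) (s : ℕ → Sizes) (auxLen : ℕ → ℕ) : Type where
  coins : ℕ → ℕ
  circuit : ∀ κ, Circuit ((s κ).hashLen κ) ((s κ).entryLen κ)
    (ViewIdx E (s κ) κ (auxLen κ) ⊕ (Unit ⊕ Unit) ⊕ Fin (coins κ)) Unit
  circuit_poly : PolyBounded fun κ => (circuit κ).size

/-- The distinguisher's decision on a view `v`, client output `z`, server output `r`, coins `t`. -/
def Distinguisher.decide {E : HEScheme} {s : ℕ → Sizes} {auxLen : ℕ → ℕ}
    (D : Distinguisher E s auxLen) (κ : ℕ) (H : Hash (s κ) κ)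
    (v : Bits (ViewIdx E (s κ) κ (auxLen κ))) (z r : Bool) (t : Bits (Fin (D.coins κ))) : Bool :=
  (D.circuit κ).run H (Sum.elim v (Sum.elim (Sum.elim (fun _ => z) (fun _ => r)) t)) ()

/-- Probability that the distinguisher outputs `1` on the view of the client and the outputs of both
parties in a real execution. The server outputs its mask `r`. -/
noncomputable def realProb (E : HEScheme) (s : ℕ → Sizes) (auxLen : ℕ → ℕ)
    (D : Distinguisher E s auxLen) (κ : ℕ) (M : FSM (s κ)) (x : Input (s κ))
    (aux : Bits (Fin (auxLen κ))) : ℝ :=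
  prob fun ω : Hash (s κ) κ × ClientCoins E (s κ) κ × ServerCoins E (s κ) κ ×
      Bits (Fin (D.coins κ)) =>
    match ω with
    | (H, cc, sc, t) =>
      let reply := serverMessage E H M (clientMessage E x cc) sc
      D.decide κ H (clientView E aux x cc reply) (clientOutput E H x cc reply) sc.2.2.1 t

/-- Probability that the distinguisher outputs `1` on the output of the simulator and the outputs of
both parties in an ideal execution. The simulator has access to the random oracle but cannot program
it; the trusted party picks the server's share `r` uniformly. -/
noncomputable def idealProb (E : HEScheme) (s : ℕ → Sizes) (auxLen : ℕ → ℕ)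
    (S : Simulator E s auxLen) (D : Distinguisher E s auxLen) (κ : ℕ) (M : FSM (s κ))
    (x : Input (s κ)) (aux : Bits (Fin (auxLen κ))) : ℝ :=
  prob fun ω : Hash (s κ) κ × Bool × Bits (Fin (S.coins κ)) × Bits (Fin (D.coins κ)) =>
    match ω with
    | (H, r, u, t) =>
      let z := clientShare M x r
      let v := (S.circuit κ).run H
        (Sum.elim aux (Sum.elim (inputBits x) (Sum.elim (fun _ => z) u)))
      D.decide κ H v z r t

/-- Simulation security against a semi-honest client: one polynomial-size simulator works for all
machines, input strings, auxiliary inputs, and polynomial-size distinguishers. -/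
def SecureAgainstSemiHonestClient (E : HEScheme) (s : ℕ → Sizes) : Prop :=
  ∀ auxLen : ℕ → ℕ, PolyBounded auxLen →
    ∃ S : Simulator E s auxLen,
      ∀ (M : ∀ κ, FSM (s κ)) (x : ∀ κ, Input (s κ)) (aux : ∀ κ, Bits (Fin (auxLen κ)))
        (D : Distinguisher E s auxLen),
        Negligible fun κ =>
          realProb E s auxLen D κ (M κ) (x κ) (aux κ) -
            idealProb E s auxLen S D κ (M κ) (x κ) (aux κ)

/-- A malicious server in the privacy game: `choose` outputs two input strings and a state; `guess`
receives the state and the message of the client (the only message that the client sends) and outputs a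
bit. The server may answer the client arbitrarily; the client sends nothing more, so the answer plays no
role in the game. -/
structure ServerAdversary (E : HEScheme) (s : ℕ → Sizes) : Type where
  coins : ℕ → ℕ
  stateLen : ℕ → ℕ
  choose : ∀ κ, Circuit ((s κ).hashLen κ) ((s κ).entryLen κ) (Fin (coins κ))
    (((Fin (s κ).n × Fin (s κ).symBits) ⊕ (Fin (s κ).n × Fin (s κ).symBits)) ⊕ Fin (stateLen κ))
  guess : ∀ κ, Circuit ((s κ).hashLen κ) ((s κ).entryLen κ)
    (Fin (stateLen κ) ⊕ Fin (E.pkLen κ) ⊕ (Fin (s κ).n × Fin (s κ).A × Fin (E.ctLen κ))) Unit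
  choose_poly : PolyBounded fun κ => (choose κ).size
  guess_poly : PolyBounded fun κ => (guess κ).size

/-- The input string with index `β` chosen by the adversary; symbols are read modulo `|Σ|`, so that every
output of the adversary denotes a string. -/
def ServerAdversary.input {E : HEScheme} {s : ℕ → Sizes} (A : ServerAdversary E s) (κ : ℕ)
    (H : Hash (s κ) κ) (t : Bits (Fin (A.coins κ))) (β : Bool) : Input (s κ) :=
  fun i => Fin.ofNat (s κ).A (Nat.ofBits fun j : Fin (s κ).symBits =>
    (A.choose κ).run H t (.inl (if β then .inr (i, j) else .inl (i, j))))

/-- The probability that the malicious server guesses which string the honest client uses. The sample is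
the random oracle, the client's bit, the adversary's coins, and the client's coins. -/
noncomputable def ServerAdversary.winProb {E : HEScheme} {s : ℕ → Sizes} (A : ServerAdversary E s)
    (κ : ℕ) : ℝ :=
  prob fun ω : Hash (s κ) κ × Bool × Bits (Fin (A.coins κ)) × ClientCoins E (s κ) κ =>
    match ω with
    | (H, β, t, cc) =>
      let st : Bits (Fin (A.stateLen κ)) := fun j => (A.choose κ).run H t (.inr j)
      let msg := clientMessage E (A.input κ H t β) cc
      (A.guess κ).run H
        (Sum.elim st (Sum.elim msg.1 (fun p => msg.2 p.1 p.2.1 p.2.2))) () == β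

/-- Privacy against a malicious server. -/
def PrivateAgainstMaliciousServer (E : HEScheme) (s : ℕ → Sizes) : Prop :=
  ∀ A : ServerAdversary E s, Negligible fun κ => A.winProb κ - 1 / 2

end ObliviousFSM

namespace ObliviousFSM

open Asymptotics Filter

/-! ## Uniform probability -/

section Prob

variable {Ω Ω' A B C : Type} [Fintype Ω] [Fintype Ω'] [Fintype A] [Fintype B] [Fintype C]

/-! Semi-honest client. The real view is carried to the simulated one by three statistical steps.
IND-CPA plays no role here, since the client knows the decryption key.

(a) By correctness (`clientOutput_eq`) the client's output is exactly its ideal share. Each answer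
is a re-randomized ciphertext of the column selected by the one-hot vector. As re-randomization
holds for every key pair, the answer can be exchanged for a fresh encryption of that column
(`abs_real_sub_le`). Of each matrix only one column remains, hence one hash point per pair of
position and state.

(b) The client knows only the keys on the path of the computation. The other entries are masked by
`H` at points that contain independent secret keys, and they become uniform strings
(`abs_garble_sub_fill_le`). The core is `abs_prob_mask_sub_le`: for distinct fixed points,
exchanging the oracle values there with the masked strings preserves the uniform measure. So the
real game equals one with uniform strings and an oracle reprogrammed at the points. Reprogramming
matters only if the run on the original oracle queries a point. That run is independent of the keys,
so a union bound over keys and queries applies. Reprogramming occurs only in this analysis: the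
simulator computes its path entries with `H` itself.

(c) The rotated path states are independent and uniform whatever the machine does. The simulator
draws them from `κ` bits modulo `|Q|`, with small bias (`abs_states_sub_le`). Afterwards the machine
enters only through the client's share.

Malicious server. The server sees `n|Σ|` encryptions of bits. Hybrids change one position at a time,
and a gap between neighbours is the advantage of an IND-CPA adversary that puts its challenge at
that position (`exists_reduction`). Non-uniformity selects the position with the largest gap for
every `κ`, so a single adversary bounds the whole telescoping sum.

The simulator and the reduction must be circuits of polynomial size. `Computes` is a composable form
of "computed by gates of bounded cost". The value `κ = 0`, where the plaintext space may be trivial,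
is discarded, as negligibility is asymptotic. -/

theorem prob_eq_sum (p : Ω → Bool) :
    prob p = (∑ ω, if p ω = true then (1 : ℝ) else 0) / (Fintype.card Ω : ℝ) := by
  simp [prob, Finset.sum_boole]

theorem prob_equiv (e : Ω ≃ Ω') (p : Ω' → Bool) : prob (fun ω => p (e ω)) = prob p := by
  rw [prob_eq_sum, prob_eq_sum, Fintype.card_congr e]
  congr 1
  exact Equiv.sum_comp e fun ω => if p ω = true then (1 : ℝ) else 0

theorem prob_prod (p : A × B → Bool) :
    prob p = (∑ a, prob fun b => p (a, b)) / (Fintype.card A : ℝ) := by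
  simp only [prob_eq_sum, Fintype.sum_prod_type, Fintype.card_prod, Nat.cast_mul,
    ← Finset.sum_div]
  rw [div_div, mul_comm]

theorem prob_swap (p : A × B → Bool) : prob (fun w : B × A => p (w.2, w.1)) = prob p :=
  prob_equiv (Equiv.prodComm B A) p

theorem prob_snd [Nonempty A] (p : B → Bool) : prob (fun w : A × B => p w.2) = prob p := by
  rw [prob_prod]
  have : (Fintype.card A : ℝ) ≠ 0 := by exact_mod_cast Fintype.card_ne_zero
  simp

theorem prob_fst [Nonempty B] (p : A → Bool) : prob (fun w : A × B => p w.1) = prob p := by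
  rw [← prob_swap, prob_snd]

theorem prob_const_true [Nonempty Ω] : prob (fun _ : Ω => true) = 1 := by
  have : (Fintype.card Ω : ℝ) ≠ 0 := by exact_mod_cast Fintype.card_ne_zero
  simp [prob, this]

theorem abs_sum_div_card_sub_le [Nonempty A] (f g : A → ℝ) (δ : ℝ)
    (h : ∀ a, |f a - g a| ≤ δ) :
    |(∑ a, f a) / (Fintype.card A : ℝ) - (∑ a, g a) / (Fintype.card A : ℝ)| ≤ δ := by
  have hc : (0 : ℝ) < Fintype.card A := by exact_mod_cast Fintype.card_pos
  rw [← sub_div, ← Finset.sum_sub_distrib, abs_div, abs_of_pos hc, div_le_iff₀ hc]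
  calc |∑ a, (f a - g a)| ≤ ∑ a, |f a - g a| := Finset.abs_sum_le_sum_abs _ _
    _ ≤ ∑ _a : A, δ := Finset.sum_le_sum fun a _ => h a
    _ = δ * Fintype.card A := by simp [mul_comm]

/-- Averaging cannot enlarge a uniform bound. Every game hop below is an instance: all randomness
shared by the two games is fixed, and only the replaced part varies. -/
theorem abs_prob_prod_sub_le [Nonempty A] (p : A × B → Bool) (q : A × C → Bool) (δ : ℝ)
    (h : ∀ a, |prob (fun b => p (a, b)) - prob (fun c => q (a, c))| ≤ δ) :
    |prob p - prob q| ≤ δ := by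
  rw [prob_prod p, prob_prod q]
  exact abs_sum_div_card_sub_le _ _ _ h

theorem prob_prod_le [Nonempty A] (p : A × B → Bool) (δ : ℝ)
    (h : ∀ a, prob (fun b => p (a, b)) ≤ δ) : prob p ≤ δ := by
  have hc : (0 : ℝ) < Fintype.card A := by exact_mod_cast Fintype.card_pos
  rw [prob_prod p, div_le_iff₀ hc]
  calc ∑ a, prob (fun b => p (a, b)) ≤ ∑ _a : A, δ := Finset.sum_le_sum fun a _ => h a
    _ = δ * Fintype.card A := by simp [mul_comm]

theorem prob_mono {p q : Ω → Bool} (h : ∀ ω, p ω = true → q ω = true) : prob p ≤ prob q := by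
  unfold prob
  gcongr ((?_ : ℕ) : ℝ) / _
  exact Finset.card_le_card (Finset.monotone_filter_right _ fun ω _ => h ω)

theorem prob_or_le (p q : Ω → Bool) : prob (fun ω => p ω || q ω) ≤ prob p + prob q := by
  simp only [prob_eq_sum, ← add_div, ← Finset.sum_add_distrib]
  gcongr with ω
  cases p ω <;> cases q ω <;> simp

theorem abs_prob_sub_le_prob_ne (p q : Ω → Bool) :
    |prob p - prob q| ≤ prob (fun ω => p ω != q ω) := by
  simp only [prob_eq_sum, ← sub_div, ← Finset.sum_sub_distrib, abs_div, Nat.abs_cast]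
  gcongr
  refine (Finset.abs_sum_le_sum_abs _ _).trans (Finset.sum_le_sum fun ω _ => ?_)
  cases p ω <;> cases q ω <;> simp

theorem prob_exists_le {ι : Type} (S : Finset ι) (p : ι → Ω → Prop) [∀ i ω, Decidable (p i ω)]
    [∀ ω, Decidable (∃ i ∈ S, p i ω)] (δ : ℝ)
    (h : ∀ i ∈ S, prob (fun ω => decide (p i ω)) ≤ δ) :
    prob (fun ω => decide (∃ i ∈ S, p i ω)) ≤ S.card * δ := by
  calc prob (fun ω => decide (∃ i ∈ S, p i ω))
      ≤ ∑ i ∈ S, prob (fun ω => decide (p i ω)) := by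
        simp only [prob_eq_sum, ← Finset.sum_div]
        rw [Finset.sum_comm]
        gcongr with ω
        by_cases hω : ∃ i ∈ S, p i ω
        · obtain ⟨i, hi, hp⟩ := hω
          have h0 : ∀ j ∈ S, (0 : ℝ) ≤ if decide (p j ω) = true then (1 : ℝ) else 0 := by
            intro j _; split_ifs <;> norm_num
          refine le_trans ?_ (Finset.single_le_sum h0 hi)
          simp only [hp, decide_true, if_true]
          split_ifs <;> norm_num
        · simp only [hω, decide_false]
          refine le_trans (by simp) (Finset.sum_nonneg fun j _ => ?_)
          split_ifs <;> norm_num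
    _ ≤ ∑ _i ∈ S, δ := Finset.sum_le_sum h
    _ = S.card * δ := by simp

/-- A uniform element hits a given value of an injective function with probability at most
`1 / |Ω|`. -/
theorem prob_injective_eq_le {α : Type} [DecidableEq α] {f : Ω → α} (hf : Function.Injective f)
    (c : α) : prob (fun ω => decide (f ω = c)) ≤ 1 / (Fintype.card Ω : ℝ) := by
  unfold prob
  gcongr
  have : (Finset.univ.filter fun ω => decide (f ω = c) = true).card ≤ 1 := by
    refine Finset.card_le_one.2 fun a ha b hb => hf ?_
    simp only [Finset.mem_filter, decide_eq_true_eq] at ha hb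
    rw [ha.2, hb.2]
  exact_mod_cast this

/-- The coordinate `j` of a uniform function is uniform, independently of the other ones. -/
theorem prob_pi_update [DecidableEq A] [Nonempty B] (j : A)
    (p : (A → B) → Bool) :
    prob (fun w : (A → B) × B => p (Function.update w.1 j w.2)) = prob p := by
  -- Exchanging the value at `j` with the extra sample is an involution, hence preserves the uniform
  -- measure.
  let e : (A → B) × B ≃ (A → B) × B :=
    { toFun := fun w => (Function.update w.1 j w.2, w.1 j)
      invFun := fun w => (Function.update w.1 j w.2, w.1 j)
      left_inv := fun w => by simp
      right_inv := fun w => by simp }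
  exact (prob_equiv e fun v : (A → B) × B => p v.1).trans (prob_fst p)

/-- Condition on the bit to be guessed. The last summand corrects for an empty `B`, where all
probabilities are `0` by convention; it vanishes otherwise. -/
theorem prob_bool_beq [Nonempty A] (f : A × Bool × B → Bool) :
    prob (fun w : A × Bool × B => f w == w.2.1) - 1 / 2 =
      (1 / 2) * (prob (fun w : A × B => f (w.1, true, w.2)) -
        prob (fun w : A × B => f (w.1, false, w.2))) +
      (1 / 2) * (prob (fun _ : A × B => true) - 1) := by
  have key : ∀ g : B → Bool, prob (fun b => g b == false) =
      prob (fun _ : B => true) - prob g := by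
    intro g
    simp only [prob_eq_sum, ← sub_div, ← Finset.sum_sub_distrib]
    congr 1
    refine Finset.sum_congr rfl fun b _ => ?_
    cases g b <;> simp
  have hA : (Fintype.card A : ℝ) ≠ 0 := by exact_mod_cast Fintype.card_ne_zero
  rw [prob_prod, prob_prod (A := A) (B := B), prob_prod (A := A) (B := B),
    prob_prod (A := A) (B := B)]
  have : ∀ a, prob (fun b : Bool × B => f (a, b) == b.1) =
      (prob (fun b => f (a, true, b)) + (prob (fun _ : B => true) -
        prob (fun b => f (a, false, b)))) / 2 := by
    intro a
    rw [prob_prod]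
    simp only [Fintype.univ_bool, Finset.mem_singleton, Bool.true_eq_false, not_false_eq_true,
      Finset.sum_insert, Finset.sum_singleton, Fintype.card_bool, Nat.cast_ofNat, key]
    congr 2
    simp
  simp only [this, ← Finset.sum_div, Finset.sum_add_distrib, Finset.sum_sub_distrib]
  field_simp
  ring

theorem prob_bool_beq_sub_half [Nonempty A] [Nonempty B] (f : A × Bool × B → Bool) :
    prob (fun w : A × Bool × B => f w == w.2.1) - 1 / 2 =
      (1 / 2) * (prob (fun w : A × B => f (w.1, true, w.2)) -
        prob (fun w : A × B => f (w.1, false, w.2))) := by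
  rw [prob_bool_beq, prob_const_true]; ring

theorem prob_comp_eq_sum {α : Type} [Fintype α] [DecidableEq α] (f : Ω → α) (ψ : α → Bool) :
    prob (fun ω => ψ (f ω)) =
      ∑ a, (if ψ a = true then 1 else 0) * prob (fun ω => decide (f ω = a)) := by
  simp only [prob_eq_sum, ← mul_div_assoc, ← Finset.sum_div, Finset.mul_sum]
  rw [Finset.sum_comm]
  congr 1
  refine Finset.sum_congr rfl fun ω _ => ?_
  simp

/-- Triangle inequality over the atoms. The sharp bound has no factor `2`, but a constant does not
affect negligibility. -/
theorem abs_prob_comp_sub_le_statDist {α : Type} [Fintype α] [DecidableEq α] (f : Ω → α)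
    (g : Ω' → α) (ψ : α → Bool) :
    |prob (fun ω => ψ (f ω)) - prob (fun ω => ψ (g ω))| ≤ 2 * statDist f g := by
  rw [prob_comp_eq_sum, prob_comp_eq_sum, statDist, ← Finset.sum_sub_distrib, ← mul_assoc]
  rw [mul_one_div_cancel two_ne_zero, one_mul]
  refine (Finset.abs_sum_le_sum_abs _ _).trans (Finset.sum_le_sum fun a _ => ?_)
  by_cases h : ψ a = true <;> simp [h]

/-- Replacing independent coordinates one after the other. -/
theorem abs_prob_pi_sub_le {α : Type} [Nonempty Ω] [Nonempty Ω'] (δ : ℝ) :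
    ∀ (n : ℕ) (f : Fin n → Ω → α) (g : Fin n → Ω' → α),
      (∀ i (ψ : α → Bool),
        |prob (fun ω => ψ (f i ω)) - prob (fun ω => ψ (g i ω))| ≤ δ) →
      ∀ Ψ : (Fin n → α) → Bool,
        |prob (fun w : Fin n → Ω => Ψ fun i => f i (w i)) -
          prob (fun w : Fin n → Ω' => Ψ fun i => g i (w i))| ≤ n * δ
  | 0, f, g, _, Ψ => by
    have h1 : (fun w : Fin 0 → Ω => Ψ fun i => f i (w i)) = fun _ => Ψ Fin.elim0 := by
      funext w; congr 1; funext i; exact i.elim0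
    have h2 : (fun w : Fin 0 → Ω' => Ψ fun i => g i (w i)) = fun _ => Ψ Fin.elim0 := by
      funext w; congr 1; funext i; exact i.elim0
    rw [h1, h2]
    cases Ψ Fin.elim0 <;> simp [prob]
  | n + 1, f, g, h, Ψ => by
    have e1 : prob (fun w : Fin (n + 1) → Ω => Ψ fun i => f i (w i)) =
        prob (fun w : Ω × (Fin n → Ω) =>
          Ψ (Fin.cons (f 0 w.1) fun i => f i.succ (w.2 i))) := by
      rw [← prob_equiv (Fin.consEquiv fun _ : Fin (n + 1) => Ω)]
      congr 1; funext w; congr 1; funext i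
      refine Fin.cases ?_ (fun i => ?_) i <;> simp [Fin.consEquiv]
    have e2 : prob (fun w : Fin (n + 1) → Ω' => Ψ fun i => g i (w i)) =
        prob (fun w : Ω' × (Fin n → Ω') =>
          Ψ (Fin.cons (g 0 w.1) fun i => g i.succ (w.2 i))) := by
      rw [← prob_equiv (Fin.consEquiv fun _ : Fin (n + 1) => Ω')]
      congr 1; funext w; congr 1; funext i
      refine Fin.cases ?_ (fun i => ?_) i <;> simp [Fin.consEquiv]
    have m1 : |prob (fun w : Ω × (Fin n → Ω) =>
          Ψ (Fin.cons (f 0 w.1) fun i => f i.succ (w.2 i))) -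
        prob (fun w : Ω × (Fin n → Ω') =>
          Ψ (Fin.cons (f 0 w.1) fun i => g i.succ (w.2 i)))| ≤ n * δ :=
      abs_prob_prod_sub_le _ _ _ fun a =>
        abs_prob_pi_sub_le δ n (fun i => f i.succ) (fun i => g i.succ)
          (fun i => h i.succ) fun v => Ψ (Fin.cons (f 0 a) v)
    have m2 : |prob (fun w : Ω × (Fin n → Ω') =>
          Ψ (Fin.cons (f 0 w.1) fun i => g i.succ (w.2 i))) -
        prob (fun w : Ω' × (Fin n → Ω') =>
          Ψ (Fin.cons (g 0 w.1) fun i => g i.succ (w.2 i)))| ≤ δ := by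
      -- The tail has already been replaced. Moving it to the front makes it the shared part to be
      -- fixed, so that only coordinate `0` varies.
      rw [← prob_swap, ← prob_swap (A := Ω') (B := Fin n → Ω')]
      exact abs_prob_prod_sub_le _ _ _ fun v =>
        h 0 fun c => Ψ (Fin.cons c fun i => g i.succ (v i))
    rw [e1, e2]
    refine (abs_sub_le _ _ _).trans ((add_le_add m1 m2).trans (le_of_eq ?_))
    push_cast
    ring

end Prob

/-! ## Negligible and polynomially bounded functions -/

theorem Negligible.add {f g : ℕ → ℝ} (hf : Negligible f) (hg : Negligible g) :
    Negligible fun κ => f κ + g κ :=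
  SuperpolynomialDecay.add hf hg

theorem Negligible.const_mul {f : ℕ → ℝ} (hf : Negligible f) (c : ℝ) :
    Negligible fun κ => c * f κ :=
  SuperpolynomialDecay.const_mul hf c

/-- An eventual bound suffices, which is what permits the security proofs to drop `κ = 0`. -/
theorem Negligible.of_eventually_abs_le {f g : ℕ → ℝ} (hg : Negligible g)
    (h : ∀ᶠ κ in atTop, |f κ| ≤ g κ) : Negligible f :=
  SuperpolynomialDecay.trans_eventually_abs_le hg
    (h.mono fun _ hκ => hκ.trans (le_abs_self _))

theorem Negligible.abs {f : ℕ → ℝ} (hf : Negligible f) : Negligible fun κ => |f κ| :=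
  SuperpolynomialDecay.trans_abs_le hf fun _ => by simp

theorem Negligible.polyBounded_mul {f : ℕ → ℝ} (hf : Negligible f) {t : ℕ → ℕ}
    (ht : PolyBounded t) : Negligible fun κ => (t κ : ℝ) * f κ := by
  obtain ⟨p, hp⟩ := ht
  have h := SuperpolynomialDecay.polynomial_mul hf (p.map (Nat.castRingHom ℝ))
  refine SuperpolynomialDecay.trans_abs_le h fun κ => ?_
  have he : (p.map (Nat.castRingHom ℝ)).eval (κ : ℝ) = ((p.eval κ : ℕ) : ℝ) := by
    simp [Polynomial.eval_map, Polynomial.eval₂_at_natCast]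
  simp only [he, abs_mul, Nat.abs_cast]
  gcongr
  exact hp κ

theorem negligible_one_div_two_pow : Negligible fun κ => 1 / (2 : ℝ) ^ κ := by
  intro c
  have := tendsto_pow_const_div_const_pow_of_one_lt c (r := (2 : ℝ)) (by norm_num)
  simpa [div_eq_mul_inv] using this

theorem PolyBounded.mono {f g : ℕ → ℕ} (hg : PolyBounded g) (h : ∀ κ, f κ ≤ g κ) :
    PolyBounded f :=
  hg.imp fun _ hp κ => (h κ).trans (hp κ)

theorem PolyBounded.const (c : ℕ) : PolyBounded fun _ => c :=
  ⟨Polynomial.C c, fun κ => by simp⟩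

theorem PolyBounded.id : PolyBounded fun κ => κ :=
  ⟨Polynomial.X, fun κ => by simp⟩

theorem PolyBounded.add {f g : ℕ → ℕ} (hf : PolyBounded f) (hg : PolyBounded g) :
    PolyBounded fun κ => f κ + g κ := by
  obtain ⟨p, hp⟩ := hf
  obtain ⟨q, hq⟩ := hg
  exact ⟨p + q, fun κ => by simpa using add_le_add (hp κ) (hq κ)⟩

theorem PolyBounded.mul {f g : ℕ → ℕ} (hf : PolyBounded f) (hg : PolyBounded g) :
    PolyBounded fun κ => f κ * g κ := by
  obtain ⟨p, hp⟩ := hf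
  obtain ⟨q, hq⟩ := hg
  exact ⟨p * q, fun κ => by simpa using Nat.mul_le_mul (hp κ) (hq κ)⟩

/-! ## Masking with a random function at secret points -/

theorem bxor_bxor_cancel {ι : Type} (a b : Bits ι) : bxor (bxor a b) b = a := by
  funext j; simp [bxor]

theorem bxor_comm {ι : Type} (a b : Bits ι) : bxor a b = bxor b a := by
  funext j; simp [bxor, Bool.xor_comm]

theorem bxor_bxor_cancel_left {ι : Type} (a b : Bits ι) : bxor a (bxor a b) = b := by
  rw [bxor_comm, bxor_comm a b, bxor_bxor_cancel]

section Mask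

variable {J K Y ι : Type} [Fintype J] [DecidableEq J] [Fintype K] [Nonempty K]
  [DecidableEq Y] [Fintype ι] [DecidableEq ι]

/-- By independence of the coordinates, a single key may be redrawn while the others stay fixed. -/
theorem prob_pi_le_of_forall (j : J) (p : (J → K) → Bool) (δ : ℝ)
    (h : ∀ w : J → K, prob (fun k => p (Function.update w j k)) ≤ δ) : prob p ≤ δ := by
  rw [← prob_pi_update j p]
  exact prob_prod_le _ _ h

/-- Birthday bound: a union over ordered pairs, with one key of the pair redrawn while the other
fixes the target. -/
theorem prob_not_injective_le (emb : J → K → Y) (hemb : ∀ j, Function.Injective (emb j)) :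
    prob (fun key : J → K => decide (¬ Function.Injective fun j => emb j (key j))) ≤
      (Fintype.card J : ℝ) ^ 2 * (1 / (Fintype.card K : ℝ)) := by
  classical
  calc _ ≤ prob (fun key : J → K => decide (∃ ij ∈ (Finset.univ : Finset (J × J)),
        ij.1 ≠ ij.2 ∧ emb ij.1 (key ij.1) = emb ij.2 (key ij.2))) := by
        refine prob_mono fun key hk => ?_
        obtain ⟨i, j, h, hne⟩ := Function.not_injective_iff.1 (of_decide_eq_true hk)
        exact decide_eq_true ⟨(i, j), Finset.mem_univ _, hne, h⟩
    _ ≤ (Finset.univ : Finset (J × J)).card * (1 / (Fintype.card K : ℝ)) := by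
        refine prob_exists_le _ _ _ fun ij _ => ?_
        refine prob_pi_le_of_forall ij.1 _ _ fun w => ?_
        refine le_trans (prob_mono fun k hk => ?_)
          (prob_injective_eq_le (hemb ij.1) (emb ij.2 (w ij.2)))
        simp only [decide_eq_true_eq, Function.update_self] at hk ⊢
        obtain ⟨hne, hk⟩ := hk
        rw [hk, Function.update_of_ne hne.symm]
    _ = _ := by simp [sq]

/-- Union bound over points and queries. It is essential that `S` is fixed before the keys are
drawn. -/
theorem prob_hit_le (emb : J → K → Y) (hemb : ∀ j, Function.Injective (emb j)) (S : Finset Y) :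
    prob (fun key : J → K => decide (∃ jy ∈ (Finset.univ : Finset J) ×ˢ S,
      emb jy.1 (key jy.1) = jy.2)) ≤
      ((Fintype.card J * S.card : ℕ) : ℝ) * (1 / (Fintype.card K : ℝ)) := by
  refine (prob_exists_le _ _ (1 / (Fintype.card K : ℝ)) fun jy _ => ?_).trans
    (by simp [Finset.card_product])
  refine prob_pi_le_of_forall jy.1 _ _ fun w => ?_
  simpa using prob_injective_eq_le (hemb jy.1) jy.2

/-- Exchange the values of a function at the points `pts j` with the (re-masked) values `u j`. -/
noncomputable def swapAt (pts : J → Y) (hpts : Function.Injective pts) (m : J → Bits ι) :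
    (Y → Bits ι) × (J → Bits ι) ≃ (Y → Bits ι) × (J → Bits ι) where
  toFun w := (Function.extend pts (fun j => bxor (w.2 j) (m j)) w.1,
    fun j => bxor (w.1 (pts j)) (m j))
  invFun w := (Function.extend pts (fun j => bxor (w.2 j) (m j)) w.1,
    fun j => bxor (w.1 (pts j)) (m j))
  left_inv w := by
    refine Prod.ext (funext fun y => ?_) (funext fun j => ?_)
    · by_cases h : ∃ j, pts j = y
      · obtain ⟨j, rfl⟩ := h
        simp [hpts.extend_apply, bxor_bxor_cancel]
      · simp [Function.extend_apply' _ _ _ h]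
    · simp [hpts.extend_apply, bxor_bxor_cancel]
  right_inv w := by
    refine Prod.ext (funext fun y => ?_) (funext fun j => ?_)
    · by_cases h : ∃ j, pts j = y
      · obtain ⟨j, rfl⟩ := h
        simp [hpts.extend_apply, bxor_bxor_cancel]
      · simp [Function.extend_apply' _ _ _ h]
    · simp [hpts.extend_apply, bxor_bxor_cancel]

/-- Values of a random function at secret points are as good as fresh random values for an
observer with few queries. -/
theorem abs_prob_mask_sub_le [Fintype Y] (emb : J → K → Y) (hemb : ∀ j, Function.Injective (emb j))
    (m : (J → K) → J → Bits ι) (Φ : (Y → Bits ι) → (J → Bits ι) → Bool) (T : ℕ)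
    (hΦ : ∀ H u, ∃ S : Finset Y, S.card ≤ T ∧
      ∀ H' : Y → Bits ι, (∀ y ∈ S, H' y = H y) → Φ H' u = Φ H u) :
    |prob (fun w : (Y → Bits ι) × (J → K) =>
        Φ w.1 fun j => bxor (w.1 (emb j (w.2 j))) (m w.2 j)) -
      prob (fun w : (Y → Bits ι) × (J → Bits ι) => Φ w.1 w.2)| ≤
      ((Fintype.card J * (Fintype.card J + T) : ℕ) : ℝ) * (1 / (Fintype.card K : ℝ)) := by
  classical
  choose S hST hS using hΦ
  let pts (key : J → K) (j : J) : Y := emb j (key j)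
  let reprog (key : J → K) (w : ((Y → Bits ι) × (J → Bits ι))) : Y → Bits ι :=
    Function.extend (pts key) (fun j => bxor (w.2 j) (m key j)) w.1
  let real (key : J → K) (H : Y → Bits ι) : Bool :=
    Φ H fun j => bxor (H (pts key j)) (m key j)
  -- The intermediate game uses the reprogrammed oracle when the points are distinct. For colliding
  -- points the real game is kept, since the exchange needs injectivity.
  let p (v : (J → K) × ((Y → Bits ι) × (J → Bits ι))) : Bool :=
    if Function.Injective (pts v.1) then Φ (reprog v.1 v.2) v.2.2 else real v.1 v.2.1
  -- This is an exact equality. For each fixed key table, `swapAt` is a bijection that turns one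
  -- game into the other; `m` may depend on the keys because they are fixed here.
  have h1 : prob (fun w : (Y → Bits ι) × (J → K) => real w.2 w.1) = prob p := by
    rw [← prob_swap, prob_prod, prob_prod]
    congr 1
    refine Finset.sum_congr rfl fun key _ => ?_
    have h0 : prob (fun H => real key H) = prob (fun w : ((Y → Bits ι) × (J → Bits ι)) => real key w.1) :=
      (prob_fst fun H => real key H).symm
    by_cases hk : Function.Injective (pts key)
    · have : (fun w => p (key, w)) =
          fun w => (fun w : ((Y → Bits ι) × (J → Bits ι)) => real key w.1) (swapAt (pts key) hk (m key) w) := by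
        funext w
        simp only [p, hk, if_true, real, swapAt, Equiv.coe_fn_mk, reprog]
        congr 1
        funext j
        simp [hk.extend_apply, bxor_bxor_cancel]
      rw [this]
      exact h0.trans
        (prob_equiv (swapAt (pts key) hk (m key)) fun w => real key w.1).symm
    · have : (fun w => p (key, w)) = fun w : ((Y → Bits ι) × (J → Bits ι)) => real key w.1 := by
        funext w
        simp [p, hk]
      rw [this]
      exact h0
  have h2 : prob (fun w : ((Y → Bits ι) × (J → Bits ι)) => Φ w.1 w.2) =
      prob (fun v : (J → K) × ((Y → Bits ι) × (J → Bits ι)) => Φ v.2.1 v.2.2) :=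
    (prob_snd fun w : ((Y → Bits ι) × (J → Bits ι)) => Φ w.1 w.2).symm
  -- The games can differ only after a collision of points or when a point lies in the query set.
  -- That set is taken for the original oracle and the strings `u`, so it does not involve the keys.
  have h3 : prob (fun v : (J → K) × ((Y → Bits ι) × (J → Bits ι)) => p v != Φ v.2.1 v.2.2) ≤
      prob (fun v : (J → K) × ((Y → Bits ι) × (J → Bits ι)) => decide (¬ Function.Injective fun j => emb j (v.1 j)) ||
        decide (∃ jy ∈ (Finset.univ : Finset J) ×ˢ S v.2.1 v.2.2,
          emb jy.1 (v.1 jy.1) = jy.2)) := by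
    refine prob_mono fun v hv => ?_
    by_contra hcon
    simp only [Bool.or_eq_true, decide_eq_true_eq, not_or, not_not] at hcon
    obtain ⟨hinj, hhit⟩ := hcon
    have hinj' : Function.Injective (pts v.1) := hinj
    have : p v = Φ v.2.1 v.2.2 := by
      simp only [p, hinj', if_true]
      refine hS _ _ _ fun y hy => ?_
      refine Function.extend_apply' _ _ _ ?_
      rintro ⟨j, hj⟩
      exact hhit ⟨(j, y), by simp [hy], hj⟩
    simp [this] at hv
  have h4 : prob (fun v : (J → K) × ((Y → Bits ι) × (J → Bits ι)) => decide (¬ Function.Injective fun j => emb j (v.1 j))) ≤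
      (Fintype.card J : ℝ) ^ 2 * (1 / (Fintype.card K : ℝ)) :=
    (prob_fst fun key : J → K => decide (¬ Function.Injective fun j => emb j (key j))).trans_le
      (prob_not_injective_le emb hemb)
  have h5 : prob (fun v : (J → K) × ((Y → Bits ι) × (J → Bits ι)) =>
        decide (∃ jy ∈ (Finset.univ : Finset J) ×ˢ S v.2.1 v.2.2,
          emb jy.1 (v.1 jy.1) = jy.2)) ≤
      ((Fintype.card J * T : ℕ) : ℝ) * (1 / (Fintype.card K : ℝ)) := by
    -- Fixing the oracle and the strings first makes the query set constant while the keys are still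
    -- uniform.
    rw [← prob_swap]
    refine prob_prod_le _ _ fun w => (prob_hit_le emb hemb (S w.1 w.2)).trans ?_
    gcongr
    exact hST _ _
  have h6 := (abs_prob_sub_le_prob_ne p
    fun v : (J → K) × (Y → Bits ι) × (J → Bits ι) => Φ v.2.1 v.2.2).trans
    (h3.trans ((prob_or_le _ _).trans (add_le_add h4 h5)))
  rw [← h1, ← h2] at h6
  refine h6.trans (le_of_eq ?_)
  push_cast
  ring

end Mask

/-! ## Composing circuits -/

section Circuits

variable {a b : ℕ} {ι ι' ο ο' : Type}

/-- The values of a list of gates. -/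
def evalGates (H : Bits (Fin a) → Bits (Fin b)) (x : Bits ι) (L : List (Gate a b ι)) : List Bool :=
  L.foldl (fun vals g => vals ++ [g.eval H x vals]) []

@[simp]
theorem evalGates_nil (H : Bits (Fin a) → Bits (Fin b)) (x : Bits ι) :
    evalGates H x ([] : List (Gate a b ι)) = [] := rfl

theorem evalGates_concat (H : Bits (Fin a) → Bits (Fin b)) (x : Bits ι)
    (L : List (Gate a b ι)) (g : Gate a b ι) :
    evalGates H x (L ++ [g]) = evalGates H x L ++ [g.eval H x (evalGates H x L)] := by
  simp [evalGates]

@[simp]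
theorem length_evalGates (H : Bits (Fin a) → Bits (Fin b)) (x : Bits ι)
    (L : List (Gate a b ι)) : (evalGates H x L).length = L.length := by
  induction L using List.reverseRecOn with
  | nil => rfl
  | append_singleton L g ih => simp [evalGates_concat, ih]

/-- The wire `w` is an input or one of the first `n` gates. -/
def ValidWire (n : ℕ) (w : ι ⊕ ℕ) : Prop := ∀ k, w = Sum.inr k → k < n

theorem ValidWire.mono {m n : ℕ} {w : ι ⊕ ℕ} (h : ValidWire m w) (hmn : m ≤ n) :
    ValidWire n w :=
  fun k hk => (h k hk).trans_le hmn

theorem validWire_inl {n : ℕ} (i : ι) : ValidWire n (Sum.inl i : ι ⊕ ℕ) :=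
  fun k hk => by cases hk

theorem validWire_inr {n k : ℕ} (h : k < n) : ValidWire n (Sum.inr k : ι ⊕ ℕ) :=
  fun j hj => by cases hj; exact h

theorem wire_append {x : Bits ι} {v v' : List Bool} {w : ι ⊕ ℕ} (h : ValidWire v.length w) :
    wire x (v ++ v') w = wire x v w := by
  cases w with
  | inl i => rfl
  | inr k =>
    have := h k rfl
    simp [wire, List.getElem?_append_left this]

/-- Replace input `i` by the wire `σ i` and move the gates by `n` positions. -/
def substWire (σ : ι' → ι ⊕ ℕ) (n : ℕ) : ι' ⊕ ℕ → ι ⊕ ℕ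
  | Sum.inl i => σ i
  | Sum.inr k => Sum.inr (n + k)

def Gate.subst (σ : ι' → ι ⊕ ℕ) (n : ℕ) : Gate a b ι' → Gate a b ι
  | Gate.const v => Gate.const v
  | Gate.nand u v => Gate.nand (substWire σ n u) (substWire σ n v)
  | Gate.oracle q j => Gate.oracle (fun t => substWire σ n (q t)) j

@[simp]
theorem Gate.cost_subst (σ : ι' → ι ⊕ ℕ) (n : ℕ) (g : Gate a b ι') :
    (g.subst σ n).cost = g.cost := by
  cases g <;> rfl

theorem wire_substWire {x : Bits ι} {v v' : List Bool} {σ : ι' → ι ⊕ ℕ}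
    (hσ : ∀ i, ValidWire v.length (σ i)) (w : ι' ⊕ ℕ) :
    wire x (v ++ v') (substWire σ v.length w) = wire (fun i => wire x v (σ i)) v' w := by
  cases w with
  | inl i => exact wire_append (hσ i)
  | inr k => simp [wire, substWire, List.getElem?_append_right]

/-- A gate reads only values computed before it, so a forward reference inside `L'` still reads
`false` after the shift. Only the substituted wires have to be valid. -/
theorem evalGates_append_subst (H : Bits (Fin a) → Bits (Fin b)) (x : Bits ι)
    (L : List (Gate a b ι)) {σ : ι' → ι ⊕ ℕ} (hσ : ∀ i, ValidWire L.length (σ i))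
    (L' : List (Gate a b ι')) :
    evalGates H x (L ++ L'.map (Gate.subst σ L.length)) =
      evalGates H x L ++ evalGates H (fun i => wire x (evalGates H x L) (σ i)) L' := by
  induction L' using List.reverseRecOn with
  | nil => simp
  | append_singleton L' g ih =>
    rw [List.map_append, List.map_singleton, ← List.append_assoc, evalGates_concat, ih,
      evalGates_concat, ← List.append_assoc]
    congr 2
    have hw : ∀ v' w, wire x (evalGates H x L ++ v') (substWire σ L.length w) =
        wire (fun i => wire x (evalGates H x L) (σ i)) v' w := by
      intro v' w
      have := wire_substWire (x := x) (v := evalGates H x L) (v' := v') (σ := σ)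
        (by simpa using hσ) w
      simpa using this
    cases g <;> simp [Gate.eval, Gate.subst, hw]

/-- `F` is computed by gates of total cost at most `T`. -/
def Computes (F : (Bits (Fin a) → Bits (Fin b)) → Bits ι → Bits ο) (T : ℕ) : Prop :=
  ∃ L : List (Gate a b ι), (L.map Gate.cost).sum ≤ T ∧
    ∀ o, ∃ w, ValidWire L.length w ∧ ∀ H x, wire x (evalGates H x L) w = F H x o

theorem Computes.mono {F : (Bits (Fin a) → Bits (Fin b)) → Bits ι → Bits ο} {T T' : ℕ}
    (h : Computes F T) (hT : T ≤ T') : Computes F T' := by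
  obtain ⟨L, hL, hw⟩ := h
  exact ⟨L, hL.trans hT, hw⟩

theorem Computes.toCircuit [Fintype ι] [Fintype ο]
    {F : (Bits (Fin a) → Bits (Fin b)) → Bits ι → Bits ο} {T : ℕ} (h : Computes F T) :
    ∃ C : Circuit a b ι ο, C.size ≤ T + Fintype.card ι + Fintype.card ο ∧
      ∀ H x, C.run H x = F H x := by
  obtain ⟨L, hL, hw⟩ := h
  choose w _ hw using hw
  refine ⟨⟨L, w⟩, ?_, fun H x => funext fun o => hw o H x⟩
  unfold Circuit.size
  gcongr

/-- An output that refers past the last gate reads `false`, but would read a genuine gate once more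
gates are appended. An extra constant gate gives such outputs a stable wire; this is the `+ 1`. -/
theorem Computes.of_run (C : Circuit a b ι ο) :
    Computes C.run ((C.gates.map Gate.cost).sum + 1) := by
  refine ⟨C.gates ++ [Gate.const false], by simp [Gate.cost], fun o => ?_⟩
  by_cases h : ValidWire C.gates.length (C.outs o)
  · refine ⟨C.outs o, h.mono (by simp), fun H x => ?_⟩
    rw [evalGates_concat, wire_append (by simpa using h)]
    rfl
  · simp only [ValidWire, not_forall, not_lt] at h
    obtain ⟨k, hk, hlen⟩ := h
    refine ⟨Sum.inr C.gates.length, validWire_inr (by simp), fun H x => ?_⟩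
    have h1 : wire x (evalGates H x C.gates) (C.outs o) = false := by
      rw [hk]
      simp [wire, hlen]
    rw [evalGates_concat]
    have h2 : C.run H x o = wire x (evalGates H x C.gates) (C.outs o) := rfl
    rw [h2, h1]
    simp [wire, Gate.eval]

theorem Computes.of_size [Fintype ι] [Fintype ο] (C : Circuit a b ι ο) :
    Computes C.run (C.size + 1) :=
  (Computes.of_run C).mono (by unfold Circuit.size; omega)

/-- View an oracle-free gate as a gate with an oracle. -/
def Gate.lift : Gate 0 0 ι → Gate a b ι
  | Gate.const v => Gate.const v
  | Gate.nand u v => Gate.nand u v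
  | Gate.oracle _ j => j.elim0

theorem Computes.of_oracle_free {T : ℕ} {f : Bits ι → Bits ο}
    (h : Computes (a := 0) (b := 0) (fun _ => f) T) :
    Computes (a := a) (b := b) (fun _ => f) T := by
  obtain ⟨L, hL, hw⟩ := h
  have hc : ∀ g : Gate 0 0 ι, (Gate.lift g : Gate a b ι).cost = g.cost := by
    intro g
    cases g with
    | const v => rfl
    | nand u v => rfl
    | oracle q j => exact j.elim0
  have he : ∀ (H : Bits (Fin a) → Bits (Fin b)) x,
      evalGates H x (L.map Gate.lift) = evalGates id x L := by
    intro H x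
    clear hL hw
    induction L using List.reverseRecOn with
    | nil => rfl
    | append_singleton L g ih =>
      rw [List.map_append, List.map_singleton, evalGates_concat, evalGates_concat, ih]
      cases g with
      | const v => rfl
      | nand u v => rfl
      | oracle q j => exact j.elim0
  refine ⟨L.map Gate.lift, by simpa [Function.comp_def, hc] using hL, fun o => ?_⟩
  obtain ⟨w, hv, hw⟩ := hw o
  exact ⟨w, by simpa using hv, fun H x => by rw [he]; exact hw id x⟩

/-- Circuit size also counts inputs and outputs, so the same bound controls the lengths of keys,
coins, messages and ciphertexts. -/
theorem Computes.of_polyComputable {ι ο : ℕ → Type} [∀ κ, Fintype (ι κ)] [∀ κ, Fintype (ο κ)]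
    {f : ∀ κ, Bits (ι κ) → Bits (ο κ)} (h : PolyComputable f) :
    ∃ T : ℕ → ℕ, PolyBounded T ∧ (∀ κ, Fintype.card (ι κ) ≤ T κ) ∧
      (∀ κ, Fintype.card (ο κ) ≤ T κ) ∧
      ∀ κ (a b : ℕ), Computes (a := a) (b := b) (fun _ => f κ) (T κ) := by
  obtain ⟨C, hC, hf⟩ := h
  refine ⟨fun κ => (C κ).size + 1, hC.add (PolyBounded.const 1), fun κ => ?_, fun κ => ?_,
    fun κ a b => Computes.of_oracle_free ?_⟩
  · simp only [Circuit.size]; omega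
  · simp only [Circuit.size]; omega
  · have h := Computes.of_size (C κ)
    -- Efficiency is stated for the oracle `id`, but with answers of zero bits all oracles coincide.
    have he : (fun _ => f κ) = (C κ).run := by
      funext H x
      rw [← hf κ x]
      congr 1
      funext q j
      exact j.elim0
    rw [he]
    exact h

theorem Computes.proj (φ : ο → ι) : Computes (a := a) (b := b) (fun _ x o => x (φ o)) 0 :=
  ⟨[], by simp, fun o => ⟨Sum.inl (φ o), validWire_inl _, fun _ _ => rfl⟩⟩

theorem Computes.reindex {F : (Bits (Fin a) → Bits (Fin b)) → Bits ι → Bits ο} {T : ℕ}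
    (h : Computes F T) (φ : ο' → ο) : Computes (fun H x o => F H x (φ o)) T := by
  obtain ⟨L, hL, hw⟩ := h
  exact ⟨L, hL, fun o => hw (φ o)⟩

theorem Computes.comp {F : (Bits (Fin a) → Bits (Fin b)) → Bits ι → Bits ι'}
    {G : (Bits (Fin a) → Bits (Fin b)) → Bits ι' → Bits ο} {T T' : ℕ}
    (hG : Computes G T') (hF : Computes F T) : Computes (fun H x => G H (F H x)) (T + T') := by
  obtain ⟨L, hL, hw⟩ := hF
  obtain ⟨L', hL', hw'⟩ := hG
  choose σ hσ hw using hw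
  refine ⟨L ++ L'.map (Gate.subst σ L.length), ?_, fun o => ?_⟩
  · simpa [Function.comp_def] using add_le_add hL hL'
  · obtain ⟨w, hv, hw'⟩ := hw' o
    refine ⟨substWire σ L.length w, ?_, fun H x => ?_⟩
    · cases w with
      | inl i => exact (hσ i).mono (by simp)
      | inr k =>
        exact validWire_inr (by simpa using hv k rfl)
    · have h1 := wire_substWire (x := x) (v := evalGates H x L)
        (v' := evalGates H (fun i => wire x (evalGates H x L) (σ i)) L') (σ := σ)
        (by simpa using hσ) w
      rw [length_evalGates] at h1
      rw [evalGates_append_subst H x L hσ, h1, hw']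
      congr 1
      funext i
      exact hw i H x

theorem Computes.sumElim {F : (Bits (Fin a) → Bits (Fin b)) → Bits ι → Bits ο}
    {G : (Bits (Fin a) → Bits (Fin b)) → Bits ι → Bits ο'} {T T' : ℕ}
    (hF : Computes F T) (hG : Computes G T') :
    Computes (fun H x => Sum.elim (F H x) (G H x)) (T + T') := by
  obtain ⟨L, hL, hw⟩ := hF
  obtain ⟨L', hL', hw'⟩ := hG
  have hσ : ∀ i : ι, ValidWire L.length (Sum.inl i : ι ⊕ ℕ) := fun i => validWire_inl i
  refine ⟨L ++ L'.map (Gate.subst Sum.inl L.length), ?_, fun o => ?_⟩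
  · simpa [Function.comp_def] using add_le_add hL hL'
  · have he : ∀ H (x : Bits ι), evalGates H x (L ++ L'.map (Gate.subst Sum.inl L.length)) =
        evalGates H x L ++ evalGates H x L' := fun H x => evalGates_append_subst H x L hσ L'
    rcases o with o | o
    · obtain ⟨w, hv, hw⟩ := hw o
      refine ⟨w, hv.mono (by simp), fun H x => ?_⟩
      rw [he, wire_append (by simpa using hv), hw]
      rfl
    · obtain ⟨w, hv, hw⟩ := hw' o
      refine ⟨substWire Sum.inl L.length w, ?_, fun H x => ?_⟩
      · cases w with
        | inl i => exact (hσ i).mono (by simp)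
        | inr k =>
          exact validWire_inr (by simpa using hv k rfl)
      · have h1 := wire_substWire (x := x) (v := evalGates H x L) (v' := evalGates H x L')
          (σ := Sum.inl) (by simpa using hσ) w
        rw [length_evalGates] at h1
        rw [he, h1]
        exact hw H x

theorem Computes.pi {J : Type} [Fintype J] {ο : J → Type}
    {F : ∀ j, (Bits (Fin a) → Bits (Fin b)) → Bits ι → Bits (ο j)} {T : ℕ}
    (h : ∀ j, Computes (F j) T) :
    Computes (fun H x (p : Σ j, ο j) => F p.1 H x p.2) (Fintype.card J * T) := by
  classical
  have main : ∀ S : Finset J, Computes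
      (fun H x (p : {p : Σ j, ο j // p.1 ∈ S}) => F p.1.1 H x p.1.2) (S.card * T) := by
    intro S
    induction S using Finset.induction_on with
    | empty => exact ⟨[], by simp, fun o => absurd o.2 (by simp)⟩
    | insert j S hj ih =>
      have h1 := (h j).sumElim ih
      have h2 := h1.reindex fun p : {p : Σ j, ο j // p.1 ∈ insert j S} =>
        if hp : p.1.1 = j then (Sum.inl (hp ▸ p.1.2) : ο j ⊕ {p : Σ j, ο j // p.1 ∈ S})
        else Sum.inr ⟨p.1, (Finset.mem_insert.1 p.2).resolve_left hp⟩
      rw [Finset.card_insert_of_notMem hj, add_mul, one_mul, add_comm]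
      convert h2 using 1
      funext H x p
      obtain ⟨⟨i, o⟩, hi⟩ := p
      by_cases hp : i = j
      · subst hp
        simp
      · simp [hp]
  have h1 := (main Finset.univ).reindex fun p : Σ j, ο j => ⟨p, Finset.mem_univ _⟩
  exact h1

theorem Computes.piProd {J : Type} [Fintype J]
    {F : J → (Bits (Fin a) → Bits (Fin b)) → Bits ι → Bits ο} {T : ℕ}
    (h : ∀ j, Computes (F j) T) :
    Computes (fun H x (p : J × ο) => F p.1 H x p.2) (Fintype.card J * T) :=
  (Computes.pi h).reindex fun p : J × ο => ⟨p.1, p.2⟩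

/-! ### Boolean building blocks, table lookup and oracle queries. -/

/-- A single bit is computed by gates of total cost at most `T`. -/
abbrev ComputesBit (f : (Bits (Fin a) → Bits (Fin b)) → Bits ι → Bool) (T : ℕ) : Prop :=
  Computes (fun H x (_ : Unit) => f H x) T

theorem Computes.of_bits [Fintype ο] {F : (Bits (Fin a) → Bits (Fin b)) → Bits ι → Bits ο}
    {T : ℕ} (h : ∀ o, ComputesBit (fun H x => F H x o) T) :
    Computes F (Fintype.card ο * T) :=
  (Computes.piProd h).reindex fun o : ο => (o, ())

theorem Computes.bit {F : (Bits (Fin a) → Bits (Fin b)) → Bits ι → Bits ο} {T : ℕ}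
    (h : Computes F T) (o : ο) : ComputesBit (fun H x => F H x o) T :=
  h.reindex fun _ => o

theorem ComputesBit.input (i : ι) : ComputesBit (a := a) (b := b) (fun _ x => x i) 0 :=
  Computes.proj fun _ => i

theorem ComputesBit.const (v : Bool) :
    ComputesBit (a := a) (b := b) (fun _ (_ : Bits ι) => v) 1 :=
  ⟨[Gate.const v], by simp [Gate.cost], fun _ => ⟨Sum.inr 0, validWire_inr (by simp),
    fun H x => by simp [evalGates, wire, Gate.eval]⟩⟩

theorem Computes.const [Fintype ο] (v : Bits ο) :
    Computes (a := a) (b := b) (fun _ (_ : Bits ι) => v) (Fintype.card ο) :=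
  (Computes.of_bits fun o => ComputesBit.const (v o)).mono (by simp)

theorem ComputesBit.nand {f g : (Bits (Fin a) → Bits (Fin b)) → Bits ι → Bool} {T T' : ℕ}
    (hf : ComputesBit f T) (hg : ComputesBit g T') :
    ComputesBit (fun H x => !(f H x && g H x)) (T + T' + 1) := by
  have h : ComputesBit (a := a) (b := b)
      (fun _ (x : Bits (Unit ⊕ Unit)) => !(x (.inl ()) && x (.inr ()))) 1 :=
    ⟨[Gate.nand (Sum.inl (.inl ())) (Sum.inl (.inr ()))], by simp [Gate.cost], fun _ =>
      ⟨Sum.inr 0, validWire_inr (by simp), fun H x => by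
        simp [evalGates, wire, Gate.eval]⟩⟩
  exact h.comp (hf.sumElim hg)

theorem ComputesBit.congr {f g : (Bits (Fin a) → Bits (Fin b)) → Bits ι → Bool} {T : ℕ}
    (hf : ComputesBit f T) (h : ∀ H x, g H x = f H x) : ComputesBit g T := by
  have : f = g := by funext H x; exact (h H x).symm
  exact this ▸ hf

theorem Computes.congr {F G : (Bits (Fin a) → Bits (Fin b)) → Bits ι → Bits ο} {T : ℕ}
    (hF : Computes F T) (h : ∀ H x o, G H x o = F H x o) : Computes G T := by
  have : F = G := by funext H x o; exact (h H x o).symm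
  exact this ▸ hF

theorem ComputesBit.not {f : (Bits (Fin a) → Bits (Fin b)) → Bits ι → Bool} {T : ℕ}
    (hf : ComputesBit f T) : ComputesBit (fun H x => !f H x) (T + 2) :=
  ((hf.nand (ComputesBit.const true)).congr fun H x => by simp).mono (by omega)

theorem ComputesBit.and {f g : (Bits (Fin a) → Bits (Fin b)) → Bits ι → Bool} {T T' : ℕ}
    (hf : ComputesBit f T) (hg : ComputesBit g T') :
    ComputesBit (fun H x => f H x && g H x) (T + T' + 3) :=
  ((hf.nand hg).not.congr fun H x => by simp).mono (by omega)

theorem ComputesBit.or {f g : (Bits (Fin a) → Bits (Fin b)) → Bits ι → Bool} {T T' : ℕ}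
    (hf : ComputesBit f T) (hg : ComputesBit g T') :
    ComputesBit (fun H x => f H x || g H x) (T + T' + 5) :=
  ((hf.not.nand hg.not).congr fun H x => by simp).mono (by omega)

/-- Selecting one of two bits. -/
theorem ComputesBit.cond {c f g : (Bits (Fin a) → Bits (Fin b)) → Bits ι → Bool} {T₀ T T' : ℕ}
    (hc : ComputesBit c T₀) (hf : ComputesBit f T) (hg : ComputesBit g T') :
    ComputesBit (fun H x => if c H x then f H x else g H x) (2 * T₀ + T + T' + 13) := by
  refine (((hc.and hf).or (hc.not.and hg)).congr fun H x => ?_).mono (by omega)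
  cases c H x <;> simp

theorem ComputesBit.xor {f g : (Bits (Fin a) → Bits (Fin b)) → Bits ι → Bool} {T T' : ℕ}
    (hf : ComputesBit f T) (hg : ComputesBit g T') :
    ComputesBit (fun H x => Bool.xor (f H x) (g H x)) (2 * T + 2 * T' + 15) := by
  refine ((hf.cond hg.not hg).congr fun H x => ?_).mono (by omega)
  cases f H x <;> simp

theorem ComputesBit.exists {J : Type} [Fintype J]
    {f : J → (Bits (Fin a) → Bits (Fin b)) → Bits ι → Bool} {T : ℕ}
    (h : ∀ j, ComputesBit (f j) T) :
    ComputesBit (fun H x => decide (∃ j, f j H x = true)) (Fintype.card J * (T + 5) + 1) := by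
  classical
  have main : ∀ S : Finset J, ComputesBit
      (fun H x => decide (∃ j ∈ S, f j H x = true)) (S.card * (T + 5) + 1) := by
    intro S
    induction S using Finset.induction_on with
    | empty => exact (ComputesBit.const false).congr (by simp) |>.mono (by simp)
    | insert j S hj ih =>
      refine (((h j).or ih).congr fun H x => ?_).mono ?_
      · simp [Bool.decide_or]
      · rw [Finset.card_insert_of_notMem hj]
        linarith
  exact (main Finset.univ).congr fun H x => by simp

/-- An oracle gate returns a single bit of the answer, so a full answer takes `b` gates of cost `1 +
a + b` each. -/
theorem Computes.oracle {F : (Bits (Fin a) → Bits (Fin b)) → Bits ι → Bits (Fin a)} {T : ℕ}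
    (hF : Computes F T) :
    Computes (fun H x => H (F H x)) (T + b * (1 + a + b)) := by
  have h : Computes (a := a) (b := b) (fun H (x : Bits (Fin a)) => H x) (b * (1 + a + b)) := by
    refine (Computes.of_bits (T := 1 + a + b) fun j => ?_).mono (by simp)
    exact ⟨[Gate.oracle (fun t => Sum.inl t) j], by simp [Gate.cost], fun _ =>
      ⟨Sum.inr 0, validWire_inr (by simp), fun H x => by
        simp [evalGates, wire, Gate.eval]⟩⟩
  exact h.comp hF

/-- Functions of few bits are computed by table lookup. -/
theorem ComputesBit.table : ∀ (m : ℕ) (f : Bits (Fin m) → Bool),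
    ComputesBit (a := a) (b := b) (fun _ x => f x) (14 * 2 ^ m - 13)
  | 0, f => by
    refine (ComputesBit.const (f fun i => i.elim0)).congr fun H x => ?_
    congr 1
    funext i
    exact i.elim0
  | m + 1, f => by
    have h (v : Bool) : ComputesBit (a := a) (b := b)
        (fun _ (x : Bits (Fin (m + 1))) => f (Fin.cons v fun i => x i.succ)) (14 * 2 ^ m - 13) :=
      (Computes.comp (ComputesBit.table m fun y => f (Fin.cons v y))
        (Computes.proj fun i : Fin m => i.succ)).mono (by simp)
    -- Selecting between two subtables by the first bit adds `13`; the recursion `c (m + 1) = 2 * c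
    -- m + 13` with `c 0 = 1` gives `14 * 2 ^ m - 13`.
    refine (((ComputesBit.input 0).cond (h true) (h false)).congr fun H x => ?_).mono ?_
    · have hx : x = Fin.cons (x 0) fun i => x i.succ := by
        funext i
        refine Fin.cases ?_ (fun i => ?_) i <;> simp
      conv_lhs => rw [hx]
      cases x 0 <;> simp
    · have := Nat.one_le_two_pow (n := m)
      rw [pow_succ]
      omega

/-- Collect the queries of the run on `H`. Adaptivity does no harm: as long as the answers agree,
all earlier gates agree, so the next query is the same. Each oracle gate costs at least `1`, hence
the bound. -/
theorem exists_queries_evalGates (H : Bits (Fin a) → Bits (Fin b)) (x : Bits ι)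
    (L : List (Gate a b ι)) :
    ∃ S : Finset (Bits (Fin a)), S.card ≤ (L.map Gate.cost).sum ∧
      ∀ H' : Bits (Fin a) → Bits (Fin b), (∀ y ∈ S, H' y = H y) →
        evalGates H' x L = evalGates H x L := by
  classical
  induction L using List.reverseRecOn with
  | nil => exact ⟨∅, by simp, fun _ _ => rfl⟩
  | append_singleton L g ih =>
    obtain ⟨S, hS, hH⟩ := ih
    cases g with
    | const v =>
      refine ⟨S, by simp; omega, fun H' h => ?_⟩
      rw [evalGates_concat, evalGates_concat, hH H' h]
      rfl
    | nand u v =>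
      refine ⟨S, by simp; omega, fun H' h => ?_⟩
      rw [evalGates_concat, evalGates_concat, hH H' h]
      rfl
    | oracle q j =>
      refine ⟨insert (fun t => wire x (evalGates H x L) (q t)) S, ?_, fun H' h => ?_⟩
      · refine (Finset.card_insert_le _ _).trans ?_
        simp [Gate.cost]
        omega
      · rw [evalGates_concat, evalGates_concat,
          hH H' fun y hy => h y (Finset.mem_insert_of_mem hy)]
        simp [Gate.eval, h _ (Finset.mem_insert_self _ _)]

/-- The run of a circuit depends on the oracle at few points only. -/
theorem Circuit.exists_queries [Fintype ι] [Fintype ο] (C : Circuit a b ι ο)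
    (H : Bits (Fin a) → Bits (Fin b)) (x : Bits ι) :
    ∃ S : Finset (Bits (Fin a)), S.card ≤ C.size ∧
      ∀ H' : Bits (Fin a) → Bits (Fin b), (∀ y ∈ S, H' y = H y) → C.run H' x = C.run H x := by
  obtain ⟨S, hS, hH⟩ := exists_queries_evalGates H x C.gates
  refine ⟨S, hS.trans (by unfold Circuit.size; omega), fun H' h => ?_⟩
  have := hH H' h
  unfold evalGates at this
  unfold Circuit.run
  rw [this]

end Circuits

/-! ## Privacy against a malicious server -/

theorem natBits_toNat {m : ℕ} (c : Bool) (j : Fin m) :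
    natBits m c.toNat j = if j.val = 0 then c else false := by
  obtain ⟨j, hj⟩ := j
  cases c <;> cases j <;> simp [natBits, Nat.testBit_succ]

theorem ite_one_zero_eq_toNat (p : Prop) [Decidable p] :
    (if p then 1 else 0) = (decide p).toNat := by
  by_cases h : p <;> simp [h]

theorem ComputesBit.natBits_toNat {a b : ℕ} {ι : Type}
    {c : (Bits (Fin a) → Bits (Fin b)) → Bits ι → Bool} {T : ℕ} (h : ComputesBit c T) (m : ℕ) :
    Computes (fun H x => natBits m (c H x).toNat) (m * (T + 1)) := by
  refine (Computes.of_bits (T := T + 1) fun j => ?_).mono (by simp)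
  by_cases hj : j.val = 0
  · exact (h.congr fun H x => by rw [ObliviousFSM.natBits_toNat, if_pos hj]).mono (by omega)
  · exact ((ComputesBit.const false).congr fun H x => by
      rw [ObliviousFSM.natBits_toNat, if_neg hj]).mono (by omega)

/-- Minimality of the ceiling logarithm. It keeps lookup tables indexed by encoded symbols linear in
`|Σ|`. -/
theorem two_pow_symBits_le (s : Sizes) : 2 ^ s.symBits ≤ 2 * s.A := by
  unfold Sizes.symBits
  rcases Nat.lt_or_ge 1 s.A with h | h
  · have h1 := Nat.pow_pred_clog_lt_self (b := 2) one_lt_two h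
    have h2 := Nat.clog_pos one_lt_two h
    obtain ⟨c, hc⟩ := Nat.exists_eq_succ_of_ne_zero h2.ne'
    rw [hc] at h1 ⊢
    rw [pow_succ]
    simp at h1
    omega
  · have h1 : s.A = 1 := le_antisymm h s.A_pos
    simp [h1]

theorem ofBits_natBits {m k : ℕ} (h : k < 2 ^ m) : Nat.ofBits (natBits m k) = k := by
  refine Nat.eq_of_testBit_eq fun j => ?_
  by_cases hj : j < m
  · rw [Nat.testBit_ofBits_lt _ _ hj]; rfl
  · rw [Nat.testBit_ofBits_ge _ _ (not_lt.1 hj)]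
    exact (Nat.testBit_lt_two_pow (h.trans_le (Nat.pow_le_pow_right two_pos (not_lt.1 hj)))).symm

theorem ofBits_natBits_le (m k : ℕ) : Nat.ofBits (natBits m k) ≤ k := by
  refine Nat.le_of_testBit fun j hj => ?_
  by_cases h : j < m
  · rwa [Nat.testBit_ofBits_lt _ _ h] at hj
  · rw [Nat.testBit_ofBits_ge _ _ (not_lt.1 h)] at hj; cases hj

/-! ### Hybrids over ciphertext positions and the circuits of the reduction. -/

section Server

variable (E : HEScheme) (s : ℕ → Sizes) (A : ServerAdversary E s) (κ : ℕ)

/-- The position of the ciphertext `(i, σ)` in the message of the client. -/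
def posRank (p : Fin (s κ).n × Fin (s κ).A) : ℕ := (finProdFinEquiv p).val

/-- The one-hot bit at position `p` in the hybrid of two inputs: the second input is used at the
positions below `j`. -/
def hybridBit (x₀ x₁ : Input (s κ)) (j : ℕ) (p : Fin (s κ).n × Fin (s κ).A) : Bool :=
  if posRank s κ p < j then decide (x₁ p.1 = p.2) else decide (x₀ p.1 = p.2)

/-- The decision of the malicious server on a hybrid message of the client. -/
def hybridDecision (H : Hash (s κ) κ) (t : Bits (Fin (A.coins κ))) (g : Bits (Fin (E.genCoins κ)))
    (e : Fin (s κ).n × Fin (s κ).A → Bits (Fin (E.encCoins κ))) (j : ℕ) : Bool :=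
  (A.guess κ).run H (Sum.elim (fun k => (A.choose κ).run H t (.inr k))
    (Sum.elim (E.gen κ g).1 fun p => E.enc κ (E.gen κ g).1
      (natBits (E.msgLen κ)
        (hybridBit s κ (A.input κ H t false) (A.input κ H t true) j (p.1, p.2.1)).toNat)
      (e (p.1, p.2.1)) p.2.2)) ()

noncomputable def hybridProb (j : ℕ) : ℝ :=
  prob fun w : Hash (s κ) κ × Bits (Fin (A.coins κ)) × Bits (Fin (E.genCoins κ)) ×
    (Fin (s κ).n × Fin (s κ).A → Bits (Fin (E.encCoins κ))) =>
    hybridDecision E s A κ w.1 w.2.1 w.2.2.1 w.2.2.2 j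

theorem posRank_lt (p : Fin (s κ).n × Fin (s κ).A) : posRank s κ p < (s κ).n * (s κ).A :=
  (finProdFinEquiv p).isLt

theorem posRank_injective : Function.Injective (posRank s κ) :=
  Fin.val_injective.comp finProdFinEquiv.injective

/-- The extreme hybrids are the two honest games: no rank is below `0`, and every rank is below
`n|Σ|`. -/
theorem winProb_eq_hybridProb :
    A.winProb κ - 1 / 2 =
      (1 / 2) * (hybridProb E s A κ ((s κ).n * (s κ).A) - hybridProb E s A κ 0) := by
  have h := prob_bool_beq_sub_half (A := Hash (s κ) κ)
    (B := Bits (Fin (A.coins κ)) × ClientCoins E (s κ) κ)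
    fun w => (A.guess κ).run w.1
      (Sum.elim (fun j => (A.choose κ).run w.1 w.2.2.1 (.inr j))
        (Sum.elim (clientMessage E (A.input κ w.1 w.2.2.1 w.2.1) w.2.2.2).1
          fun p => (clientMessage E (A.input κ w.1 w.2.2.1 w.2.1) w.2.2.2).2 p.1 p.2.1 p.2.2)) ()
  refine Eq.trans h ?_
  let e : Hash (s κ) κ × Bits (Fin (A.coins κ)) × ClientCoins E (s κ) κ ≃
      Hash (s κ) κ × Bits (Fin (A.coins κ)) × Bits (Fin (E.genCoins κ)) ×
        (Fin (s κ).n × Fin (s κ).A → Bits (Fin (E.encCoins κ))) :=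
    (Equiv.refl _).prodCongr ((Equiv.refl _).prodCongr ((Equiv.refl _).prodCongr
      (Equiv.curry _ _ _).symm))
  rw [hybridProb, hybridProb, ← prob_equiv e, ← prob_equiv e]
  congr 2
  · congr 1
    funext w
    simp only [hybridDecision, clientMessage, hybridBit, posRank_lt, if_true,
      ite_one_zero_eq_toNat]
    rfl
  · congr 1
    funext w
    simp only [hybridDecision, clientMessage, hybridBit, not_lt_zero, if_false,
      ite_one_zero_eq_toNat]
    rfl

theorem hybridBit_posRank (x₀ x₁ : Input (s κ)) (p : Fin (s κ).n × Fin (s κ).A) :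
    hybridBit s κ x₀ x₁ (posRank s κ p) p = decide (x₀ p.1 = p.2) := by
  simp [hybridBit]

theorem hybridBit_posRank_succ (x₀ x₁ : Input (s κ)) (p : Fin (s κ).n × Fin (s κ).A) :
    hybridBit s κ x₀ x₁ (posRank s κ p + 1) p = decide (x₁ p.1 = p.2) := by
  simp [hybridBit]

/-- Ranks are injective, so neighbouring hybrids differ at a single position, the one that receives
the challenge. -/
theorem hybridBit_succ_of_ne (x₀ x₁ : Input (s κ)) {p q : Fin (s κ).n × Fin (s κ).A}
    (h : q ≠ p) :
    hybridBit s κ x₀ x₁ (posRank s κ p + 1) q = hybridBit s κ x₀ x₁ (posRank s κ p) q := by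
  have h1 : posRank s κ q ≠ posRank s κ p := fun h' => h (posRank_injective s κ h')
  have h2 : posRank s κ q < posRank s κ p + 1 ↔ posRank s κ q < posRank s κ p := by omega
  simp only [hybridBit, h2]

/-- Indices of the coins of the reduction. -/
abbrev RedCoins : Type :=
  Fin (A.coins κ) ⊕ (Fin (s κ).n × Fin (s κ).A) × Fin (E.encCoins κ)

/-- Indices of the state of the reduction. -/
abbrev RedState : Type :=
  Fin (A.stateLen κ) ⊕ Fin (E.pkLen κ) ⊕ (Fin (s κ).n × Fin (s κ).A × Fin (E.ctLen κ))

/-- The first stage of the reduction, with the challenge at position `p`. -/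
def redChoose (p : Fin (s κ).n × Fin (s κ).A) (H : Hash (s κ) κ)
    (w : Bits (Fin (E.pkLen κ) ⊕ RedCoins E s A κ)) :
    Bits ((Fin (E.msgLen κ) ⊕ Fin (E.msgLen κ)) ⊕ RedState E s A κ) :=
  let t : Bits (Fin (A.coins κ)) := fun j => w (.inr (.inl j))
  let x := A.input κ H t
  Sum.elim
    (Sum.elim
      -- Admissibility is demanded for all `κ`. At `κ = 0` the number `1` need not be a plaintext,
      -- so both messages are then forced to `0`.
      (natBits (E.msgLen κ) (decide (κ ≠ 0) && decide (x false p.1 = p.2)).toNat)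
      (natBits (E.msgLen κ) (decide (κ ≠ 0) && decide (x true p.1 = p.2)).toNat))
    (Sum.elim (fun k => (A.choose κ).run H t (.inr k))
      -- Position `p` is encrypted as well, which avoids an index type with a hole; the second stage
      -- overwrites this ciphertext with the challenge.
      (Sum.elim (fun j => w (.inl j)) fun q => E.enc κ (fun j => w (.inl j))
        (natBits (E.msgLen κ)
          (hybridBit s κ (x false) (x true) (posRank s κ p) (q.1, q.2.1)).toNat)
        (fun l => w (.inr (.inr ((q.1, q.2.1), l)))) q.2.2))

/-- The second stage of the reduction. -/
def redGuess (p : Fin (s κ).n × Fin (s κ).A) (H : Hash (s κ) κ)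
    (w : Bits (RedState E s A κ ⊕ Fin (E.ctLen κ))) : Bits Unit :=
  (A.guess κ).run H (Sum.elim (fun k => w (.inl (.inl k)))
    (Sum.elim (fun j => w (.inl (.inr (.inl j)))) fun q =>
      if (q.1, q.2.1) = p then w (.inr q.2.2) else w (.inl (.inr (.inr q)))))

theorem computes_redGuess (p : Fin (s κ).n × Fin (s κ).A) :
    Computes (redGuess E s A κ p) ((A.guess κ).size + 1) := by
  have h := (Computes.of_size (A.guess κ)).comp
    (Computes.proj (a := (s κ).hashLen κ) (b := (s κ).entryLen κ)
      (Sum.elim (fun k => .inl (.inl k)) (Sum.elim (fun j => .inl (.inr (.inl j))) fun q =>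
        if (q.1, q.2.1) = p then .inr q.2.2 else .inl (.inr (.inr q))) :
        Fin (A.stateLen κ) ⊕ Fin (E.pkLen κ) ⊕ (Fin (s κ).n × Fin (s κ).A × Fin (E.ctLen κ)) →
          RedState E s A κ ⊕ Fin (E.ctLen κ)))
  refine (h.congr fun H w o => ?_).mono (by omega)
  simp only [redGuess]
  congr 1
  funext q
  rcases q with k | j | q
  · rfl
  · rfl
  · simp only [Sum.elim_inr]
    split_ifs <;> rfl

/-- Reduction modulo `|Σ|` and the comparison are done by one table on `symBits` bits, of cost at
most `14 * 2 ^ symBits ≤ 28 |Σ|`. -/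
theorem computes_input_eq (β : Bool) (p : Fin (s κ).n × Fin (s κ).A) :
    ComputesBit (a := (s κ).hashLen κ) (b := (s κ).entryLen κ)
      (fun H (w : Bits (Fin (E.pkLen κ) ⊕ RedCoins E s A κ)) =>
        decide (A.input κ H (fun j => w (.inr (.inl j))) β p.1 = p.2))
      ((A.choose κ).size + 1 + 28 * (s κ).A) := by
  have h := (ComputesBit.table (a := (s κ).hashLen κ) (b := (s κ).entryLen κ) (s κ).symBits
    fun y => decide (Fin.ofNat (s κ).A (Nat.ofBits y) = p.2)).comp
      (((Computes.of_size (A.choose κ)).comp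
        (Computes.proj fun j => (.inr (.inl j) : Fin (E.pkLen κ) ⊕ RedCoins E s A κ))).reindex
        fun j => (.inl (if β then .inr (p.1, j) else .inl (p.1, j))))
  refine (h.congr fun H w o => rfl).mono ?_
  have := two_pow_symBits_le (s κ)
  omega

/-- Cost of the first stage of the reduction when encryption costs `T`. -/
def redCost (T : ℕ) : ℕ :=
  let c := E.msgLen κ * ((A.choose κ).size + 1 + 28 * (s κ).A + 1 + 3 + 1)
  2 * c + ((A.choose κ).size + 1) + (s κ).n * (s κ).A * (c + T)

theorem computes_redChoose (p : Fin (s κ).n × Fin (s κ).A) (T : ℕ)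
    (hT : Computes (a := (s κ).hashLen κ) (b := (s κ).entryLen κ)
      (fun _ (w : Bits (Fin (E.pkLen κ) ⊕ Fin (E.msgLen κ) ⊕ Fin (E.encCoins κ))) =>
        E.enc κ (fun j => w (.inl j)) (fun j => w (.inr (.inl j)))
          (fun j => w (.inr (.inr j)))) T) :
    Computes (redChoose E s A κ p) (redCost E s A κ T) := by
  have hm (β : Bool) := ((ComputesBit.const (decide (κ ≠ 0))).and
    (computes_input_eq E s A κ β p)).natBits_toNat (E.msgLen κ)
  have hst := ((Computes.of_size (A.choose κ)).comp
        (Computes.proj fun j => (.inr (.inl j) : Fin (E.pkLen κ) ⊕ RedCoins E s A κ))).reindex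
        fun j => Sum.inr j
  have hpk := Computes.proj (a := (s κ).hashLen κ) (b := (s κ).entryLen κ)
    fun j => (.inl j : Fin (E.pkLen κ) ⊕ RedCoins E s A κ)
  have hq (q : Fin (s κ).n × Fin (s κ).A) := by
    have h1 : ComputesBit (a := (s κ).hashLen κ) (b := (s κ).entryLen κ)
      (fun H (w : Bits (Fin (E.pkLen κ) ⊕ RedCoins E s A κ)) =>
        hybridBit s κ (A.input κ H (fun j => w (.inr (.inl j))) false)
          (A.input κ H (fun j => w (.inr (.inl j))) true) (posRank s κ p) q)
      ((A.choose κ).size + 1 + 28 * (s κ).A) := by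
      by_cases h : posRank s κ q < posRank s κ p
      · exact (computes_input_eq E s A κ true q).congr fun H w => by simp [hybridBit, h]
      · exact (computes_input_eq E s A κ false q).congr fun H w => by simp [hybridBit, h]
    have h2 := Computes.proj (a := (s κ).hashLen κ) (b := (s κ).entryLen κ)
      fun l => (.inr (.inr (q, l)) : Fin (E.pkLen κ) ⊕ RedCoins E s A κ)
    exact (hT.comp (hpk.sumElim ((h1.natBits_toNat (E.msgLen κ)).sumElim h2))).mono
      (T' := E.msgLen κ * ((A.choose κ).size + 1 + 28 * (s κ).A + 1 + 3 + 1) + T) (by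
        gcongr
        have : (A.choose κ).size + 1 + 28 * (s κ).A + 1 ≤
          (A.choose κ).size + 1 + 28 * (s κ).A + 1 + 3 + 1 := by omega
        simpa using Nat.mul_le_mul_left _ this)
  have hall := (Computes.piProd hq).reindex
    fun q : Fin (s κ).n × Fin (s κ).A × Fin (E.ctLen κ) => ((q.1, q.2.1), q.2.2)
  refine ((((hm false).sumElim (hm true)).sumElim (hst.sumElim (hpk.sumElim hall))).congr
    fun H w o => rfl).mono ?_
  simp only [redCost, Fintype.card_prod, Fintype.card_fin]
  have : E.msgLen κ * (1 + ((A.choose κ).size + 1 + 28 * (s κ).A) + 3 + 1) =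
    E.msgLen κ * ((A.choose κ).size + 1 + 28 * (s κ).A + 1 + 3 + 1) := by ring
  rw [this]
  omega

end Server

/-- For positive `κ` a column has at least one bit. For `κ = 0` and `|Q| = 1` the capacity
assumption only says that the modulus is positive. -/
theorem one_lt_modulus {E : HEScheme} {s : Sizes} {κ : ℕ} (hκ : κ ≠ 0)
    {g : Bits (Fin (E.genCoins κ))}
    (hcap : 2 ^ (s.Q * s.entryLen κ) ≤ E.modulus κ (E.gen κ g).1) :
    1 < E.modulus κ (E.gen κ g).1 := by
  refine (Nat.one_lt_two_pow ?_).trans_le hcap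
  have := s.Q_pos
  simp only [Sizes.entryLen, ne_eq, mul_eq_zero, not_or]
  omega

theorem ofBits_natBits_toNat_lt {E : HEScheme} {s : Sizes} {κ : ℕ}
    {g : Bits (Fin (E.genCoins κ))}
    (hcap : 2 ^ (s.Q * s.entryLen κ) ≤ E.modulus κ (E.gen κ g).1) {c : Bool}
    (hc : κ = 0 → c = false) (m : ℕ) :
    Nat.ofBits (natBits m c.toNat) < E.modulus κ (E.gen κ g).1 := by
  refine (ofBits_natBits_le _ _).trans_lt ?_
  by_cases hκ : κ = 0
  · rw [hc hκ]
    exact Nat.two_pow_pos _ |>.trans_le hcap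
  · exact (Bool.toNat_le c).trans_lt (one_lt_modulus hκ hcap)

/-! ### The reduction to IND-CPA and the telescoping of the hybrids. -/

section Reduction

variable (E : HEScheme) (s : ℕ → Sizes) (A : ServerAdversary E s)

theorem polyBounded_hashLen (hA : PolyBounded fun κ => (s κ).A) :
    PolyBounded fun κ => (s κ).hashLen κ := by
  refine (PolyBounded.id.add hA).mono fun κ => ?_
  have : Nat.clog 2 (s κ).A ≤ (s κ).A :=
    Nat.clog_le_of_le_pow (Nat.lt_two_pow_self).le
  simp only [Sizes.hashLen, Sizes.symBits]
  omega

theorem polyBounded_entryLen (hQ : PolyBounded fun κ => (s κ).Q) :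
    PolyBounded fun κ => (s κ).entryLen κ := by
  refine (hQ.add PolyBounded.id).mono fun κ => ?_
  have : Nat.clog 2 (s κ).Q ≤ (s κ).Q :=
    Nat.clog_le_of_le_pow (Nat.lt_two_pow_self).le
  simp only [Sizes.entryLen, Sizes.stateBits]
  omega

/-- The indistinguishability of neighbouring hybrids reduces to the security of the encryption. -/
theorem exists_reduction (hA : PolyBounded fun κ => (s κ).A) (hn : PolyBounded fun κ => (s κ).n)
    (hcap : ∀ κ (g : Bits (Fin (E.genCoins κ))),
      2 ^ ((s κ).Q * (s κ).entryLen κ) ≤ E.modulus κ (E.gen κ g).1)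
    (p : ∀ κ, Fin (s κ).n × Fin (s κ).A) :
    ∃ B : CPAAdversary E (fun κ => (s κ).hashLen κ) (fun κ => (s κ).entryLen κ),
      B.Admissible ∧ ∀ κ, κ ≠ 0 →
        B.winProb κ - 1 / 2 = (1 / 2) * (hybridProb E s A κ (posRank s κ (p κ) + 1) -
          hybridProb E s A κ (posRank s κ (p κ))) := by
  obtain ⟨T, hT, hTin, hTout, hTc⟩ := Computes.of_polyComputable E.enc_poly
  have hpkT : ∀ κ, E.pkLen κ ≤ T κ := fun κ => le_trans (by simp) (hTin κ)
  have hmsgT : ∀ κ, E.msgLen κ ≤ T κ := fun κ => le_trans (by simp; omega) (hTin κ)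
  have hecT : ∀ κ, E.encCoins κ ≤ T κ := fun κ => le_trans (by simp; omega) (hTin κ)
  have hctT : ∀ κ, E.ctLen κ ≤ T κ := fun κ => le_trans (by simp) (hTout κ)
  let eW κ := Fintype.equivFin (RedCoins E s A κ)
  let eZ κ := Fintype.equivFin (RedState E s A κ)
  have h1 κ := (((computes_redChoose E s A κ (p κ) (T κ) (hTc κ _ _)).comp
    (Computes.proj (Sum.map (id : Fin (E.pkLen κ) → _) (eW κ)))).reindex
      (Sum.map (id : Fin (E.msgLen κ) ⊕ Fin (E.msgLen κ) → _) (eZ κ).symm)).toCircuit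
  have h2 κ := ((computes_redGuess E s A κ (p κ)).comp
    (Computes.proj (Sum.map (eZ κ) (id : Fin (E.ctLen κ) → _)))).toCircuit
  choose C hCs hC using h1
  choose D hDs hD using h2
  have hch : PolyBounded fun κ => (A.choose κ).size := A.choose_poly
  have hgu : PolyBounded fun κ => (A.guess κ).size := A.guess_poly
  have hcoins : PolyBounded A.coins :=
    hch.mono fun κ => by simp only [Circuit.size, Fintype.card_fin]; omega
  have hstate : PolyBounded A.stateLen := hch.mono fun κ => by
    simp only [Circuit.size, Fintype.card_sum, Fintype.card_fin]; omega
  have hW : PolyBounded fun κ => Fintype.card (RedCoins E s A κ) :=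
    (hcoins.add ((hn.mul hA).mul hT)).mono fun κ => by
      simp only [Fintype.card_sum, Fintype.card_prod, Fintype.card_fin]
      have := Nat.mul_le_mul_left ((s κ).n * (s κ).A) (hecT κ)
      omega
  have hZ : PolyBounded fun κ => Fintype.card (RedState E s A κ) :=
    (hstate.add (hT.add (hn.mul (hA.mul hT)))).mono fun κ => by
      simp only [Fintype.card_sum, Fintype.card_prod, Fintype.card_fin]
      have := Nat.mul_le_mul_left (s κ).n (Nat.mul_le_mul_left (s κ).A (hctT κ))
      have := hpkT κ
      omega
  have hcost : PolyBounded fun κ => redCost E s A κ (T κ) := by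
    have hc := hT.mul ((((hch.add (PolyBounded.const 1)).add
      ((PolyBounded.const 28).mul hA)).add (PolyBounded.const 5)))
    refine ((((PolyBounded.const 2).mul hc).add (hch.add (PolyBounded.const 1))).add
      ((hn.mul hA).mul (hc.add hT))).mono fun κ => ?_
    have := hmsgT κ
    unfold redCost
    dsimp only
    gcongr
  let B : CPAAdversary E (fun κ => (s κ).hashLen κ) (fun κ => (s κ).entryLen κ) :=
    { coins := fun κ => Fintype.card (RedCoins E s A κ)
      stateLen := fun κ => Fintype.card (RedState E s A κ)
      choose := C
      guess := D
      choose_poly := by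
        refine ((hcost.add (hT.add hW)).add ((hT.add hT).add hZ)).mono fun κ =>
          (hCs κ).trans ?_
        have := hpkT κ
        have := hmsgT κ
        simp only [Fintype.card_sum, Fintype.card_fin]
        omega
      guess_poly := by
        refine ((hgu.add (hZ.add hT)).add (PolyBounded.const 2)).mono fun κ =>
          (hDs κ).trans ?_
        have := hctT κ
        simp only [Fintype.card_sum, Fintype.card_fin, Fintype.card_unit]
        omega }
  have hmsg : ∀ κ H pk r β, B.msg κ H pk r β = natBits (E.msgLen κ)
      (decide (κ ≠ 0) && decide (A.input κ H (fun j => r (eW κ (.inl j))) β (p κ).1 =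
        (p κ).2)).toNat := by
    intro κ H pk r β
    funext j
    have : B.msg κ H pk r β j =
      (C κ).run H (Sum.elim pk r) (.inl (if β then .inr j else .inl j)) := rfl
    rw [this, hC]
    cases β <;> rfl
  have hst : ∀ κ H pk r k, (C κ).run H (Sum.elim pk r) (.inr k) =
      redChoose E s A κ (p κ) H (Sum.elim pk fun i => r (eW κ i)) (.inr ((eZ κ).symm k)) := by
    intro κ H pk r k
    rw [hC]
    simp only [Sum.map_inr]
    congr 1
    funext i
    cases i <;> rfl
  refine ⟨B, ?_, fun κ hκ => ?_⟩
  · intro κ H g r β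
    rw [hmsg]
    exact ofBits_natBits_toNat_lt (hcap κ g) (fun h => by simp [h]) _
  have hwin := prob_bool_beq_sub_half (A := Hash (s κ) κ)
    (B := Bits (Fin (E.genCoins κ)) × Bits (Fin (Fintype.card (RedCoins E s A κ))) ×
      Bits (Fin (E.encCoins κ)))
    fun w => (D κ).run w.1 (Sum.elim
      (fun j => (C κ).run w.1 (Sum.elim (E.gen κ w.2.2.1).1 w.2.2.2.1) (.inr j))
      (E.enc κ (E.gen κ w.2.2.1).1
        (B.msg κ w.1 (E.gen κ w.2.2.1).1 w.2.2.2.1 w.2.1) w.2.2.2.2)) ()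
  refine Eq.trans hwin ?_
  -- With challenge bit `β` the reduction plays the hybrid of index rank plus `β`, the challenge
  -- coins serving as the encryption coins of position `p κ`.
  have hdec : ∀ (β : Bool) H g r ρ, (D κ).run H (Sum.elim
      (fun j => (C κ).run H (Sum.elim (E.gen κ g).1 r) (.inr j))
      (E.enc κ (E.gen κ g).1 (B.msg κ H (E.gen κ g).1 r β) ρ)) () =
      hybridDecision E s A κ H (fun j => r (eW κ (.inl j))) g
        (Function.update (fun q l => r (eW κ (.inr (q, l)))) (p κ) ρ)
        (posRank s κ (p κ) + β.toNat) := by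
    intro β H g r ρ
    rw [hD, hmsg]
    unfold redGuess hybridDecision
    congr 1
    funext i
    rcases i with k | j | q
    · simp only [Sum.map_inl, Sum.elim_inl, hst, Equiv.symm_apply_apply]
      rfl
    · simp only [Sum.map_inl, Sum.elim_inl, Sum.elim_inr, hst, Equiv.symm_apply_apply]
      rfl
    · by_cases hq : (q.1, q.2.1) = p κ
      · simp only [Sum.elim_inr, hq, if_true, Sum.map_inr, id_eq, Function.update_self]
        cases β <;> simp [hybridBit_posRank, hybridBit_posRank_succ, hκ]
      · simp only [Sum.elim_inr, hq, if_false, Sum.map_inl, Sum.elim_inl, hst,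
          Equiv.symm_apply_apply, Function.update_of_ne hq]
        cases β <;> simp [redChoose, hybridBit_succ_of_ne s κ _ _ hq]
  -- Overwriting one coordinate of uniform coins by fresh uniform coins does not change their
  -- distribution; the rest regroups coordinates.
  have hprob : ∀ j : ℕ, prob (fun w : Hash (s κ) κ × Bits (Fin (E.genCoins κ)) ×
      Bits (Fin (Fintype.card (RedCoins E s A κ))) × Bits (Fin (E.encCoins κ)) =>
      hybridDecision E s A κ w.1 (fun j => w.2.2.1 (eW κ (.inl j))) w.2.1
        (Function.update (fun q l => w.2.2.1 (eW κ (.inr (q, l)))) (p κ) w.2.2.2) j) =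
      hybridProb E s A κ j := by
    intro j
    let e : (Bits (Fin (E.genCoins κ)) × Bits (Fin (Fintype.card (RedCoins E s A κ))) ×
        Bits (Fin (E.encCoins κ))) ≃
        (Bits (Fin (A.coins κ)) × Bits (Fin (E.genCoins κ)) ×
          (Fin (s κ).n × Fin (s κ).A → Bits (Fin (E.encCoins κ))) × Bits (Fin (E.encCoins κ))) :=
      { toFun := fun w => (fun j => w.2.1 (eW κ (.inl j)), w.1,
          fun q l => w.2.1 (eW κ (.inr (q, l))), w.2.2)
        invFun := fun v => (v.2.1, fun i => Sum.elim v.1 (fun q => v.2.2.1 q.1 q.2)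
          ((eW κ).symm i), v.2.2.2)
        left_inv := fun w => by
          refine Prod.ext rfl (Prod.ext (funext fun i => ?_) rfl)
          obtain ⟨i, rfl⟩ := (eW κ).surjective i
          simp only [Equiv.symm_apply_apply]
          cases i <;> rfl
        right_inv := fun v => by
          simp }
    rw [hybridProb, prob_prod, prob_prod]
    congr 1
    refine Finset.sum_congr rfl fun H _ => ?_
    refine (prob_equiv e fun v => hybridDecision E s A κ H v.1 v.2.1
      (Function.update v.2.2.1 (p κ) v.2.2.2) j).trans ?_
    rw [prob_prod, prob_prod]
    congr 1
    refine Finset.sum_congr rfl fun t _ => ?_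
    rw [prob_prod, prob_prod]
    congr 1
    refine Finset.sum_congr rfl fun g _ => ?_
    exact prob_pi_update (p κ) fun e => hybridDecision E s A κ H t g e j
  simp only [hdec]
  rw [hprob, hprob]
  rfl

/-- The advantage telescopes into `n|Σ|` gaps. A single adversary has to serve all `κ`, so its
position is chosen, non-uniformly, as one with the largest gap. Since negligibility is two-sided,
absolute values may be taken. -/
theorem privateAgainstMaliciousServer (hA : PolyBounded fun κ => (s κ).A)
    (hn : PolyBounded fun κ => (s κ).n)
    (hcap : ∀ κ (g : Bits (Fin (E.genCoins κ))),
      2 ^ ((s κ).Q * (s κ).entryLen κ) ≤ E.modulus κ (E.gen κ g).1)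
    (hcpa : E.IndCPA (fun κ => (s κ).hashLen κ) (fun κ => (s κ).entryLen κ)) :
    PrivateAgainstMaliciousServer E s := by
  intro A
  let d κ (p : Fin (s κ).n × Fin (s κ).A) : ℝ := (1 / 2) *
    (hybridProb E s A κ (posRank s κ p + 1) - hybridProb E s A κ (posRank s κ p))
  have hmax κ : ∃ p, ∀ q, |d κ q| ≤ |d κ p| := Finite.exists_max fun p => |d κ p|
  choose p hp using hmax
  obtain ⟨B, hB, hwin⟩ := exists_reduction E s A hA hn hcap p
  refine ((hcpa B hB).abs.polyBounded_mul (hn.mul hA)).of_eventually_abs_le ?_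
  filter_upwards [eventually_ne_atTop 0] with κ hκ
  have hsum : A.winProb κ - 1 / 2 = ∑ q, d κ q := by
    rw [winProb_eq_hybridProb, ← Finset.sum_range_sub, ← Fin.sum_univ_eq_sum_range
      (fun j => hybridProb E s A κ (j + 1) - hybridProb E s A κ j), Finset.mul_sum]
    exact (Equiv.sum_comp finProdFinEquiv fun j : Fin ((s κ).n * (s κ).A) => (1 / 2) *
      (hybridProb E s A κ (j + 1) - hybridProb E s A κ j)).symm
  rw [hsum, hwin κ hκ]
  refine (Finset.abs_sum_le_sum_abs _ _).trans
    ((Finset.sum_le_sum fun q _ => hp κ q).trans (le_of_eq ?_))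
  simp [d]

end Reduction

/-! ## Correctness of the protocol -/

theorem natToColumn_columnToNat {s : Sizes} {κ : ℕ}
    (col : Fin s.Q → Bits (Fin (s.entryLen κ))) : natToColumn s κ (columnToNat col) = col := by
  funext q j
  rw [natToColumn, columnToNat, Nat.testBit_ofBits_lt _ _ (finProdFinEquiv (q, j)).isLt]
  change col (finProdFinEquiv.symm (finProdFinEquiv (q, j))).1
    (finProdFinEquiv.symm (finProdFinEquiv (q, j))).2 = col q j
  rw [Equiv.symm_apply_apply]

theorem columnToNat_lt {s : Sizes} {κ : ℕ} (col : Fin s.Q → Bits (Fin (s.entryLen κ))) :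
    columnToNat col < 2 ^ (s.Q * s.entryLen κ) :=
  Nat.ofBits_lt_two_pow _

/-- The empty list is excluded because its sum is an arbitrary default string; positivity of `|Σ|`
excludes it in the protocol. -/
theorem isCt_sumCt {E : HEScheme} {κ : ℕ} {pk : Bits (Fin (E.pkLen κ))} :
    ∀ l : List (Bits (Fin (E.ctLen κ)) × ZMod (E.modulus κ pk)), l ≠ [] →
      (∀ p ∈ l, IsCt E.toHEAlgorithms κ pk p.1 p.2) →
      IsCt E.toHEAlgorithms κ pk (sumCt E κ pk (l.map Prod.fst)) (l.map Prod.snd).sum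
  | [], h, _ => absurd rfl h
  | [p], _, h => by simpa [sumCt] using h p (by simp)
  | p :: p' :: l, _, h => by
    have ih := isCt_sumCt (p' :: l) (by simp) fun q hq => h q (List.mem_cons_of_mem _ hq)
    simpa [sumCt] using (h p (by simp)).add ih

/-! ### The oblivious transfers. -/

section OT

variable {E : HEScheme} {s : Sizes} {κ : ℕ}

/-- The answer in the oblivious transfer before the re-randomisation. -/
def otSum (E : HEScheme) {s : Sizes} {κ : ℕ} (pk : Bits (Fin (E.pkLen κ)))
    (c : Fin s.A → Bits (Fin (E.ctLen κ))) (b : Fin s.A → ℕ) : Bits (Fin (E.ctLen κ)) :=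
  sumCt E κ pk (List.ofFn fun σ => E.smul κ pk (natBits (E.msgLen κ) (b σ)) (c σ))

theorem ofBits_natBits_of_lt_modulus {g : Bits (Fin (E.genCoins κ))} {m : ℕ}
    (hm : m < E.modulus κ (E.gen κ g).1) : Nat.ofBits (natBits (E.msgLen κ) m) = m :=
  ofBits_natBits (hm.trans_le (E.modulus_le κ g))

/-- The scalar product with the one-hot vector of `x i` leaves only the term `σ = x i`. A modulus
above `1` is needed for the bit `1` to be a plaintext. -/
theorem isCt_otSum (x : Input s) (cc : ClientCoins E s κ)
    (hN : 1 < E.modulus κ (E.gen κ cc.1).1) (i : Fin s.n) (b : Fin s.A → ℕ)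
    (hb : ∀ σ, b σ < E.modulus κ (E.gen κ cc.1).1) :
    IsCt E.toHEAlgorithms κ (E.gen κ cc.1).1
      (otSum E (E.gen κ cc.1).1 ((clientMessage E x cc).2 i) b) (b (x i)) := by
  let l : List (Bits (Fin (E.ctLen κ)) × ZMod (E.modulus κ (E.gen κ cc.1).1)) :=
    List.ofFn fun σ => (E.smul κ (E.gen κ cc.1).1 (natBits (E.msgLen κ) (b σ))
      ((clientMessage E x cc).2 i σ),
      (b σ : ZMod (E.modulus κ (E.gen κ cc.1).1)) * ((if x i = σ then 1 else 0 : ℕ)))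
  have h := isCt_sumCt l (by simp [l, s.A_pos.ne']) (by
    intro p hp
    obtain ⟨σ, rfl⟩ := (List.mem_ofFn' _ _).1 hp
    have hv : (if x i = σ then 1 else 0) < E.modulus κ (E.gen κ cc.1).1 := by
      split_ifs <;> omega
    have h1 := IsCt.enc (E := E.toHEAlgorithms) (pk := (E.gen κ cc.1).1)
      (natBits (E.msgLen κ) (if x i = σ then 1 else 0)) (cc.2 i σ)
      (by rwa [ofBits_natBits_of_lt_modulus hv])
    have h2 := IsCt.smul (natBits (E.msgLen κ) (b σ))
      (by rw [ofBits_natBits_of_lt_modulus (hb σ)]; exact hb σ) h1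
    rw [ofBits_natBits_of_lt_modulus hv, ofBits_natBits_of_lt_modulus (hb σ)] at h2
    exact h2)
  have h1 : l.map Prod.fst = List.ofFn fun σ => E.smul κ (E.gen κ cc.1).1
      (natBits (E.msgLen κ) (b σ)) ((clientMessage E x cc).2 i σ) := by
    simp [l, List.map_ofFn, Function.comp_def]
  have h2 : (l.map Prod.snd).sum = (b (x i) : ZMod (E.modulus κ (E.gen κ cc.1).1)) := by
    simp [l, List.map_ofFn, Function.comp_def, List.sum_ofFn]
  rw [h1, h2] at h
  exact h

/-- Decryption gives the right residue; both sides are below the modulus, so they agree as natural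
numbers. -/
theorem dec_otAnswer (x : Input s) (cc : ClientCoins E s κ)
    (hN : 1 < E.modulus κ (E.gen κ cc.1).1) (i : Fin s.n) (b : Fin s.A → ℕ)
    (hb : ∀ σ, b σ < E.modulus κ (E.gen κ cc.1).1) (ρ : Bits (Fin (E.encCoins κ))) :
    Nat.ofBits (E.dec κ (E.gen κ cc.1).2
      (otAnswer E (E.gen κ cc.1).1 ((clientMessage E x cc).2 i) b ρ)) = b (x i) := by
  have h0 := IsCt.enc (E := E.toHEAlgorithms) (pk := (E.gen κ cc.1).1)
      (natBits (E.msgLen κ) 0) ρ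
      (by rw [ofBits_natBits_of_lt_modulus (g := cc.1) (by omega)]; omega)
  have h := h0.add (isCt_otSum x cc hN i b hb)
  rw [ofBits_natBits_of_lt_modulus (g := cc.1) (by omega), Nat.cast_zero, zero_add] at h
  obtain ⟨hlt, heq⟩ := E.dec_correct κ cc.1 _ _ h
  have hmod := (ZMod.natCast_eq_natCast_iff' _ _ _).1 heq
  rw [Nat.mod_eq_of_lt hlt, Nat.mod_eq_of_lt (hb _)] at hmod
  exact hmod

/-- This hides the unselected columns even from the owner of the decryption key: the bound holds for
each fixed key pair and each fixed ciphertext. -/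
theorem statDist_otAnswer_le {ε : ℕ → ℝ} (hε : ∀ κ (g : Bits (Fin (E.genCoins κ)))
      (c : Bits (Fin (E.ctLen κ))) (m : Bits (Fin (E.msgLen κ))),
      Nat.ofBits m < E.modulus κ (E.gen κ g).1 →
      IsCt E.toHEAlgorithms κ (E.gen κ g).1 c (Nat.ofBits m : ZMod (E.modulus κ (E.gen κ g).1)) →
      statDist
        (fun ρ : Bits (Fin (E.encCoins κ)) =>
          E.add κ (E.gen κ g).1 (E.enc κ (E.gen κ g).1 (natBits (E.msgLen κ) 0) ρ) c)
        (fun ρ : Bits (Fin (E.encCoins κ)) => E.enc κ (E.gen κ g).1 m ρ) ≤ ε κ)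
    (x : Input s) (cc : ClientCoins E s κ)
    (hN : 1 < E.modulus κ (E.gen κ cc.1).1) (i : Fin s.n) (b : Fin s.A → ℕ)
    (hb : ∀ σ, b σ < E.modulus κ (E.gen κ cc.1).1) :
    statDist (fun ρ => otAnswer E (E.gen κ cc.1).1 ((clientMessage E x cc).2 i) b ρ)
      (fun ρ => E.enc κ (E.gen κ cc.1).1 (natBits (E.msgLen κ) (b (x i))) ρ) ≤ ε κ := by
  refine hε κ cc.1 (otSum E (E.gen κ cc.1).1 ((clientMessage E x cc).2 i) b) _ ?_ ?_
  · rw [ofBits_natBits_of_lt_modulus (hb _)]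
    exact hb _
  · rw [ofBits_natBits_of_lt_modulus (hb _)]
    exact isCt_otSum x cc hN i b hb

end OT

/-! ### The path of the client through the garbled matrices. -/

section Path

variable {s : Sizes} {κ : ℕ}

/-- The state of the machine after `k` symbols. -/
def stateAfter (M : FSM s) (x : Input s) (k : ℕ) : Fin s.Q :=
  M.evalFrom M.start ((List.ofFn x).take k)

theorem stateAfter_succ (M : FSM s) (x : Input s) (i : Fin s.n) :
    stateAfter M x (i + 1) = M.step (stateAfter M x i) (x i) := by
  unfold stateAfter
  rw [List.take_add_one, List.getElem?_ofFn, dif_pos i.isLt]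
  simp [DFA.evalFrom_append_singleton]

open Classical in
theorem output_eq_stateAfter (M : FSM s) (x : Input s) :
    M.output x = decide (stateAfter M x s.n ∈ M.accept) := by
  unfold FSM.output stateAfter
  rw [List.take_of_length_le (by simp)]
  rfl

/-- The plaintext of the entry on the path of the client in the matrix `i`: the path visits the
(rotated) states `P`, whose keys are `K`, and ends with the bit `z`. -/
def pathEntry (P : Fin s.n → Fin s.Q) (K : Fin s.n → Bits (Fin κ)) (z : Bool) (k : ℕ) :
    Bits (Fin (s.entryLen κ)) :=
  if h : k < s.n then packEntry (P ⟨k, h⟩) (K ⟨k, h⟩) else natBits (s.entryLen κ) z.toNat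

open Classical in
/-- The plaintext of the entry `G(q, σ, i)`. -/
noncomputable def plainEntry (M : FSM s) (rot : Fin s.n → Fin s.Q)
    (key : Fin s.n → Fin s.Q → Bits (Fin κ)) (mask : Bool) (q : Fin s.Q) (σ : Fin s.A)
    (i : Fin s.n) : Bits (Fin (s.entryLen κ)) :=
  let next : Fin s.Q := M.step (q - rot i) σ
  if h : i.val + 1 < s.n then
    packEntry (next + rot ⟨i.val + 1, h⟩) (key ⟨i.val + 1, h⟩ (next + rot ⟨i.val + 1, h⟩))
  else natBits (s.entryLen κ) (xor mask (decide (next ∈ M.accept))).toNat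

theorem garble_eq (H : Hash s κ) (M : FSM s) (rot : Fin s.n → Fin s.Q)
    (key : Fin s.n → Fin s.Q → Bits (Fin κ)) (mask : Bool) (q : Fin s.Q) (σ : Fin s.A)
    (i : Fin s.n) : garble H M rot key mask q σ i =
      bxor (H (packQuery (key i q) σ)) (plainEntry M rot key mask q σ i) := rfl

/-- The rotated states on the path. -/
def pathStates (M : FSM s) (x : Input s) (rot : Fin s.n → Fin s.Q) (i : Fin s.n) : Fin s.Q :=
  stateAfter M x i + rot i

/-- The rotation at position `i` cancels, so the entry leads to the next rotated state of the true
computation, or to the masked output bit once `i + 1 = n`. -/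
theorem plainEntry_pathStates (M : FSM s) (x : Input s) (rot : Fin s.n → Fin s.Q)
    (key : Fin s.n → Fin s.Q → Bits (Fin κ)) (mask : Bool) (i : Fin s.n) :
    plainEntry M rot key mask (pathStates M x rot i) (x i) i =
      pathEntry (pathStates M x rot) (fun j => key j (pathStates M x rot j))
        (clientShare M x mask) (i + 1) := by
  have h0 : pathStates M x rot i - rot i = stateAfter M x i := add_sub_cancel_right _ _
  have hs : M.step (pathStates M x rot i - rot i) (x i) = stateAfter M x (i + 1) := by
    rw [h0, stateAfter_succ]
  unfold plainEntry pathEntry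
  rw [hs]
  dsimp only
  split_ifs with h
  · rfl
  · have : i.val + 1 = s.n := by omega
    rw [clientShare, output_eq_stateAfter, this]

theorem foldl_finRange_eq {β : Type} : ∀ (n : ℕ) (f : β → Fin n → β) (I : ℕ → β),
    (∀ i : Fin n, f (I i) i = I (i + 1)) → (List.finRange n).foldl f (I 0) = I n
  | 0, f, I, _ => rfl
  | n + 1, f, I, h => by
    rw [List.finRange_succ, List.foldl_cons, List.foldl_map]
    have h0 : f (I 0) 0 = I 1 := h 0
    rw [h0]
    exact foldl_finRange_eq n (fun b i => f b i.succ) (fun k => I (k + 1)) fun i => h i.succ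

theorem ofNat_ofBits_packEntry (q : Fin s.Q) (k : Bits (Fin κ)) :
    Fin.ofNat s.Q (Nat.ofBits fun j => (packEntry q k : Bits (Fin (s.entryLen κ)))
      (Fin.castAdd κ j)) = q := by
  have : (fun j => (packEntry q k : Bits (Fin (s.entryLen κ))) (Fin.castAdd κ j)) =
      natBits s.stateBits q := by
    funext j
    exact Fin.append_left _ _ _
  have hQ : s.Q ≤ 2 ^ s.stateBits := Nat.le_pow_clog one_lt_two _
  rw [this, ofBits_natBits (q.isLt.trans_le hQ)]
  exact Fin.ofNat_val_eq_self q

theorem packEntry_natAdd (q : Fin s.Q) (k : Bits (Fin κ)) :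
    (fun j => (packEntry q k : Bits (Fin (s.entryLen κ))) (Fin.natAdd s.stateBits j)) = k := by
  funext j
  exact Fin.append_right _ _ _

/-- Correctness is perfect: decryption returns the exact column, and hashing with the path key
unmasks the next string. Positivity of `κ` makes `1` a plaintext and leaves room for the output bit
in an entry. -/
theorem clientOutput_eq {E : HEScheme} (hκ : κ ≠ 0)
    (hcap : ∀ g : Bits (Fin (E.genCoins κ)),
      2 ^ (s.Q * s.entryLen κ) ≤ E.modulus κ (E.gen κ g).1)
    (H : Hash s κ) (M : FSM s) (x : Input s) (cc : ClientCoins E s κ) (sc : ServerCoins E s κ) :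
    clientOutput E H x cc (serverMessage E H M (clientMessage E x cc) sc) =
      clientShare M x sc.2.2.1 := by
  obtain ⟨rot, key, mask, ρ⟩ := sc
  set P := pathStates M x rot with hP
  -- Loop invariant: `I k` is the string held after `k` steps, from the transmitted pair `I 0` to
  -- the padded output share `I s.n`.
  set I : ℕ → Bits (Fin (s.entryLen κ)) :=
    pathEntry P (fun j => key j (P j)) (clientShare M x mask) with hI
  have hN := one_lt_modulus hκ (hcap cc.1)
  have h0 : (serverMessage E H M (clientMessage E x cc) (rot, key, mask, ρ)).2 = I 0 := by
    rw [hI, pathEntry, dif_pos s.n_pos]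
    rfl
  have hent : 0 < s.entryLen κ := by unfold Sizes.entryLen; omega
  unfold clientOutput
  rw [h0]
  dsimp only
  rw [foldl_finRange_eq _ _ I]
  · rw [hI, pathEntry, dif_neg (lt_irrefl _), Nat.testBit_ofBits_lt _ _ hent, natBits_toNat]
    rfl
  · intro i
    have hcol : natToColumn s κ (Nat.ofBits (E.dec κ (E.gen κ cc.1).2
        ((serverMessage E H M (clientMessage E x cc) (rot, key, mask, ρ)).1 i))) =
        fun q => garble H M rot key mask q (x i) i := by
      have h := dec_otAnswer x cc hN i
        (fun σ => columnToNat fun q => garble H M rot key mask q σ i)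
        (fun σ => (columnToNat_lt _).trans_le (hcap cc.1)) (ρ i)
      refine Eq.trans (congrArg _ h) (natToColumn_columnToNat _)
    have hIi : I i = packEntry (P i) (key i (P i)) := by
      rw [hI, pathEntry, dif_pos i.isLt]
    rw [hcol, hIi, ofNat_ofBits_packEntry, packEntry_natAdd]
    dsimp only
    rw [garble_eq, bxor_bxor_cancel_left, hI, hP]
    exact plainEntry_pathStates M x rot key mask i

end Path

/-! ## The simulator -/

section Simulator

variable {a b : ℕ} {ι ο : Type}

theorem append_eq_sumElim {m n : ℕ} (v : Bits (Fin m)) (w : Bits (Fin n)) :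
    Fin.append v w = fun j => Sum.elim v w (finSumFinEquiv.symm j) := by
  funext j
  refine Fin.addCases (fun i => ?_) (fun i => ?_) j <;> simp

theorem Computes.append {m n T T' : ℕ}
    {F : (Bits (Fin a) → Bits (Fin b)) → Bits ι → Bits (Fin m)}
    {G : (Bits (Fin a) → Bits (Fin b)) → Bits ι → Bits (Fin n)}
    (hF : Computes F T) (hG : Computes G T') :
    Computes (fun H x => (Fin.append (F H x) (G H x) : Bits (Fin (m + n)))) (T + T') :=
  ((hF.sumElim hG).reindex fun j => finSumFinEquiv.symm j).congr fun H x o => by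
    rw [append_eq_sumElim]

theorem Computes.bxor [Fintype ο] {T T' : ℕ}
    {F G : (Bits (Fin a) → Bits (Fin b)) → Bits ι → Bits ο}
    (hF : Computes F T) (hG : Computes G T') :
    Computes (fun H x => ObliviousFSM.bxor (F H x) (G H x))
      (Fintype.card ο * (2 * T + 2 * T' + 15)) :=
  Computes.of_bits fun o => (hF.bit o).xor (hG.bit o)

/-- The state denoted by a bit string, modulo the number of states. -/
def sampleState (s : Sizes) {m : ℕ} (y : Bits (Fin m)) : Fin s.Q := Fin.ofNat s.Q (Nat.ofBits y)

/-- Horner's rule modulo `|Q|`, with bit `0` least significant. A circuit only has to remember the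
current residue. -/
theorem sampleState_succ (s : Sizes) {m : ℕ} (y : Bits (Fin (m + 1))) :
    sampleState s y =
      Fin.ofNat s.Q (2 * (sampleState s fun i : Fin m => y i.succ).val + (y 0).toNat) := by
  apply Fin.ext
  simp only [sampleState, Fin.val_ofNat, Nat.ofBits_succ]
  have : y ∘ Fin.succ = fun i => y i.succ := rfl
  rw [this, Nat.add_mod, Nat.mul_mod, Nat.add_mod (2 * _), Nat.mul_mod 2 (_ % _), Nat.mod_mod]

/-- The one-hot encoding of `sampleState` is computed by adding the bits one by one. -/
theorem computes_oneHot (s : Sizes) : ∀ m : ℕ,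
    Computes (a := a) (b := b) (fun _ (y : Bits (Fin m)) (q : Fin s.Q) =>
      decide (sampleState s y = q)) (s.Q + m * (s.Q * (s.Q * 23 + 1)))
  | 0 => by
    have h := Computes.const (a := a) (b := b) (ι := Fin 0)
      fun q : Fin s.Q => decide (sampleState s (fun i : Fin 0 => i.elim0) = q)
    refine (h.congr fun H y o => ?_).mono (by simp)
    have : y = fun i : Fin 0 => i.elim0 := funext fun i => i.elim0
    rw [this]
  | m + 1 => by
    have ih := (computes_oneHot s m).comp (Computes.proj fun i : Fin m => i.succ)
    have hin := ih.sumElim (ComputesBit.input (a := a) (b := b) (0 : Fin (m + 1)))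
    -- One Horner step on one-hot vectors. Each of the `|Q|` terms costs `15` for the selection, `3`
    -- for the conjunction and `5` for the disjunction.
    have hstep : Computes (a := a) (b := b)
        (fun _ (w : Bits (Fin s.Q ⊕ Unit)) (q : Fin s.Q) =>
          decide (∃ q' : Fin s.Q, (w (.inl q') &&
            (if w (.inr ()) then decide (Fin.ofNat s.Q (2 * q'.val + 1) = q)
              else decide (Fin.ofNat s.Q (2 * q'.val) = q))) = true))
        (s.Q * (s.Q * 23 + 1)) := by
      refine (Computes.of_bits (T := s.Q * 23 + 1) fun q => ?_).mono (by simp)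
      have h := (ComputesBit.exists (a := a) (b := b) fun q' : Fin s.Q =>
        (ComputesBit.input (Sum.inl q' : Fin s.Q ⊕ Unit)).and
          ((ComputesBit.input (Sum.inr ())).cond
            (ComputesBit.const (decide (Fin.ofNat s.Q (2 * q'.val + 1) = q)))
            (ComputesBit.const (decide (Fin.ofNat s.Q (2 * q'.val) = q)))))
      exact Computes.mono (h.congr fun H w => by congr) (by simp)
    refine ((hstep.comp hin).congr fun H y q => ?_).mono ?_
    · rw [sampleState_succ]
      cases h : y 0 <;> simp [h]
    · linarith

/-- Cost of the one-hot encoding of a sampled state. -/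
def oneHotCost (s : Sizes) (κ : ℕ) : ℕ := s.Q + κ * (s.Q * (s.Q * 23 + 1))

theorem computes_stateBits (s : Sizes) (m : ℕ) :
    Computes (a := a) (b := b) (fun _ (y : Bits (Fin m)) => natBits s.stateBits (sampleState s y))
      (oneHotCost s m + s.stateBits * (s.Q * 9 + 1)) := by
  have h : Computes (a := a) (b := b) (fun _ (w : Bits (Fin s.Q)) (j : Fin s.stateBits) =>
      decide (∃ q : Fin s.Q, (w q && natBits s.stateBits q j) = true))
      (s.stateBits * (s.Q * 9 + 1)) := by
    refine (Computes.of_bits (T := s.Q * 9 + 1) fun j => ?_).mono (by simp)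
    have h := ComputesBit.exists (a := a) (b := b) fun q : Fin s.Q =>
      (ComputesBit.input q).and (ComputesBit.const (natBits s.stateBits q j))
    exact Computes.mono (h.congr fun H w => by congr) (by simp)
  refine (h.comp (computes_oneHot s m)).congr fun H y j => ?_
  simp

variable {s : Sizes} {κ : ℕ}

/-- The columns of the simulated matrices: the entries on the path `P` are encrypted with the hash
function under the keys `K`, the other ones are the strings `u`. -/
def simColumn (H : Hash s κ) (xb : Bits (Fin s.n × Fin s.symBits)) (P : Fin s.n → Fin s.Q)
    (K : Fin s.n → Bits (Fin κ)) (z : Bool) (u : Fin s.n × Fin s.Q → Bits (Fin (s.entryLen κ)))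
    (i : Fin s.n) (q : Fin s.Q) : Bits (Fin (s.entryLen κ)) :=
  if P i = q then
    bxor (H (Fin.append (K i) fun j => xb (i, j))) (pathEntry P K z (i + 1))
  else u (i, q)

/-- The simulated message of the server. -/
def simReply (E : HEScheme) (H : Hash s κ) (xb : Bits (Fin s.n × Fin s.symBits)) (z : Bool)
    (g : Bits (Fin (E.genCoins κ))) (ρ : Fin s.n → Bits (Fin (E.encCoins κ)))
    (P : Fin s.n → Fin s.Q) (K : Fin s.n → Bits (Fin κ))
    (u : Fin s.n × Fin s.Q → Bits (Fin (s.entryLen κ))) :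
    (Fin s.n → Bits (Fin (E.ctLen κ))) × Bits (Fin (s.entryLen κ)) :=
  (fun i => E.enc κ (E.gen κ g).1
      (natBits (E.msgLen κ) (columnToNat (simColumn H xb P K z u i))) (ρ i),
    packEntry (P 0) (K 0))

/-- Indices of the coins of the simulator: key generation, encryptions of the client, encryptions of
the columns, states, keys, and the entries outside the path. -/
abbrev SimCoins (E : HEScheme) (s : Sizes) (κ : ℕ) : Type :=
  Fin (E.genCoins κ) ⊕ (Fin s.n × Fin s.A × Fin (E.encCoins κ)) ⊕
    (Fin s.n × Fin (E.encCoins κ)) ⊕ (Fin s.n × Fin κ) ⊕ (Fin s.n × Fin κ) ⊕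
    ((Fin s.n × Fin s.Q) × Fin (s.entryLen κ))

/-- Indices of the inputs of the simulator. -/
abbrev SimInput (E : HEScheme) (s : Sizes) (κ auxLen : ℕ) : Type :=
  Fin auxLen ⊕ (Fin s.n × Fin s.symBits) ⊕ Unit ⊕ SimCoins E s κ

variable {E : HEScheme} {auxLen : ℕ}

def simState (w : Bits (SimCoins E s κ)) (i : Fin s.n) : Fin s.Q :=
  sampleState s fun j => w (.inr (.inr (.inr (.inl (i, j)))))

def simKey (w : Bits (SimCoins E s κ)) (i : Fin s.n) : Bits (Fin κ) :=
  fun j => w (.inr (.inr (.inr (.inr (.inl (i, j))))))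

def simFill (w : Bits (SimCoins E s κ)) (p : Fin s.n × Fin s.Q) : Bits (Fin (s.entryLen κ)) :=
  fun j => w (.inr (.inr (.inr (.inr (.inr (p, j))))))

def simEncCoins (w : Bits (SimCoins E s κ)) (i : Fin s.n) : Bits (Fin (E.encCoins κ)) :=
  fun j => w (.inr (.inr (.inl (i, j))))

/-- The function computed by the simulator. -/
def simView (H : Hash s κ) (w : Bits (SimInput E s κ auxLen)) : Bits (ViewIdx E s κ auxLen) :=
  let c : Bits (SimCoins E s κ) := fun j => w (.inr (.inr (.inr j)))
  let xb : Bits (Fin s.n × Fin s.symBits) := fun p => w (.inr (.inl p))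
  let reply := simReply E H xb (w (.inr (.inr (.inl ())))) (fun j => c (.inl j)) (simEncCoins c)
    (simState c) (simKey c) (simFill c)
  Sum.elim (fun j => w (.inl j)) <| Sum.elim xb <| Sum.elim (fun j => c (.inl j)) <|
    Sum.elim (fun p => c (.inr (.inl p))) <| Sum.elim (fun p => reply.1 p.1 p.2) reply.2

section Cost

variable (s κ)

/-- Cost of a state and its key. -/
def packCost : ℕ := oneHotCost s κ + s.stateBits * (s.Q * 9 + 1)

/-- Cost of an entry on the path. -/
def pathCost : ℕ :=
  s.entryLen κ * (2 * (s.entryLen κ * (1 + s.hashLen κ + s.entryLen κ)) +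
    2 * (packCost s κ + s.entryLen κ) + 15)

/-- Cost of one bit of a column. -/
def columnCost : ℕ := 2 * oneHotCost s κ + pathCost s κ + 14

variable (E)

/-- Cost of the simulator when key generation costs `T` and encryption costs `T'`. -/
def simCost (T T' : ℕ) : ℕ :=
  s.n * (T + E.msgLen κ * columnCost s κ + T') + packCost s κ

end Cost

theorem computes_oneHot_simState (i : Fin s.n) :
    Computes (a := a) (b := b) (fun _ (w : Bits (SimInput E s κ auxLen)) (q : Fin s.Q) =>
      decide (simState (fun j => w (.inr (.inr (.inr j)))) i = q)) (oneHotCost s κ) :=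
  ((computes_oneHot s κ).comp (Computes.proj fun j =>
    (.inr (.inr (.inr (.inr (.inr (.inr (.inl (i, j))))))) :
      SimInput E s κ auxLen))).mono (by simp [oneHotCost])

theorem computes_packEntry (i : Fin s.n) :
    Computes (a := a) (b := b) (fun _ (w : Bits (SimInput E s κ auxLen)) =>
      packEntry (simState (fun j => w (.inr (.inr (.inr j)))) i)
        (simKey (fun j => w (.inr (.inr (.inr j)))) i)) (packCost s κ) := by
  have h1 := (computes_stateBits (a := a) (b := b) s κ).comp (Computes.proj fun j =>
    (.inr (.inr (.inr (.inr (.inr (.inr (.inl (i, j))))))) : SimInput E s κ auxLen))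
  have h2 := Computes.proj (a := a) (b := b) fun j : Fin κ =>
    (.inr (.inr (.inr (.inr (.inr (.inr (.inr (.inl (i, j)))))))) : SimInput E s κ auxLen)
  exact (h1.append h2).mono (by simp [packCost])

theorem computes_pathEntry (k : ℕ) :
    Computes (a := a) (b := b) (fun _ (w : Bits (SimInput E s κ auxLen)) =>
      pathEntry (simState fun j => w (.inr (.inr (.inr j))))
        (simKey fun j => w (.inr (.inr (.inr j)))) (w (.inr (.inr (.inl ())))) k)
      (packCost s κ + s.entryLen κ) := by
  by_cases h : k < s.n
  · exact ((computes_packEntry ⟨k, h⟩).congr fun H w o => by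
      rw [pathEntry, dif_pos h]).mono (by omega)
  · exact (((ComputesBit.input _).natBits_toNat _).congr fun H w o => by
      rw [pathEntry, dif_neg h]).mono (by simp)

theorem computes_simColumn (i : Fin s.n) (q : Fin s.Q) (j : Fin (s.entryLen κ)) :
    ComputesBit (a := s.hashLen κ) (b := s.entryLen κ)
      (fun H (w : Bits (SimInput E s κ auxLen)) =>
        simColumn H (fun p => w (.inr (.inl p))) (simState fun j => w (.inr (.inr (.inr j))))
          (simKey fun j => w (.inr (.inr (.inr j)))) (w (.inr (.inr (.inl ()))))
          (simFill fun j => w (.inr (.inr (.inr j)))) i q j)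
      (2 * oneHotCost s κ + pathCost s κ + 13) := by
  have hq := Computes.oracle ((Computes.proj (a := s.hashLen κ) (b := s.entryLen κ)
    fun j : Fin κ =>
      (.inr (.inr (.inr (.inr (.inr (.inr (.inr (.inl (i, j)))))))) :
        SimInput E s κ auxLen)).append (Computes.proj fun j : Fin s.symBits => .inr (.inl (i, j))))
  have he := (hq.bxor (computes_pathEntry (i + 1))).bit j
  have hu := ComputesBit.input (a := s.hashLen κ) (b := s.entryLen κ)
    (.inr (.inr (.inr (.inr (.inr (.inr (.inr (.inr ((i, q), j)))))))) : SimInput E s κ auxLen)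
  refine ((((computes_oneHot_simState i).bit q).cond he hu).congr fun H w => ?_).mono ?_
  · simp only [simColumn, decide_eq_true_eq]
    split_ifs <;> rfl
  · simp [pathCost]

theorem natBits_columnToNat (m : ℕ) (col : Fin s.Q → Bits (Fin (s.entryLen κ))) (t : Fin m) :
    natBits m (columnToNat col) t =
      if h : t.val < s.Q * s.entryLen κ then
        col (finProdFinEquiv.symm ⟨t, h⟩).1 (finProdFinEquiv.symm ⟨t, h⟩).2
      else false := by
  unfold natBits columnToNat
  split_ifs with h
  · rw [Nat.testBit_ofBits_lt _ _ h]
  · rw [Nat.testBit_ofBits_ge _ _ (not_lt.1 h)]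

/-- The public key is recomputed for every answer; this wastes a factor `n` on key generation but
lets the answers be treated as separate blocks. -/
theorem computes_simView (T T' : ℕ)
    (hgen : Computes (a := s.hashLen κ) (b := s.entryLen κ)
      (fun _ (g : Bits (Fin (E.genCoins κ))) => Sum.elim (E.gen κ g).1 (E.gen κ g).2) T)
    (henc : Computes (a := s.hashLen κ) (b := s.entryLen κ)
      (fun _ (w : Bits (Fin (E.pkLen κ) ⊕ Fin (E.msgLen κ) ⊕ Fin (E.encCoins κ))) =>
        E.enc κ (fun j => w (.inl j)) (fun j => w (.inr (.inl j)))
          (fun j => w (.inr (.inr j)))) T') :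
    Computes (simView (E := E) (s := s) (κ := κ) (auxLen := auxLen)) (simCost s κ E T T') := by
  have hpk := (hgen.comp (Computes.proj fun j =>
    (.inr (.inr (.inr (.inl j))) : SimInput E s κ auxLen))).reindex Sum.inl
  have hans (i : Fin s.n) : Computes (a := s.hashLen κ) (b := s.entryLen κ)
      (fun H (w : Bits (SimInput E s κ auxLen)) =>
        E.enc κ (E.gen κ fun j => w (.inr (.inr (.inr (.inl j))))).1
          (natBits (E.msgLen κ) (columnToNat
            (simColumn H (fun p => w (.inr (.inl p))) (simState fun j => w (.inr (.inr (.inr j))))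
              (simKey fun j => w (.inr (.inr (.inr j)))) (w (.inr (.inr (.inl ()))))
              (simFill fun j => w (.inr (.inr (.inr j)))) i)))
          (simEncCoins (fun j => w (.inr (.inr (.inr j)))) i))
      (T + E.msgLen κ * columnCost s κ + T') := by
    have hmsg : Computes (a := s.hashLen κ) (b := s.entryLen κ)
        (fun H (w : Bits (SimInput E s κ auxLen)) => natBits (E.msgLen κ) (columnToNat
          (simColumn H (fun p => w (.inr (.inl p))) (simState fun j => w (.inr (.inr (.inr j))))
            (simKey fun j => w (.inr (.inr (.inr j)))) (w (.inr (.inr (.inl ()))))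
            (simFill fun j => w (.inr (.inr (.inr j)))) i)))
        (E.msgLen κ * columnCost s κ) := by
      refine (Computes.of_bits (T := columnCost s κ) fun t => ?_).mono (by simp)
      by_cases h : t.val < s.Q * s.entryLen κ
      · exact ((computes_simColumn i _ _).congr fun H w => by
          rw [natBits_columnToNat, dif_pos h]).mono (by simp [columnCost])
      · exact ((ComputesBit.const false).congr fun H w => by
          rw [natBits_columnToNat, dif_neg h]).mono (by simp [columnCost])
    have hco := Computes.proj (a := s.hashLen κ) (b := s.entryLen κ)
      fun j : Fin (E.encCoins κ) =>
        (.inr (.inr (.inr (.inr (.inr (.inl (i, j)))))) : SimInput E s κ auxLen)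
    exact ((henc.comp (hpk.sumElim (hmsg.sumElim hco))).congr fun H w o => rfl).mono (by omega)
  have hall := Computes.piProd hans
  have h1 := Computes.proj (a := s.hashLen κ) (b := s.entryLen κ)
    fun j => (.inl j : SimInput E s κ auxLen)
  have h2 := Computes.proj (a := s.hashLen κ) (b := s.entryLen κ)
    fun p => (.inr (.inl p) : SimInput E s κ auxLen)
  have h3 := Computes.proj (a := s.hashLen κ) (b := s.entryLen κ)
    fun j => (.inr (.inr (.inr (.inl j))) : SimInput E s κ auxLen)
  have h4 := Computes.proj (a := s.hashLen κ) (b := s.entryLen κ)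
    fun p => (.inr (.inr (.inr (.inr (.inl p)))) : SimInput E s κ auxLen)
  refine ((h1.sumElim (h2.sumElim (h3.sumElim (h4.sumElim
    (hall.sumElim (computes_packEntry 0)))))).congr fun H w o => rfl).mono ?_
  simp [simCost]

end Simulator

/-! ## Simulation security against the client -/

/-! ### Resampling and nearly uniform states. -/

section Sampling

variable {A B C : Type} [Fintype A] [Fintype B] [Fintype C]

theorem prob_prod_congr {p : A × B → Bool} {q : A × C → Bool}
    (h : ∀ a, prob (fun b => p (a, b)) = prob (fun c => q (a, c))) : prob p = prob q := by
  rw [prob_prod, prob_prod]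
  exact congrArg₂ _ (Finset.sum_congr rfl fun a _ => h a) rfl

/-- Resampling the values of a uniform function on a graph. -/
theorem prob_resample [DecidableEq A] [DecidableEq B] [Nonempty C] (P : A → B)
    (f : (A × B → C) → Bool) :
    prob (fun w : (A × B → C) × (A → C) =>
      f fun j => if P j.1 = j.2 then w.2 j.1 else w.1 j) = prob f := by
  let e : (A × B → C) × (A → C) ≃ (A × B → C) × (A → C) :=
    { toFun := fun w => (fun j => if P j.1 = j.2 then w.2 j.1 else w.1 j, fun i => w.1 (i, P i))
      invFun := fun w => (fun j => if P j.1 = j.2 then w.2 j.1 else w.1 j, fun i => w.1 (i, P i))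
      left_inv := fun w => by
        refine Prod.ext (funext fun j => ?_) (funext fun i => by simp)
        obtain ⟨i, q⟩ := j
        by_cases h : P i = q
        · subst h; simp
        · simp [h]
      right_inv := fun w => by
        refine Prod.ext (funext fun j => ?_) (funext fun i => by simp)
        obtain ⟨i, q⟩ := j
        by_cases h : P i = q
        · subst h; simp
        · simp [h] }
  exact (prob_equiv e fun v : (A × B → C) × (A → C) => f v.1).trans (prob_fst f)

/-- Bit strings of length `m` are the numbers below `2 ^ m`. -/
def bitsEquivFin (m : ℕ) : Bits (Fin m) ≃ Fin (2 ^ m) where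
  toFun y := ⟨Nat.ofBits y, Nat.ofBits_lt_two_pow y⟩
  invFun k := natBits m k
  left_inv y := by
    funext j
    exact Nat.testBit_ofBits_lt _ _ j.isLt
  right_inv k := Fin.ext (ofBits_natBits k.isLt)

/-- A residue class modulo `|Q|` has the floor of `2 ^ m / |Q|` elements below `2 ^ m`, or one more;
the count is within `1` of `2 ^ m / |Q|`. -/
theorem prob_sampleState (s : Sizes) (m : ℕ) (a : Fin s.Q) :
    |prob (fun q : Fin s.Q => decide (q = a)) -
      prob (fun y : Bits (Fin m) => decide (sampleState s y = a))| ≤ 1 / (2 : ℝ) ^ m := by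
  have hQ : (0 : ℝ) < s.Q := by exact_mod_cast s.Q_pos
  have h2 : (0 : ℝ) < (2 : ℝ) ^ m := by positivity
  have h1 : prob (fun q : Fin s.Q => decide (q = a)) = 1 / s.Q := by
    simp [prob, Finset.filter_eq']
  have h3 : prob (fun y : Bits (Fin m) => decide (sampleState s y = a)) =
      (Nat.count (fun k => k ≡ a [MOD s.Q]) (2 ^ m) : ℝ) / 2 ^ m := by
    have := prob_equiv (bitsEquivFin m)
      fun k : Fin (2 ^ m) => decide (Fin.ofNat s.Q k.val = a)
    refine Eq.trans this ?_
    have hs := Fin.sum_univ_eq_sum_range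
      (fun k => if decide (Fin.ofNat s.Q k = a) = true then (1 : ℝ) else 0) (2 ^ m)
    have hmod : ∀ k, Fin.ofNat s.Q k = a ↔ k ≡ a [MOD s.Q] := by
      intro k
      rw [Fin.ext_iff, Fin.val_ofNat, Nat.ModEq, Nat.mod_eq_of_lt a.isLt]
    rw [prob_eq_sum, hs, Nat.count_eq_card_filter_range]
    simp only [decide_eq_true_eq, hmod, Finset.sum_boole, Fintype.card_fin, Nat.cast_pow,
      Nat.cast_ofNat]
  have hc := Nat.count_modEq_card (2 ^ m) s.Q_pos a
  obtain ⟨e, he, hcount⟩ : ∃ e : ℝ, (0 ≤ e ∧ e ≤ 1) ∧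
      (Nat.count (fun k => k ≡ a [MOD s.Q]) (2 ^ m) : ℝ) = (2 ^ m / s.Q : ℕ) + e := by
    rw [hc]
    refine ⟨((if a % s.Q < 2 ^ m % s.Q then 1 else 0 : ℕ) : ℝ), ?_, by push_cast; rfl⟩
    split_ifs <;> simp
  have hdiv : (s.Q : ℝ) * (2 ^ m / s.Q : ℕ) + (2 ^ m % s.Q : ℕ) = 2 ^ m := by
    exact_mod_cast Nat.div_add_mod (2 ^ m) s.Q
  have hr : ((2 ^ m % s.Q : ℕ) : ℝ) / s.Q ≤ 1 :=
    div_le_one_of_le₀ (by exact_mod_cast (Nat.mod_lt _ s.Q_pos).le) hQ.le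
  have hr0 : 0 ≤ ((2 ^ m % s.Q : ℕ) : ℝ) / s.Q := by positivity
  have hd : (2 : ℝ) ^ m / s.Q = (2 ^ m / s.Q : ℕ) + ((2 ^ m % s.Q : ℕ) : ℝ) / s.Q := by
    rw [← hdiv]; field_simp
  have hfin : 1 / (s.Q : ℝ) - ((2 ^ m / s.Q : ℕ) + e) / 2 ^ m =
      (((2 ^ m % s.Q : ℕ) : ℝ) / s.Q - e) / 2 ^ m := by
    rw [eq_div_iff h2.ne', sub_mul, div_mul_cancel₀ _ h2.ne', one_div_mul_eq_div, hd]
    ring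
  rw [h1, h3, hcount, hfin, abs_div, abs_of_pos h2]
  gcongr
  rw [abs_le]
  constructor <;> linarith [he.1, he.2]

theorem abs_prob_sampleState_sub_le (s : Sizes) (m : ℕ) (ψ : Fin s.Q → Bool) :
    |prob ψ - prob (fun y : Bits (Fin m) => ψ (sampleState s y))| ≤ s.Q * (1 / (2 : ℝ) ^ m) := by
  have h1 := prob_comp_eq_sum (fun q : Fin s.Q => q) ψ
  rw [h1, prob_comp_eq_sum, ← Finset.sum_sub_distrib]
  refine (Finset.abs_sum_le_sum_abs _ _).trans
    ((Finset.sum_le_sum fun a _ => ?_).trans (b := ∑ _a : Fin s.Q, 1 / (2 : ℝ) ^ m)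
      (le_of_eq (by simp)))
  rw [← mul_sub, abs_mul]
  refine (mul_le_of_le_one_left (abs_nonneg _) ?_).trans (prob_sampleState s m a)
  split_ifs <;> simp

end Sampling

/-! ### The game hops from the real to the simulated view. -/

section Games

variable {E : HEScheme} {s : Sizes} {κ auxLen : ℕ} {τ : Type}

theorem packQuery_injective (σ : Fin s.A) :
    Function.Injective fun k : Bits (Fin κ) => (packQuery k σ : Bits (Fin (s.hashLen κ))) := by
  intro k k' h
  funext j
  have := congrFun h (Fin.castAdd s.symBits j)
  simpa [packQuery] using this

theorem simColumn_path (H : Hash s κ) (x : Input s) (P : Fin s.n → Fin s.Q)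
    (K : Fin s.n → Bits (Fin κ)) (z : Bool) (u : Fin s.n × Fin s.Q → Bits (Fin (s.entryLen κ)))
    (i : Fin s.n) : simColumn H (inputBits x) P K z u i (P i) =
      bxor (H (packQuery (K i) (x i))) (pathEntry P K z (i + 1)) := by
  rw [simColumn, if_pos rfl]
  rfl

/-- Simulated columns with honest path data and honest filling outside the path are the real ones,
so all later games are instances of one decision procedure. The filling on the path is irrelevant.
-/
theorem simColumn_garble (H : Hash s κ) (M : FSM s) (x : Input s) (rot : Fin s.n → Fin s.Q)
    (key : Fin s.n → Fin s.Q → Bits (Fin κ)) (mask : Bool)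
    (u : Fin s.n × Fin s.Q → Bits (Fin (s.entryLen κ)))
    (hu : ∀ i q, pathStates M x rot i ≠ q → u (i, q) = garble H M rot key mask q (x i) i)
    (i : Fin s.n) :
    simColumn H (inputBits x) (pathStates M x rot) (fun i => key i (pathStates M x rot i))
      (clientShare M x mask) u i = fun q => garble H M rot key mask q (x i) i := by
  funext q
  by_cases h : pathStates M x rot i = q
  · subst h
    rw [simColumn_path, garble_eq, plainEntry_pathStates]
  · rw [simColumn, if_neg h, hu i q h]

/-- The decision of a distinguisher on a simulated view. -/
noncomputable def simDecision (dec : Hash s κ → Bits (ViewIdx E s κ auxLen) → Bool → Bool → τ → Bool)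
    (M : FSM s) (x : Input s) (aux : Bits (Fin auxLen)) (H : Hash s κ) (cc : ClientCoins E s κ)
    (ρ : Fin s.n → Bits (Fin (E.encCoins κ))) (P : Fin s.n → Fin s.Q)
    (K : Fin s.n → Bits (Fin κ)) (u : Fin s.n × Fin s.Q → Bits (Fin (s.entryLen κ)))
    (mask : Bool) (t : τ) : Bool :=
  dec H (clientView E aux x cc
    (simReply E H (inputBits x) (clientShare M x mask) cc.1 ρ P K u)) (clientShare M x mask) mask t

variable (dec : Hash s κ → Bits (ViewIdx E s κ auxLen) → Bool → Bool → τ → Bool)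
    (M : FSM s) (x : Input s) (aux : Bits (Fin auxLen))

/-- Besides the `T` queries of the distinguisher, the `n` path entries are hashed when the view is
formed. -/
theorem exists_queries_simDecision (T : ℕ)
    (hdec : ∀ H v z r t, ∃ S : Finset (Bits (Fin (s.hashLen κ))), S.card ≤ T ∧
      ∀ H' : Hash s κ, (∀ y ∈ S, H' y = H y) → dec H' v z r t = dec H v z r t)
    (H : Hash s κ) (cc : ClientCoins E s κ)
    (ρ : Fin s.n → Bits (Fin (E.encCoins κ))) (P : Fin s.n → Fin s.Q)
    (K : Fin s.n → Bits (Fin κ)) (u : Fin s.n × Fin s.Q → Bits (Fin (s.entryLen κ)))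
    (mask : Bool) (t : τ) :
    ∃ S : Finset (Bits (Fin (s.hashLen κ))), S.card ≤ s.n + T ∧
      ∀ H' : Hash s κ, (∀ y ∈ S, H' y = H y) →
        simDecision dec M x aux H' cc ρ P K u mask t =
          simDecision dec M x aux H cc ρ P K u mask t := by
  classical
  obtain ⟨S, hS, hH⟩ := hdec H (clientView E aux x cc
    (simReply E H (inputBits x) (clientShare M x mask) cc.1 ρ P K u)) (clientShare M x mask) mask t
  refine ⟨Finset.univ.image (fun i => packQuery (K i) (x i)) ∪ S, ?_, fun H' h => ?_⟩
  · refine (Finset.card_union_le _ _).trans (add_le_add ?_ hS)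
    exact Finset.card_image_le.trans (by simp)
  · have hreply : simReply E H' (inputBits x) (clientShare M x mask) cc.1 ρ P K u =
        simReply E H (inputBits x) (clientShare M x mask) cc.1 ρ P K u := by
      have hcol : ∀ i, simColumn H' (inputBits x) P K (clientShare M x mask) u i =
          simColumn H (inputBits x) P K (clientShare M x mask) u i := by
        intro i
        funext q
        by_cases hq : P i = q
        · subst hq
          rw [simColumn_path, simColumn_path, h _ (Finset.mem_union_left _
            (Finset.mem_image_of_mem _ (Finset.mem_univ i)))]
        · rw [simColumn, if_neg hq, simColumn, if_neg hq]
      simp only [simReply, hcol]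
    rw [simDecision, simDecision, hreply]
    exact hH H' fun y hy => h y (Finset.mem_union_right _ hy)

variable [Fintype τ]

/-- Splitting the coins of the simulator. -/
def simCoinsEquiv (E : HEScheme) (s : Sizes) (κ : ℕ) : Bits (SimCoins E s κ) ≃
    ClientCoins E s κ × (Fin s.n → Bits (Fin (E.encCoins κ))) × (Fin s.n → Bits (Fin κ)) ×
      (Fin s.n × Fin s.Q → Bits (Fin (s.entryLen κ))) × (Fin s.n → Bits (Fin κ)) where
  toFun c := ((fun j => c (.inl j), fun i σ j => c (.inr (.inl (i, σ, j)))), simEncCoins c,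
    simKey c, simFill c, fun i j => c (.inr (.inr (.inr (.inl (i, j))))))
  invFun v := Sum.elim v.1.1 <| Sum.elim (fun p => v.1.2 p.1 p.2.1 p.2.2) <|
    Sum.elim (fun p => v.2.1 p.1 p.2) <| Sum.elim (fun p => v.2.2.2.2 p.1 p.2) <|
    Sum.elim (fun p => v.2.2.1 p.1 p.2) fun p => v.2.2.2.1 p.1 p.2
  left_inv c := by
    funext j
    rcases j with j | j | j | j | j | j <;> rfl
  right_inv _ := rfl

/-- A regrouping of coins. The bits that encode the states come last, since they are what the final
hop varies. -/
theorem prob_simView_eq {N : ℕ} (d : SimCoins E s κ ≃ Fin N) :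
    prob (fun w : Hash s κ × Bool × Bits (Fin N) × τ =>
      dec w.1 (simView w.1 (Sum.elim aux (Sum.elim (inputBits x)
        (Sum.elim (fun _ => clientShare M x w.2.1) fun j => w.2.2.1 (d j))))) (clientShare M x w.2.1) w.2.1
        w.2.2.2) =
      prob (fun w : (Hash s κ × Bool × ClientCoins E s κ × τ ×
          (Fin s.n → Bits (Fin (E.encCoins κ))) × (Fin s.n → Bits (Fin κ)) ×
          (Fin s.n × Fin s.Q → Bits (Fin (s.entryLen κ)))) × (Fin s.n → Bits (Fin κ)) =>
        simDecision dec M x aux w.1.1 w.1.2.2.1 w.1.2.2.2.2.1 (fun i => sampleState s (w.2 i))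
          w.1.2.2.2.2.2.1 w.1.2.2.2.2.2.2 w.1.2.1 w.1.2.2.2.1) := by
  let e' : (ClientCoins E s κ × (Fin s.n → Bits (Fin (E.encCoins κ))) ×
      (Fin s.n → Bits (Fin κ)) × (Fin s.n × Fin s.Q → Bits (Fin (s.entryLen κ))) ×
      (Fin s.n → Bits (Fin κ))) × τ ≃
      (ClientCoins E s κ × τ × (Fin s.n → Bits (Fin (E.encCoins κ))) × (Fin s.n → Bits (Fin κ)) ×
        (Fin s.n × Fin s.Q → Bits (Fin (s.entryLen κ)))) × (Fin s.n → Bits (Fin κ)) :=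
    { toFun := fun w => ((w.1.1, w.2, w.1.2.1, w.1.2.2.1, w.1.2.2.2.1), w.1.2.2.2.2)
      invFun := fun v => ((v.1.1, v.1.2.2.1, v.1.2.2.2.1, v.1.2.2.2.2, v.2), v.1.2.1)
      left_inv := fun _ => rfl
      right_inv := fun _ => rfl }
  let e : Hash s κ × Bool × Bits (Fin N) × τ ≃
      (Hash s κ × Bool × ClientCoins E s κ × τ ×
          (Fin s.n → Bits (Fin (E.encCoins κ))) × (Fin s.n → Bits (Fin κ)) ×
          (Fin s.n × Fin s.Q → Bits (Fin (s.entryLen κ)))) × (Fin s.n → Bits (Fin κ)) :=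
    ((Equiv.refl _).prodCongr ((Equiv.refl _).prodCongr
      ((((d.arrowCongr (Equiv.refl Bool)).symm.trans (simCoinsEquiv E s κ)).prodCongr (Equiv.refl τ)).trans e'))).trans
      { toFun := fun w => ((w.1, w.2.1, w.2.2.1), w.2.2.2)
        invFun := fun v => (v.1.1, v.1.2.1, v.1.2.2, v.2)
        left_inv := fun _ => rfl
        right_inv := fun _ => rfl }
  rw [← prob_equiv e]
  rfl

variable [Nonempty τ]

/-- The answers of the server may be replaced by fresh encryptions of the columns. -/
theorem abs_real_sub_le (hκ : κ ≠ 0)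
    (hcap : ∀ g : Bits (Fin (E.genCoins κ)),
      2 ^ (s.Q * s.entryLen κ) ≤ E.modulus κ (E.gen κ g).1) {ε : ℕ → ℝ}
    (hε : ∀ κ (g : Bits (Fin (E.genCoins κ)))
      (c : Bits (Fin (E.ctLen κ))) (m : Bits (Fin (E.msgLen κ))),
      Nat.ofBits m < E.modulus κ (E.gen κ g).1 →
      IsCt E.toHEAlgorithms κ (E.gen κ g).1 c (Nat.ofBits m : ZMod (E.modulus κ (E.gen κ g).1)) →
      statDist
        (fun ρ : Bits (Fin (E.encCoins κ)) =>
          E.add κ (E.gen κ g).1 (E.enc κ (E.gen κ g).1 (natBits (E.msgLen κ) 0) ρ) c)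
        (fun ρ : Bits (Fin (E.encCoins κ)) => E.enc κ (E.gen κ g).1 m ρ) ≤ ε κ) :
    |prob (fun w : Hash s κ × ClientCoins E s κ × ServerCoins E s κ × τ =>
        dec w.1 (clientView E aux x w.2.1
            (serverMessage E w.1 M (clientMessage E x w.2.1) w.2.2.1))
          (clientOutput E w.1 x w.2.1
            (serverMessage E w.1 M (clientMessage E x w.2.1) w.2.2.1)) w.2.2.1.2.2.1 w.2.2.2) -
      prob (fun w : (Hash s κ × ClientCoins E s κ × (Fin s.n → Fin s.Q) ×
          (Fin s.n → Fin s.Q → Bits (Fin κ)) × Bool × τ) ×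
          (Fin s.n → Bits (Fin (E.encCoins κ))) =>
        simDecision dec M x aux w.1.1 w.1.2.1 w.2 (pathStates M x w.1.2.2.1)
          (fun i => w.1.2.2.2.1 i (pathStates M x w.1.2.2.1 i))
          (fun p => garble w.1.1 M w.1.2.2.1 w.1.2.2.2.1 w.1.2.2.2.2.1 p.2 (x p.1) p.1)
          w.1.2.2.2.2.1 w.1.2.2.2.2.2)| ≤ s.n * (2 * ε κ) := by
  let e : Hash s κ × ClientCoins E s κ × ServerCoins E s κ × τ ≃
      (Hash s κ × ClientCoins E s κ × (Fin s.n → Fin s.Q) ×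
          (Fin s.n → Fin s.Q → Bits (Fin κ)) × Bool × τ) ×
          (Fin s.n → Bits (Fin (E.encCoins κ))) :=
    { toFun := fun w => ((w.1, w.2.1, w.2.2.1.1, w.2.2.1.2.1, w.2.2.1.2.2.1, w.2.2.2),
        w.2.2.1.2.2.2)
      invFun := fun v => (v.1.1, v.1.2.1, (v.1.2.2.1, v.1.2.2.2.1, v.1.2.2.2.2.1, v.2),
        v.1.2.2.2.2.2)
      left_inv := fun _ => rfl
      right_inv := fun _ => rfl }
  rw [← prob_equiv e.symm]
  refine abs_prob_prod_sub_le _ _ _ fun ⟨H, cc, rot, key, mask, t⟩ => ?_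
  have hN := one_lt_modulus hκ (hcap cc.1)
  let b (i : Fin s.n) (σ : Fin s.A) : ℕ := columnToNat fun q => garble H M rot key mask q σ i
  have hb : ∀ i σ, b i σ < E.modulus κ (E.gen κ cc.1).1 := fun i σ =>
    (columnToNat_lt _).trans_le (hcap cc.1)
  let start : Bits (Fin (s.entryLen κ)) :=
    packEntry (M.start + rot 0) (key 0 (M.start + rot 0))
  -- Key pair, oracle and matrices are fixed; the answers now depend on disjoint coins and are
  -- replaced one by one.
  have h := abs_prob_pi_sub_le (2 * ε κ) s.n
    (fun i ρ => otAnswer E (E.gen κ cc.1).1 ((clientMessage E x cc).2 i) (b i) ρ)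
    (fun i ρ => E.enc κ (E.gen κ cc.1).1 (natBits (E.msgLen κ) (b i (x i))) ρ)
    (fun i ψ => (abs_prob_comp_sub_le_statDist _ _ ψ).trans
      (mul_le_mul_of_nonneg_left (statDist_otAnswer_le hε x cc hN i (b i) (hb i)) two_pos.le))
    fun d => dec H (clientView E aux x cc (d, start)) (clientShare M x mask) mask t
  refine le_trans (le_of_eq (congrArg abs (congrArg₂ _ (congrArg prob (funext fun ρ => ?_))
    (congrArg prob (funext fun ρ => ?_))))) h
  · have hout := clientOutput_eq hκ hcap H M x cc (rot, key, mask, ρ)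
    change dec H _ (clientOutput E H x cc
      (serverMessage E H M (clientMessage E x cc) (rot, key, mask, ρ))) mask t = _
    rw [hout]
    rfl
  · have hcol := simColumn_garble H M x rot key mask
      (fun p => garble H M rot key mask p.2 (x p.1) p.1) fun _ _ _ => rfl
    simp only [simDecision, simReply, hcol]
    rfl

/-- The entries outside the path may be replaced by random strings. -/
theorem abs_garble_sub_fill_le (T : ℕ)
    (hdec : ∀ H v z r t, ∃ S : Finset (Bits (Fin (s.hashLen κ))), S.card ≤ T ∧
      ∀ H' : Hash s κ, (∀ y ∈ S, H' y = H y) → dec H' v z r t = dec H v z r t) :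
    |prob (fun w : (Hash s κ × ClientCoins E s κ × (Fin s.n → Fin s.Q) ×
          (Fin s.n → Fin s.Q → Bits (Fin κ)) × Bool × τ) ×
          (Fin s.n → Bits (Fin (E.encCoins κ))) =>
        simDecision dec M x aux w.1.1 w.1.2.1 w.2 (pathStates M x w.1.2.2.1)
          (fun i => w.1.2.2.2.1 i (pathStates M x w.1.2.2.1 i))
          (fun p => garble w.1.1 M w.1.2.2.1 w.1.2.2.2.1 w.1.2.2.2.2.1 p.2 (x p.1) p.1)
          w.1.2.2.2.2.1 w.1.2.2.2.2.2) -
      prob (fun w : (ClientCoins E s κ × Bool × τ × (Fin s.n → Bits (Fin (E.encCoins κ))) ×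
          (Fin s.n → Fin s.Q) × (Fin s.n → Bits (Fin κ))) ×
          (Hash s κ × (Fin s.n × Fin s.Q → Bits (Fin (s.entryLen κ)))) =>
        simDecision dec M x aux w.2.1 w.1.1 w.1.2.2.2.1 (pathStates M x w.1.2.2.2.2.1)
          w.1.2.2.2.2.2 w.2.2 w.1.2.1 w.1.2.2.1)| ≤
      ((s.n * s.Q * (s.n * s.Q + (s.n + T)) : ℕ) : ℝ) * (1 / (2 : ℝ) ^ κ) := by
  let Rest := ClientCoins E s κ × Bool × τ × (Fin s.n → Bits (Fin (E.encCoins κ))) ×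
    (Fin s.n → Fin s.Q)
  let Keys := Fin s.n × Fin s.Q → Bits (Fin κ)
  -- Keys on the path, which the client learns, are separated from the secret ones by taking them
  -- from an independent family `K`.
  let merge (rot : Fin s.n → Fin s.Q) (K : Fin s.n → Bits (Fin κ)) (key : Keys) : Keys :=
    fun j => if pathStates M x rot j.1 = j.2 then K j.1 else key j
  let real (w : Rest) (H : Hash s κ) (key : Keys) : Bool :=
    simDecision dec M x aux H w.1 w.2.2.2.1 (pathStates M x w.2.2.2.2)
      (fun i => key (i, pathStates M x w.2.2.2.2 i))
      (fun p => garble H M w.2.2.2.2 (fun i q => key (i, q)) w.2.1 p.2 (x p.1) p.1) w.2.1 w.2.2.1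
  let e1 : (Hash s κ × ClientCoins E s κ × (Fin s.n → Fin s.Q) ×
          (Fin s.n → Fin s.Q → Bits (Fin κ)) × Bool × τ) ×
          (Fin s.n → Bits (Fin (E.encCoins κ))) ≃ (Rest × Hash s κ) × Keys :=
    { toFun := fun w => (((w.1.2.1, w.1.2.2.2.2.1, w.1.2.2.2.2.2, w.2, w.1.2.2.1), w.1.1),
        fun j => w.1.2.2.2.1 j.1 j.2)
      invFun := fun v => ((v.1.2, v.1.1.1, v.1.1.2.2.2.2, fun i q => v.2 (i, q), v.1.1.2.1,
        v.1.1.2.2.1), v.1.1.2.2.2.1)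
      left_inv := fun _ => rfl
      right_inv := fun _ => rfl }
  let e2 : (Rest × Hash s κ) × Keys × (Fin s.n → Bits (Fin κ)) ≃
      (ClientCoins E s κ × Bool × τ × (Fin s.n → Bits (Fin (E.encCoins κ))) ×
        (Fin s.n → Fin s.Q) × (Fin s.n → Bits (Fin κ))) × Hash s κ × Keys :=
    { toFun := fun w => ((w.1.1.1, w.1.1.2.1, w.1.1.2.2.1, w.1.1.2.2.2.1, w.1.1.2.2.2.2, w.2.2),
        w.1.2, w.2.1)
      invFun := fun v => (((v.1.1, v.1.2.1, v.1.2.2.1, v.1.2.2.2.1, v.1.2.2.2.2.1), v.2.1), v.2.2,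
        v.1.2.2.2.2.2)
      left_inv := fun _ => rfl
      right_inv := fun _ => rfl }
  -- Resampling on the path keeps the merged table uniform. Afterwards `K` can be fixed while the
  -- whole table `key` remains uniform.
  have h1 : prob (fun w : (Rest × Hash s κ) × Keys => real w.1.1 w.1.2 w.2) =
      prob (fun w : (Rest × Hash s κ) × Keys × (Fin s.n → Bits (Fin κ)) =>
        real w.1.1 w.1.2 (merge w.1.1.2.2.2.2 w.2.2 w.2.1)) :=
    prob_prod_congr fun a => (prob_resample (pathStates M x a.1.2.2.2.2)
      fun key => real a.1 a.2 key).symm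
  have h2 := prob_equiv e1 fun w => real w.1.1 w.1.2 w.2
  have h3 := prob_equiv e2.symm fun w => real w.1.1 w.1.2 (merge w.1.1.2.2.2.2 w.2.2 w.2.1)
  rw [h1, ← h3] at h2
  refine le_trans (le_of_eq (congrArg abs (congrArg₂ _ h2 rfl))) ?_
  refine abs_prob_prod_sub_le _ _ _ fun ⟨cc, mask, t, ρ, rot, K⟩ => ?_
  -- The masked plaintexts contain keys themselves, hence a message family depending on the key
  -- table. Path positions are masked as well, for the sake of a simple index set; the columns
  -- ignore the filling there.
  have hmask := abs_prob_mask_sub_le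
    (fun (j : Fin s.n × Fin s.Q) (k : Bits (Fin κ)) =>
      (packQuery k (x j.1) : Bits (Fin (s.hashLen κ))))
    (fun j => packQuery_injective (x j.1))
    (fun key j => plainEntry M rot (fun i q => merge rot K key (i, q)) mask j.2 (x j.1) j.1)
    (fun H u => simDecision dec M x aux H cc ρ (pathStates M x rot) K u mask t) (s.n + T)
    (fun H u => exists_queries_simDecision dec M x aux T hdec H cc ρ _ K u mask t)
  refine le_trans (le_of_eq (congrArg abs (congrArg₂ _ (congrArg prob (funext fun w => ?_)) rfl)))
    (hmask.trans (le_of_eq ?_))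
  · change simDecision dec M x aux w.1 cc ρ (pathStates M x rot)
      (fun i => merge rot K w.2 (i, pathStates M x rot i))
      (fun p => garble w.1 M rot (fun i q => merge rot K w.2 (i, q)) mask p.2 (x p.1) p.1)
      mask t = _
    have hK : (fun i => merge rot K w.2 (i, pathStates M x rot i)) = K := by
      funext i
      exact if_pos rfl
    have hcol : ∀ u v : Fin s.n × Fin s.Q → Bits (Fin (s.entryLen κ)),
        (∀ i q, pathStates M x rot i ≠ q → u (i, q) = v (i, q)) →
        simDecision dec M x aux w.1 cc ρ (pathStates M x rot) K u mask t =
          simDecision dec M x aux w.1 cc ρ (pathStates M x rot) K v mask t := by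
      intro u v huv
      have : ∀ i, simColumn w.1 (inputBits x) (pathStates M x rot) K (clientShare M x mask) u i =
          simColumn w.1 (inputBits x) (pathStates M x rot) K (clientShare M x mask) v i := by
        intro i
        funext q
        by_cases hq : pathStates M x rot i = q
        · rw [simColumn, if_pos hq, simColumn, if_pos hq]
        · rw [simColumn, if_neg hq, simColumn, if_neg hq, huv i q hq]
      simp only [simDecision, simReply, this]
    rw [hK]
    refine hcol _ _ fun i q hq => ?_
    rw [garble_eq]
    have : merge rot K w.2 (i, q) = w.2 (i, q) := if_neg hq
    simp only [this]
  · simp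

/-- The states may be sampled from bits. -/
theorem abs_states_sub_le :
    |prob (fun w : (ClientCoins E s κ × Bool × τ × (Fin s.n → Bits (Fin (E.encCoins κ))) ×
          (Fin s.n → Fin s.Q) × (Fin s.n → Bits (Fin κ))) ×
          (Hash s κ × (Fin s.n × Fin s.Q → Bits (Fin (s.entryLen κ)))) =>
        simDecision dec M x aux w.2.1 w.1.1 w.1.2.2.2.1 (pathStates M x w.1.2.2.2.2.1)
          w.1.2.2.2.2.2 w.2.2 w.1.2.1 w.1.2.2.1) -
      prob (fun w : (Hash s κ × Bool × ClientCoins E s κ × τ ×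
          (Fin s.n → Bits (Fin (E.encCoins κ))) × (Fin s.n → Bits (Fin κ)) ×
          (Fin s.n × Fin s.Q → Bits (Fin (s.entryLen κ)))) × (Fin s.n → Bits (Fin κ)) =>
        simDecision dec M x aux w.1.1 w.1.2.2.1 w.1.2.2.2.2.1 (fun i => sampleState s (w.2 i))
          w.1.2.2.2.2.2.1 w.1.2.2.2.2.2.2 w.1.2.1 w.1.2.2.2.1)| ≤
      s.n * (s.Q * (1 / (2 : ℝ) ^ κ)) := by
  let e : (ClientCoins E s κ × Bool × τ × (Fin s.n → Bits (Fin (E.encCoins κ))) ×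
          (Fin s.n → Fin s.Q) × (Fin s.n → Bits (Fin κ))) ×
          (Hash s κ × (Fin s.n × Fin s.Q → Bits (Fin (s.entryLen κ)))) ≃
      (Hash s κ × Bool × ClientCoins E s κ × τ ×
          (Fin s.n → Bits (Fin (E.encCoins κ))) × (Fin s.n → Bits (Fin κ)) ×
          (Fin s.n × Fin s.Q → Bits (Fin (s.entryLen κ)))) × (Fin s.n → Fin s.Q) :=
    { toFun := fun w => ((w.2.1, w.1.2.1, w.1.1, w.1.2.2.1, w.1.2.2.2.1, w.1.2.2.2.2.2, w.2.2),
        w.1.2.2.2.2.1)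
      invFun := fun v => ((v.1.2.2.1, v.1.2.1, v.1.2.2.2.1, v.1.2.2.2.2.1, v.2, v.1.2.2.2.2.2.1),
        v.1.1, v.1.2.2.2.2.2.2)
      left_inv := fun _ => rfl
      right_inv := fun _ => rfl }
  rw [← prob_equiv e.symm]
  refine abs_prob_prod_sub_le _ _ _ fun ⟨H, mask, cc, t, ρ, K, u⟩ => ?_
  refine abs_prob_pi_sub_le (s.Q * (1 / (2 : ℝ) ^ κ)) s.n (fun i r => stateAfter M x i + r)
    (fun _ y => sampleState s y) (fun i ψ => ?_)
    fun P => simDecision dec M x aux H cc ρ P K u mask t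
  -- Translation by the true state is a bijection of the residues, so the rotated state is uniform
  -- independently of the machine.
  have h := prob_equiv (Equiv.addLeft (stateAfter M x i)) ψ
  simp only [Equiv.coe_addLeft] at h
  rw [h]
  exact abs_prob_sampleState_sub_le s κ ψ

end Games

section Client

variable {E : HEScheme} {s : ℕ → Sizes}

theorem polyBounded_simCost (hQ : PolyBounded fun κ => (s κ).Q)
    (hA : PolyBounded fun κ => (s κ).A) (hn : PolyBounded fun κ => (s κ).n) {T T' : ℕ → ℕ}
    (hT : PolyBounded T) (hT' : PolyBounded T') (hmsg : PolyBounded E.msgLen) :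
    PolyBounded fun κ => simCost (s κ) κ E (T κ) (T' κ) := by
  have hent := polyBounded_entryLen s hQ
  have hone : PolyBounded fun κ => oneHotCost (s κ) κ :=
    hQ.add (PolyBounded.id.mul (hQ.mul ((hQ.mul (PolyBounded.const 23)).add
      (PolyBounded.const 1))))
  have hst : PolyBounded fun κ => (s κ).stateBits :=
    hent.mono fun κ => by unfold Sizes.entryLen; omega
  have hpack : PolyBounded fun κ => packCost (s κ) κ :=
    hone.add (hst.mul ((hQ.mul (PolyBounded.const 9)).add (PolyBounded.const 1)))
  have hpath : PolyBounded fun κ => pathCost (s κ) κ :=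
    hent.mul ((((PolyBounded.const 2).mul (hent.mul (((PolyBounded.const 1).add
      (polyBounded_hashLen s hA)).add hent))).add
      ((PolyBounded.const 2).mul (hpack.add hent))).add (PolyBounded.const 15))
  have hcol : PolyBounded fun κ => columnCost (s κ) κ :=
    (((PolyBounded.const 2).mul hone).add hpath).add (PolyBounded.const 14)
  exact (hn.mul ((hT.add (hmsg.mul hcol)).add hT')).add hpack

theorem exists_simulator (hQ : PolyBounded fun κ => (s κ).Q)
    (hA : PolyBounded fun κ => (s κ).A) (hn : PolyBounded fun κ => (s κ).n) {auxLen : ℕ → ℕ}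
    (haux : PolyBounded auxLen) :
    ∃ S : Simulator E s auxLen, ∃ d : ∀ κ, SimCoins E (s κ) κ ≃ Fin (S.coins κ),
      ∀ κ H w, (S.circuit κ).run H w = simView H fun j =>
        w (Sum.map id (Sum.map id (Sum.map id (d κ))) j) := by
  obtain ⟨T, hT, hTin, -, hTc⟩ := Computes.of_polyComputable E.gen_poly
  obtain ⟨T', hT', hTin', hTout', hTc'⟩ := Computes.of_polyComputable E.enc_poly
  have hgen : PolyBounded E.genCoins := hT.mono fun κ => le_trans (by simp) (hTin κ)
  have hmsg : PolyBounded E.msgLen := hT'.mono fun κ => le_trans (by simp; omega) (hTin' κ)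
  have henc : PolyBounded E.encCoins := hT'.mono fun κ => le_trans (by simp; omega) (hTin' κ)
  have hct : PolyBounded E.ctLen := hT'.mono fun κ => le_trans (by simp) (hTout' κ)
  have hent := polyBounded_entryLen s hQ
  have hsym : PolyBounded fun κ => (s κ).symBits :=
    (polyBounded_hashLen s hA).mono fun κ => by unfold Sizes.hashLen; omega
  let d κ := Fintype.equivFin (SimCoins E (s κ) κ)
  have h κ := ((computes_simView (E := E) (s := s κ) (κ := κ) (auxLen := auxLen κ) (T κ) (T' κ)
    (hTc κ _ _) (hTc' κ _ _)).comp (Computes.proj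
      (Sum.map (id : Fin (auxLen κ) → _) (Sum.map (id : Fin (s κ).n × Fin (s κ).symBits → _)
        (Sum.map (id : Unit → _) (d κ)))))).toCircuit
  choose C hCs hC using h
  have hcoins : PolyBounded fun κ => Fintype.card (SimCoins E (s κ) κ) := by
    refine (hgen.add ((hn.mul (hA.mul henc)).add ((hn.mul henc).add ((hn.mul PolyBounded.id).add
      ((hn.mul PolyBounded.id).add ((hn.mul hQ).mul hent)))))).mono fun κ => ?_
    simp only [Fintype.card_sum, Fintype.card_prod, Fintype.card_fin]
    exact le_rfl
  refine ⟨⟨fun κ => Fintype.card (SimCoins E (s κ) κ), C, ?_⟩, d, hC⟩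
  refine (((polyBounded_simCost (E := E) hQ hA hn hT hT' hmsg).add
    (haux.add ((hn.mul hsym).add ((PolyBounded.const 1).add hcoins)))).add
    (haux.add ((hn.mul hsym).add (hgen.add ((hn.mul (hA.mul henc)).add
      ((hn.mul hct).add hent)))))).mono fun κ => (hCs κ).trans ?_
  simp only [Fintype.card_sum, Fintype.card_prod, Fintype.card_fin, Fintype.card_unit]
  omega

/-- With `T` the size of the distinguisher, the error is `2nε` from re-randomization, `n|Q|(n|Q| + n
+ T) / 2 ^ κ` from the entries off the path, and `n|Q| / 2 ^ κ` from sampling the states. The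
simulator is fixed before machine, input and distinguisher. -/
theorem secureAgainstSemiHonestClient (hQ : PolyBounded fun κ => (s κ).Q)
    (hA : PolyBounded fun κ => (s κ).A) (hn : PolyBounded fun κ => (s κ).n)
    (hcap : ∀ κ (g : Bits (Fin (E.genCoins κ))),
      2 ^ ((s κ).Q * (s κ).entryLen κ) ≤ E.modulus κ (E.gen κ g).1)
    (hrerand : E.Rerandomizable) : SecureAgainstSemiHonestClient E s := by
  intro auxLen haux
  obtain ⟨S, d, hS⟩ := exists_simulator (E := E) hQ hA hn haux
  obtain ⟨ε, hεneg, hε⟩ := hrerand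
  refine ⟨S, fun M x aux D => ?_⟩
  have hD : PolyBounded fun κ => (D.circuit κ).size := D.circuit_poly
  have hbound := ((((hεneg.const_mul 2).polyBounded_mul hn).add
    (negligible_one_div_two_pow.polyBounded_mul ((hn.mul hQ).mul
      ((hn.mul hQ).add (hn.add hD))))).add
    ((negligible_one_div_two_pow.polyBounded_mul hQ).polyBounded_mul hn))
  refine hbound.of_eventually_abs_le ?_
  filter_upwards [eventually_ne_atTop 0] with κ hκ
  have hdec : ∀ H v z r t, ∃ Y : Finset (Bits (Fin ((s κ).hashLen κ))),
      Y.card ≤ (D.circuit κ).size ∧ ∀ H' : Hash (s κ) κ, (∀ y ∈ Y, H' y = H y) →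
        D.decide κ H' v z r t = D.decide κ H v z r t := by
    intro H v z r t
    obtain ⟨Y, hY, hH⟩ := (D.circuit κ).exists_queries H
      (Sum.elim v (Sum.elim (Sum.elim (fun _ => z) (fun _ => r)) t))
    exact ⟨Y, hY, fun H' h => congrFun (hH H' h) ()⟩
  have h1 := abs_real_sub_le (D.decide κ) (M κ) (x κ) (aux κ) hκ (hcap κ) hε
  have h2 := abs_garble_sub_fill_le (D.decide κ) (M κ) (x κ) (aux κ) _ hdec
  have h3 := abs_states_sub_le (E := E) (D.decide κ) (M κ) (x κ) (aux κ)
  have hideal : idealProb E s auxLen S D κ (M κ) (x κ) (aux κ) =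
      prob (fun w : Hash (s κ) κ × Bool × Bits (Fin (S.coins κ)) × Bits (Fin (D.coins κ)) =>
        D.decide κ w.1 (simView w.1 (Sum.elim (aux κ) (Sum.elim (inputBits (x κ))
          (Sum.elim (fun _ => clientShare (M κ) (x κ) w.2.1) fun j => w.2.2.1 (d κ j)))))
          (clientShare (M κ) (x κ) w.2.1) w.2.1 w.2.2.2) := by
    unfold idealProb
    congr 1
    funext w
    dsimp only
    rw [hS]
    congr 2
    funext j
    rcases j with j | j | j | j <;> rfl
  rw [← prob_simView_eq (D.decide κ) (M κ) (x κ) (aux κ) (d κ), ← hideal] at h3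
  exact (abs_sub_le _ _ _).trans ((add_le_add ((abs_sub_le _ _ _).trans
    (add_le_add h1 h2)) h3))

end Client

end ObliviousFSM

theorem mainTheorem1
    (E : ObliviousFSM.HEScheme)
    (s : ℕ → ObliviousFSM.Sizes)
    (hQ : ObliviousFSM.PolyBounded fun κ => (s κ).Q)
    (hA : ObliviousFSM.PolyBounded fun κ => (s κ).A)
    (hn : ObliviousFSM.PolyBounded fun κ => (s κ).n)
    (hcap : ∀ κ (g : ObliviousFSM.Bits (Fin (E.genCoins κ))),
      2 ^ ((s κ).Q * (s κ).entryLen κ) ≤ E.modulus κ (E.gen κ g).1)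
    (hrerand : E.Rerandomizable)
    (hcpa : E.IndCPA (fun κ => (s κ).hashLen κ) (fun κ => (s κ).entryLen κ)) :
    ObliviousFSM.SecureAgainstSemiHonestClient E s ∧
      ObliviousFSM.PrivateAgainstMaliciousServer E s :=
  ⟨ObliviousFSM.secureAgainstSemiHonestClient hQ hA hn hcap hrerand,
    ObliviousFSM.privateAgainstMaliciousServer E s hA hn hcap hcpa⟩
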